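/- For random vectors $X\in\mathbb R^p$, $Y\in\mathbb R^q$ with characteristic functions $f_X,f_Y$ and joint characteristic function $f_{X,Y}$, the squared distance covariance is $$\mathcal V^2(X,Y)=\int_{\mathbb R^{p+q}}\frac{|f_{X,Y}(t,s)-f_X(t)f_Y(s)|^2}{c_pc_q\|t\|^{p+1}\|s\|^{q+1}}\,dt\,ds,\qquad c_p=\frac{\pi^{(p+1)/2}}{\Gamma((p+1)/2)},$$ and $\mathcal V^2(X)=\mathcal V^2(X,X)$; $\|\cdot\|$ is the Euclidean norm. For independent copies $X_1,X_2,X_3,X_4$ of $X$ put $$d(X_1,X_2)=\|X_1-X_2\|-\mathbb E[\|X_1-X_2\|\mid X_1]-\mathbb E[\|X_1-X_2\|\mid X_2]+\mathbb E\|X_1-X_2\|,$$ $$g(X_1,X_2,X_3,X_4)=d(X_1,X_2)\,d(X_1,X_3)\,d(X_2,X_4)\,d(X_3,X_4),$$ and similarly for $Y$. Given an i.i.d. sample $(X_i,Y_i)$, $1\le i\le n$, from $(X,Y)$, let $a_{kl}=\|X_k-X_l\|$, $$A^*_{kl}=a_{kl}-\frac1{n-2}\sum_{i=1}^n a_{il}-\frac1{n-2}\sum_{j=1}^n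 a_{kj}+\frac1{(n-1)(n-2)}\sum_{i,j=1}^n a_{ij},$$ let $B^*_{kl}$ be defined in the same way from $\|Y_k-Y_l\|$, and set $$\mathcal V_n^*(X,Y)=\frac1{n(n-3)}\sum_{k\ne l}A^*_{kl}B^*_{kl},\qquad \mathcal R_n^*(X,Y)=\frac{\mathcal V_n^*(X,Y)}{\sqrt{\mathcal V_n^*(X)\,\mathcal V_n^*(Y)}},$$ where $\mathcal V_n^*(X)=\mathcal V_n^*(X,X)$, $\mathcal V_n^*(Y)=\mathcal V_n^*(Y,Y)$, and $\mathcal R_n^*(X,Y)=0$ if $\mathcal V_n^*(X)\mathcal V_n^*(Y)=0$. Let $T_n=\sqrt{n(n-1)/2}\;\mathcal R_n^*(X,Y)$. **Theorem.** Consider any limiting regime of $(n,p,q)$ with $n\to\infty$ and $p+q\to\infty$, where the distribution of $(X,Y)$ on $\mathbb R^p\times\mathbb R^q$ may change along the regime. Let $0<\tau\le1$ be a fixed constant. Assume that, at every point of the regime, $X$ and $Y$ are independent, $\mathbb E\|X\|^{2+2\tau}+\mathbb E\|Y\|^{2+2\tau}<\infty$, and $\mathcal V^2(X),\mathcal V^2(Y)>0$.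 If $$\frac{\mathbb E\big(|d(X_1,X_2)|^{2+2\tau}\big)\,\mathbb E\big(|d(Y_1,Y_2)|^{2+2\tau}\big)}{n^\tau\,[\mathcal V^2(X)\mathcal V^2(Y)]^{1+\tau}}\to0$$ and $$\frac{\mathbb E[g(X_1,X_2,X_3,X_4)]\;\mathbb E[g(Y_1,Y_2,Y_3,Y_4)]}{[\mathcal V^2(X)\mathcal V^2(Y)]^2}\to0$$ along the regime, then $T_n$ converges in distribution to $N(0,1)$ along the regime. -/

import Mathlib

open MeasureTheory ProbabilityTheory Filter Topology

noncomputable section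

/-- `c_p = π^{(p+1)/2} / Γ((p+1)/2)`, the normalizing constant in the weight of the
distance covariance on `ℝ^p`. -/
def dcovConst (p : ℕ) : ℝ :=
  Real.pi ^ (((p : ℝ) + 1) / 2) / Real.Gamma (((p : ℝ) + 1) / 2)

/-- The joint characteristic function `f_{X,Y}(t,s) = E exp(i⟨t,X⟩ + i⟨s,Y⟩)`. -/
def jointCharFun {Ω : Type*} [MeasurableSpace Ω] {p q : ℕ} (P : Measure Ω)
    (X : Ω → EuclideanSpace ℝ (Fin p)) (Y : Ω → EuclideanSpace ℝ (Fin q))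
    (t : EuclideanSpace ℝ (Fin p)) (s : EuclideanSpace ℝ (Fin q)) : ℂ :=
  ∫ ω, Complex.exp (((inner ℝ t (X ω) + inner ℝ s (Y ω) : ℝ) : ℂ) * Complex.I) ∂P

/-- The squared distance covariance `𝒱²(X, Y)`: the weighted integral over `ℝ^p × ℝ^q` of
`|f_{X,Y}(t,s) - f_X(t) f_Y(s)|²` with weight `1 / (c_p c_q ‖t‖^{p+1} ‖s‖^{q+1})`. -/
def distCovSq {Ω : Type*} [MeasurableSpace Ω] {p q : ℕ} (P : Measure Ω)
    (X : Ω → EuclideanSpace ℝ (Fin p)) (Y : Ω → EuclideanSpace ℝ (Fin q)) : ℝ :=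
  ∫ z : EuclideanSpace ℝ (Fin p) × EuclideanSpace ℝ (Fin q),
    ‖jointCharFun P X Y z.1 z.2 - charFun (P.map X) z.1 * charFun (P.map Y) z.2‖ ^ 2 /
      (dcovConst p * dcovConst q * ‖z.1‖ ^ (p + 1) * ‖z.2‖ ^ (q + 1))

/-- The squared distance variance `𝒱²(X) = 𝒱²(X, X)`. -/
def distVarSq {Ω : Type*} [MeasurableSpace Ω] {p : ℕ} (P : Measure Ω)
    (X : Ω → EuclideanSpace ℝ (Fin p)) : ℝ :=
  distCovSq P X X

/-- The double-centered distance `d(x, x')` of a law `μ` on `ℝ^p`. For independent `X₁, X₂` with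
law `μ`, the conditional expectation of `‖X₁ - X₂‖` given `X₁ = x` is `∫ ‖x - z‖ dμ(z)`. -/
def doubleCentered {p : ℕ} (μ : Measure (EuclideanSpace ℝ (Fin p)))
    (x x' : EuclideanSpace ℝ (Fin p)) : ℝ :=
  ‖x - x'‖ - ∫ z, ‖x - z‖ ∂μ - ∫ z, ‖z - x'‖ ∂μ + ∫ z, ‖z.1 - z.2‖ ∂(μ.prod μ)

/-- `E |d(X₁, X₂)|^r`, where `X₁, X₂` are independent with law `μ`. -/
def doubleCenteredMoment {p : ℕ} (μ : Measure (EuclideanSpace ℝ (Fin p))) (r : ℝ) : ℝ :=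
  ∫ z, |doubleCentered μ z.1 z.2| ^ r ∂(μ.prod μ)

/-- `E g(X₁, X₂, X₃, X₄)`, where `X₁, …, X₄` are independent with law `μ` and
`g(x₁, x₂, x₃, x₄) = d(x₁, x₂) d(x₁, x₃) d(x₂, x₄) d(x₃, x₄)`. -/
def gMoment {p : ℕ} (μ : Measure (EuclideanSpace ℝ (Fin p))) : ℝ :=
  ∫ x : Fin 4 → EuclideanSpace ℝ (Fin p),
    doubleCentered μ (x 0) (x 1) * doubleCentered μ (x 0) (x 2) *
      doubleCentered μ (x 1) (x 3) * doubleCentered μ (x 2) (x 3) ∂(Measure.pi fun _ => μ)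

/-- The `𝒰`-centered distances `A*_{k,l}` of a sample `x₁, …, x_n` in `ℝ^p`. -/
def uCentered {n p : ℕ} (x : Fin n → EuclideanSpace ℝ (Fin p)) (k l : Fin n) : ℝ :=
  ‖x k - x l‖ - 1 / ((n : ℝ) - 2) * ∑ i, ‖x i - x l‖ - 1 / ((n : ℝ) - 2) * ∑ j, ‖x k - x j‖
    + 1 / (((n : ℝ) - 1) * ((n : ℝ) - 2)) * ∑ i, ∑ j, ‖x i - x j‖

/-- The bias-corrected sample distance covariance
`𝒱*_n(X, Y) = (n (n - 3))⁻¹ ∑_{k ≠ l} A*_{k,l} B*_{k,l}`. -/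
def sampleDistCov {n p q : ℕ} (x : Fin n → EuclideanSpace ℝ (Fin p))
    (y : Fin n → EuclideanSpace ℝ (Fin q)) : ℝ :=
  1 / ((n : ℝ) * ((n : ℝ) - 3)) *
    ∑ k, ∑ l, if k ≠ l then uCentered x k l * uCentered y k l else 0

/-- The bias-corrected sample distance correlation `ℛ*_n(X, Y)`, with
`𝒱*_n(X) = 𝒱*_n(X, X)` and `𝒱*_n(Y) = 𝒱*_n(Y, Y)`. -/
def sampleDistCorr {n p q : ℕ} (x : Fin n → EuclideanSpace ℝ (Fin p))
    (y : Fin n → EuclideanSpace ℝ (Fin q)) : ℝ :=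
  if 0 < sampleDistCov x x * sampleDistCov y y then
    sampleDistCov x y / √(sampleDistCov x x * sampleDistCov y y)
  else 0

/-- The rescaled statistic `T_n = √(n (n - 1) / 2) ℛ*_n(X, Y)`. -/
def rescaledDistCorr {n p q : ℕ} (x : Fin n → EuclideanSpace ℝ (Fin p))
    (y : Fin n → EuclideanSpace ℝ (Fin q)) : ℝ :=
  √((n : ℝ) * ((n : ℝ) - 1) / 2) * sampleDistCorr x y

end

/-! The statistic does not change when distances are replaced by multiples of $d$: off the diagonal,
$\|x-y\|$ and $d(x,y)$ differ by a term $u(x)+u(y)$, which U-centering kills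
(`uMatrix_eq_of_additive`), and a correlation is scale invariant (`uCorr_div`). So one works with
kernels $f,g$ proportional to $d$ and of unit second moment. They are degenerate: their mean over
one argument vanishes. By independence the product kernel $h=f\otimes g$ on pairs $Z=(X,Y)$ is
degenerate too. Values of a degenerate kernel at different index pairs are orthogonal, hence the
row-sum and total-sum corrections of U-centering are small: with $s^2=n(n-1)/2$, the numerator of
$T_n$ is $s^{-1}\sum_{k<l}h(Z_k,Z_l)$ up to $O(n^{-1/2})$ in $L^1$ (`integral_abs_uInner_sub_le`).
The sample variances tend to 1 in $L^1$ by a truncated weak law, and `norm_exp_studentized_sub_le`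
bounds the cost of dividing by them.

The central limit theorem for the $U$-statistic (`IsDegenerateKernel.norm_integral_exp_sub_le`) is a
martingale argument on characteristic functions. A new observation $Z_m$ adds the row
$\sum_{k<m}h(Z_k,Z_m)$; given the past it has mean 0 and variance $\sum_{k,l<m}(h\circ h)(Z_k,Z_l)$,
where $h\circ h$ is `composeKernel`. Telescoping $E\,e^{iuS_m}\,e^{V_m}$, with $V_m$ half the target
variance, leaves two errors per step. The Taylor remainder is bounded conditionally on $Z_m$, when
the row is a sum of i.i.d. variables, by truncation at $h^2\le\varepsilon^2n$. The distance of the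
conditional variance from its target splits into a diagonal, treated by a truncated law of large
numbers, and an off-diagonal sum of the degenerate kernel $h\circ h$, of size $m\|h\circ h\|_2$.

Thus only the tail of $h^2$ and $\|h\circ h\|_2$ matter. The first is at most the $(2+2\tau)$-moment
over a multiple of $n^\tau$, the second squared is the normalized expectation of the four-point
product $g$, and both factor over $X$ and $Y$: these are the two hypotheses. Normalized moments are
at least 1, so the product hypothesis also controls each marginal tail.

The hypotheses are normalized by $\mathcal V^2$, not by $E\,d^2$. Since $1-\cos\langle t,x\rangle$
integrates to $\|x\|$ against the weight, $-d(x,x')$ is the real part of the inner product of the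
centered characters of $x$ and $x'$ in the weighted $L^2$; Fubini then gives $\mathcal V^2\le
E\,d^2$ (`distVarSq_le`). This suffices, because a larger normalization only lowers both ratios. The
resulting error bound depends on $n$, the two ratios and a free $\eta$; the regime goes to its limit
first, then $\eta\to0$. -/

set_option linter.unusedSectionVars false

/-! ### Integration in one or two coordinates of a product measure -/

section CoordinateIntegration

variable {ι Z : Type*} [Fintype ι] [DecidableEq ι] [MeasurableSpace Z] {ρ : Measure Z}
  [IsProbabilityMeasure ρ]

/-- Resampling one coordinate of a product measure leaves the product measure unchanged. -/
lemma measurePreserving_update (l : ι) :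
    MeasurePreserving (fun p : (ι → Z) × Z => Function.update p.1 l p.2)
      ((Measure.pi fun _ : ι => ρ).prod ρ) (Measure.pi fun _ : ι => ρ) := by
  have hm : Measurable (fun p : (ι → Z) × Z => Function.update p.1 l p.2) := by
    refine measurable_pi_lambda _ fun i => ?_
    by_cases h : i = l
    · subst h; simpa using measurable_snd
    · simpa [Function.update_of_ne h, Function.comp_def] using (measurable_pi_apply i).comp
        measurable_fst
  refine ⟨hm, (Measure.pi_eq fun s hs => ?_).symm⟩
  rw [Measure.map_apply hm (.univ_pi hs)]
  have : (fun p : (ι → Z) × Z => Function.update p.1 l p.2) ⁻¹' (Set.univ.pi s) =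
      (Set.univ.pi (Function.update s l Set.univ)) ×ˢ (s l) := by
    ext p
    simp only [Set.mem_preimage, Set.mem_pi, Set.mem_univ, true_implies, Set.mem_prod]
    constructor
    · intro h
      refine ⟨fun i => ?_, by simpa using h l⟩
      by_cases hi : i = l
      · subst hi; simp
      · simpa [Function.update_of_ne hi] using h i
    · rintro ⟨h1, h2⟩ i
      by_cases hi : i = l
      · subst hi; simpa using h2
      · simpa [Function.update_of_ne hi] using h1 i
  rw [this, Measure.prod_prod, Measure.pi_pi,
    ← Finset.mul_prod_erase _ _ (Finset.mem_univ l),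
    ← Finset.mul_prod_erase (s := Finset.univ) (f := fun i => ρ (s i)) (Finset.mem_univ l)]
  rw [Finset.prod_congr rfl (g := fun i => ρ (s i))]
  · simp [mul_comm]
  · intro i hi
    rw [Function.update_of_ne (Finset.ne_of_mem_erase hi)]

variable {E : Type*} [NormedAddCommGroup E] [NormedSpace ℝ E]

lemma integral_pi_eq_integral_update (l : ι) {f : (ι → Z) → E}
    (hf : Integrable f (Measure.pi fun _ : ι => ρ)) :
    ∫ z, f z ∂(Measure.pi fun _ : ι => ρ) =
      ∫ z, ∫ w, f (Function.update z l w) ∂ρ ∂(Measure.pi fun _ : ι => ρ) := by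
  have h := measurePreserving_update (ρ := ρ) l
  have hf' := hf
  rw [← h.map_eq] at hf'
  rw [← integral_prod (fun p : (ι → Z) × Z => f (Function.update p.1 l p.2))
    (hf'.comp_measurable h.measurable)]
  conv_lhs => rw [← h.map_eq]
  rw [integral_map h.aemeasurable hf'.aestronglyMeasurable]

/-- Fubini in one coordinate. No integrability is assumed, because a non-integrable function has
Bochner integral 0 by convention. -/
lemma integral_pi_eq_zero (l : ι) {f : (ι → Z) → E}
    (h : ∀ᵐ z ∂(Measure.pi fun _ : ι => ρ), ∫ w, f (Function.update z l w) ∂ρ = 0) :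
    ∫ z, f z ∂(Measure.pi fun _ : ι => ρ) = 0 := by
  by_cases hf : Integrable f (Measure.pi fun _ : ι => ρ)
  · rw [integral_pi_eq_integral_update l hf, integral_congr_ae h]; simp
  · exact integral_undef hf

lemma measurePreserving_pair {k l : ι} (hkl : k ≠ l) :
    MeasurePreserving (fun z : ι → Z => (z k, z l)) (Measure.pi fun _ : ι => ρ) (ρ.prod ρ) := by
  refine ⟨(measurable_pi_apply k).prodMk (measurable_pi_apply l), ?_⟩
  have hi : iIndepFun (fun i (z : ι → Z) => z i) (Measure.pi fun _ : ι => ρ) :=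
    iIndepFun_pi (X := fun _ => id) fun _ => aemeasurable_id
  have := (indepFun_iff_map_prod_eq_prod_map_map (measurable_pi_apply k).aemeasurable
    (measurable_pi_apply l).aemeasurable).1 (hi.indepFun hkl)
  rw [this, (measurePreserving_eval (fun _ : ι => ρ) k).map_eq,
    (measurePreserving_eval (fun _ : ι => ρ) l).map_eq]

lemma ae_pi_of_ae (k : ι) {p : Z → Prop} (h : ∀ᵐ x ∂ρ, p x) :
    ∀ᵐ z ∂(Measure.pi fun _ : ι => ρ), p (z k) :=
  (measurePreserving_eval (fun _ : ι => ρ) k).quasiMeasurePreserving.ae h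

lemma integral_pi_pair {k l : ι} (hkl : k ≠ l) {f : Z × Z → E}
    (hf : AEStronglyMeasurable f (ρ.prod ρ)) :
    ∫ z, f (z k, z l) ∂(Measure.pi fun _ : ι => ρ) = ∫ p, f p ∂(ρ.prod ρ) := by
  have h := measurePreserving_pair (ρ := ρ) hkl
  conv_rhs => rw [← h.map_eq]
  rw [integral_map h.aemeasurable (by rwa [h.map_eq])]

end CoordinateIntegration

/-! ### Degenerate kernels and the orthogonality of their values -/

/-- A symmetric square-integrable kernel whose conditional expectation given one argument
vanishes. -/
structure IsDegenerateKernel {Z : Type*} [MeasurableSpace Z] (ρ : Measure Z) (h : Z → Z → ℝ) :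
    Prop where
  meas : Measurable (fun p : Z × Z => h p.1 p.2)
  symm : ∀ x y, h x y = h y x
  centered : ∀ᵐ x ∂ρ, ∫ y, h x y ∂ρ = 0
  memLp : MemLp (fun p : Z × Z => h p.1 p.2) 2 (ρ.prod ρ)

/-- The matrix of pairwise kernel values of a sample, with zero diagonal. -/
def offDiag {ι Z : Type*} [DecidableEq ι] (h : Z → Z → ℝ) (z : ι → Z) (k l : ι) : ℝ :=
  if k = l then 0 else h (z k) (z l)

/-- The second moment of a kernel. -/
noncomputable def kernelSq {Z : Type*} [MeasurableSpace Z] (ρ : Measure Z) (h : Z → Z → ℝ) : ℝ :=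
  ∫ p, h p.1 p.2 ^ 2 ∂(ρ.prod ρ)

namespace IsDegenerateKernel

variable {ι Z : Type*} [Fintype ι] [DecidableEq ι] [MeasurableSpace Z] {ρ : Measure Z}
  [IsProbabilityMeasure ρ] {h : Z → Z → ℝ}

lemma memLp_offDiag (hh : IsDegenerateKernel ρ h) (k l : ι) :
    MemLp (fun z : ι → Z => offDiag h z k l) 2 (Measure.pi fun _ : ι => ρ) := by
  unfold offDiag
  split_ifs with hkl
  · simp
  · exact hh.memLp.comp_measurePreserving (measurePreserving_pair hkl)

lemma integrable_offDiag_mul (hh : IsDegenerateKernel ρ h) (k l k' l' : ι) :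
    Integrable (fun z : ι → Z => offDiag h z k l * offDiag h z k' l')
      (Measure.pi fun _ : ι => ρ) :=
  (hh.memLp_offDiag k l).integrable_mul (hh.memLp_offDiag k' l')

lemma offDiag_symm (hh : IsDegenerateKernel ρ h) (z : ι → Z) (k l : ι) :
    offDiag h z k l = offDiag h z l k := by
  unfold offDiag
  simp only [eq_comm (a := k), hh.symm (z k)]

/-- An index that occurs only once makes the expectation vanish. -/
lemma integral_mul_offDiag_eq_zero (hh : IsDegenerateKernel ρ h) {k l : ι}
    {Φ : (ι → Z) → ℝ} (hΦ : ∀ z w, Φ (Function.update z l w) = Φ z) :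
    ∫ z, Φ z * offDiag h z k l ∂(Measure.pi fun _ : ι => ρ) = 0 := by
  by_cases hkl : k = l
  · simp [offDiag, hkl]
  refine integral_pi_eq_zero l ?_
  filter_upwards [ae_pi_of_ae k hh.centered] with z hz
  simp [offDiag, hkl, hΦ, integral_const_mul, hz]

/-- The covariances of the pairwise kernel values. -/
lemma integral_offDiag_mul (hh : IsDegenerateKernel ρ h) (k l k' l' : ι) :
    ∫ z, offDiag h z k l * offDiag h z k' l' ∂(Measure.pi fun _ : ι => ρ) =
      if k = l then 0 else kernelSq ρ h *
        ((if k = k' ∧ l = l' then 1 else 0) + (if k = l' ∧ l = k' then 1 else 0)) := by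
  by_cases hkl : k = l
  · simp [offDiag, hkl]
  rw [if_neg hkl]
  by_cases hkl' : k' = l'
  · subst hkl'
    have : ¬ (k = k' ∧ l = k') := fun h => hkl (h.1.trans h.2.symm)
    simp [offDiag, this]
  have key : ∫ z, offDiag h z k l * offDiag h z k l ∂(Measure.pi fun _ : ι => ρ)
      = kernelSq ρ h := by
    simp only [offDiag, if_neg hkl, kernelSq, ← sq]
    exact integral_pi_pair hkl (f := fun p : Z × Z => h p.1 p.2 ^ 2)
      (hh.meas.pow_const 2).aestronglyMeasurable
  have upd : ∀ {a b c : ι}, a ≠ c → b ≠ c → ∀ (z : ι → Z) (w : Z),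
      offDiag h (Function.update z c w) a b = offDiag h z a b := by
    intro a b c ha hb z w
    simp [offDiag, Function.update_of_ne ha, Function.update_of_ne hb]
  -- Unless the two pairs agree as sets, some index occurs in one pair only, and integrating that
  -- coordinate first gives 0. The free index is `l'`, `k` or `l` according to the case; symmetry of
  -- the kernel moves it to the second slot.
  by_cases h1 : l = k' ∨ l = l'
  · rcases h1 with rfl | rfl
    · by_cases h2 : k = l'
      · subst h2
        simp only [hkl, false_and, if_false, zero_add, and_self, if_true, mul_one]
        rw [← key]
        simp_rw [hh.offDiag_symm _ l k]
      · simp only [hkl, h2, false_and, if_false, zero_add, mul_zero]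
        exact hh.integral_mul_offDiag_eq_zero (upd h2 hkl')
    · by_cases h2 : k = k'
      · subst h2
        simp only [hkl, false_and, if_false, add_zero, and_self, if_true, mul_one]
        exact key
      · simp only [hkl, h2, false_and, if_false, zero_add, mul_zero]
        simp_rw [hh.offDiag_symm _ k l, mul_comm (offDiag h _ l k)]
        exact hh.integral_mul_offDiag_eq_zero (upd (Ne.symm h2) (Ne.symm hkl))
  · push Not at h1
    simp only [h1.1, h1.2, and_false, if_false, add_zero, mul_zero]
    simp_rw [mul_comm (offDiag h _ k l)]
    exact hh.integral_mul_offDiag_eq_zero (upd h1.1.symm h1.2.symm)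

/-- The second moment of a weighted sum of pairwise kernel values. -/
lemma integral_sum_offDiag_sq (hh : IsDegenerateKernel ρ h) (c : ι → ι → ℝ) :
    ∫ z, (∑ k, ∑ l, c k l * offDiag h z k l) ^ 2 ∂(Measure.pi fun _ : ι => ρ) =
      kernelSq ρ h * ∑ k, ∑ l, if k = l then 0 else c k l * (c k l + c l k) := by
  have e : ∀ z : ι → Z, (∑ k, ∑ l, c k l * offDiag h z k l) ^ 2 =
      ∑ k, ∑ l, ∑ k', ∑ l', c k l * c k' l' * (offDiag h z k l * offDiag h z k' l') := by
    intro z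
    simp only [sq, Finset.sum_mul, Finset.mul_sum]
    refine Finset.sum_congr rfl fun k _ => Finset.sum_congr rfl fun l _ =>
      Finset.sum_congr rfl fun k' _ => Finset.sum_congr rfl fun l' _ => by ring
  simp_rw [e]
  have hi : ∀ k l k' l', Integrable (fun z : ι → Z =>
      c k l * c k' l' * (offDiag h z k l * offDiag h z k' l')) (Measure.pi fun _ : ι => ρ) :=
    fun k l k' l' => (hh.integrable_offDiag_mul k l k' l').const_mul _
  rw [integral_finsetSum _ fun k _ => integrable_finsetSum _ fun l _ =>
    integrable_finsetSum _ fun k' _ => integrable_finsetSum _ fun l' _ => hi k l k' l',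
    Finset.mul_sum]
  refine Finset.sum_congr rfl fun k _ => ?_
  rw [integral_finsetSum _ fun l _ =>
    integrable_finsetSum _ fun k' _ => integrable_finsetSum _ fun l' _ => hi k l k' l',
    Finset.mul_sum]
  refine Finset.sum_congr rfl fun l _ => ?_
  rw [integral_finsetSum _ fun k' _ => integrable_finsetSum _ fun l' _ => hi k l k' l']
  simp_rw [integral_finsetSum _ fun l' _ => hi k l _ l', integral_const_mul,
    hh.integral_offDiag_mul]
  by_cases hkl : k = l
  · simp [hkl]
  simp only [if_neg hkl]
  have : ∀ k' l', c k l * c k' l' * (kernelSq ρ h *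
      ((if k = k' ∧ l = l' then (1:ℝ) else 0) + (if k = l' ∧ l = k' then 1 else 0))) =
      (if k = k' then (if l = l' then kernelSq ρ h * (c k l * c k' l') else 0) else 0) +
      (if l = k' then (if k = l' then kernelSq ρ h * (c k l * c k' l') else 0) else 0) := by
    intro k' l'
    simp only [ite_and]
    split_ifs <;> ring
  simp_rw [this, Finset.sum_add_distrib]
  simp
  ring

end IsDegenerateKernel

/-! ### Moments and Lindeberg remainders of sums of i.i.d. variables -/

section IndependentSums

variable {ι Z : Type*} [Fintype ι] [DecidableEq ι] [MeasurableSpace Z] {ρ : Measure Z}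
  [IsProbabilityMeasure ρ]

lemma integral_pi_mul_eval {k : ι} {Φ : (ι → Z) → ℝ} {g : Z → ℝ}
    (hΦ : ∀ z w, Φ (Function.update z k w) = Φ z)
    (hi : Integrable (fun z => Φ z * g (z k)) (Measure.pi fun _ : ι => ρ)) :
    ∫ z, Φ z * g (z k) ∂(Measure.pi fun _ : ι => ρ) =
      (∫ z, Φ z ∂(Measure.pi fun _ : ι => ρ)) * ∫ w, g w ∂ρ := by
  rw [integral_pi_eq_integral_update k hi]
  simp [hΦ, integral_const_mul, integral_mul_const]

lemma integral_pi_eval (k : ι) {g : Z → ℝ} (hg : AEStronglyMeasurable g ρ) :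
    ∫ z, g (z k) ∂(Measure.pi fun _ : ι => ρ) = ∫ w, g w ∂ρ := by
  have h := measurePreserving_eval (fun _ : ι => ρ) k
  conv_rhs => rw [← h.map_eq]
  rw [integral_map h.aemeasurable (by rwa [h.map_eq])]

lemma sum_eval_update {f : Z → ℝ} {k : ι} {J : Finset ι} (hk : k ∉ J) (z : ι → Z) (w : Z) :
    ∑ i ∈ J, f (Function.update z k w i) = ∑ i ∈ J, f (z i) :=
  Finset.sum_congr rfl fun i hi => by
    rw [Function.update_of_ne (by rintro rfl; exact hk hi)]

lemma memLp_sum_eval {f : Z → ℝ} {r : ENNReal} (hf : MemLp f r ρ) (J : Finset ι) :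
    MemLp (fun z : ι → Z => ∑ i ∈ J, f (z i)) r (Measure.pi fun _ : ι => ρ) :=
  memLp_finsetSum _ fun i _ => hf.comp_measurePreserving (measurePreserving_eval (fun _ => ρ) i)

lemma integral_sum_eval_sq {f : Z → ℝ} (hf : MemLp f 2 ρ) (hf0 : ∫ w, f w ∂ρ = 0)
    (J : Finset ι) :
    ∫ z, (∑ i ∈ J, f (z i)) ^ 2 ∂(Measure.pi fun _ : ι => ρ) = J.card * ∫ w, f w ^ 2 ∂ρ := by
  induction J using Finset.induction_on with
  | empty => simp
  | insert k J hk ih =>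
    have hS := memLp_sum_eval hf J
    have hk2 : MemLp (fun z : ι → Z => f (z k)) 2 (Measure.pi fun _ : ι => ρ) :=
      hf.comp_measurePreserving (measurePreserving_eval (fun _ => ρ) k)
    have e : ∀ z : ι → Z, (∑ i ∈ insert k J, f (z i)) ^ 2 =
        (∑ i ∈ J, f (z i)) ^ 2 + 2 * ((∑ i ∈ J, f (z i)) * f (z k)) + f (z k) ^ 2 := by
      intro z; rw [Finset.sum_insert hk]; ring
    simp_rw [e]
    have hi := (hS.integrable_mul hk2).const_mul 2
    rw [integral_add, integral_add, ih,
      integral_const_mul, integral_pi_mul_eval (sum_eval_update hk) (hS.integrable_mul hk2), hf0,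
      integral_pi_eval k (g := fun w => f w ^ 2) (hf.1.pow 2), Finset.card_insert_of_notMem hk]
    · push_cast; ring
    · exact hS.integrable_sq
    · exact hi
    · exact hS.integrable_sq.add hi
    · exact hk2.integrable_sq

lemma sq_integral_le_integral_sq {Ω : Type*} [MeasurableSpace Ω] {P : Measure Ω}
    [IsProbabilityMeasure P] {f : Ω → ℝ} (hf : MemLp f 2 P) :
    (∫ x, f x ∂P) ^ 2 ≤ ∫ x, f x ^ 2 ∂P := by
  have := variance_nonneg f P
  rw [variance_eq_sub hf] at this
  simp only [Pi.pow_apply] at this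
  linarith

lemma integral_abs_le_sqrt {Ω : Type*} [MeasurableSpace Ω] {P : Measure Ω}
    [IsProbabilityMeasure P] {f : Ω → ℝ} (hf : MemLp f 2 P) :
    ∫ x, |f x| ∂P ≤ √(∫ x, f x ^ 2 ∂P) := by
  refine Real.le_sqrt_of_sq_le ?_
  simpa using sq_integral_le_integral_sq hf.abs

lemma integral_sub_mean_sq_le {Ω : Type*} [MeasurableSpace Ω] {P : Measure Ω}
    [IsProbabilityMeasure P] {f : Ω → ℝ} (hf : MemLp f 2 P) :
    ∫ x, (f x - ∫ y, f y ∂P) ^ 2 ∂P ≤ ∫ x, f x ^ 2 ∂P := by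
  have h1 := variance_eq_integral (μ := P) hf.1.aemeasurable
  have h2 := variance_eq_sub hf
  simp only [Pi.pow_apply] at h2
  rw [← h1, h2]
  linarith [sq_nonneg (∫ x, f x ∂P)]

/-- Fourth moment of a sum of independent centered bounded variables. -/
lemma integral_sum_eval_pow_four_le {f : Z → ℝ} (hf : Measurable f) {K : ℝ}
    (hK : ∀ z, |f z| ≤ K) (hf0 : ∫ w, f w ∂ρ = 0) (J : Finset ι) :
    ∫ z, (∑ i ∈ J, f (z i)) ^ 4 ∂(Measure.pi fun _ : ι => ρ) ≤
      3 * (J.card : ℝ) ^ 2 * ∫ w, f w ^ 4 ∂ρ := by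
  have hLp : MemLp f 2 ρ := MemLp.of_bound hf.aestronglyMeasurable K (Eventually.of_forall hK)
  have hmS : ∀ J : Finset ι, Measurable (fun z : ι → Z => ∑ i ∈ J, f (z i)) := fun J =>
    Finset.measurable_sum _ fun i _ => hf.comp (measurable_pi_apply i)
  have hbS : ∀ (J : Finset ι) (z : ι → Z), |∑ i ∈ J, f (z i)| ≤ J.card * K := fun J z =>
    (Finset.abs_sum_le_sum_abs _ _).trans
      ((Finset.sum_le_sum fun i _ => hK (z i)).trans (by simp))
  have hint : ∀ (J : Finset ι) (k : ι) (a b : ℕ),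
      Integrable (fun z : ι → Z => (∑ i ∈ J, f (z i)) ^ a * f (z k) ^ b)
        (Measure.pi fun _ : ι => ρ) := by
    intro J k a b
    refine Integrable.of_bound (((hmS J).pow_const a).mul
      ((hf.comp (measurable_pi_apply k)).pow_const b)).aestronglyMeasurable
      ((J.card * K) ^ a * K ^ b) (Eventually.of_forall fun z => ?_)
    simp only [norm_mul, norm_pow, Real.norm_eq_abs]
    have hK0 : 0 ≤ K := (abs_nonneg _).trans (hK (z k))
    gcongr
    · exact hbS J z
    · exact hK _
  have hM : (∫ w, f w ^ 2 ∂ρ) ^ 2 ≤ ∫ w, f w ^ 4 ∂ρ := by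
    have hLp2 : MemLp (fun w => f w ^ 2) 2 ρ :=
      MemLp.of_bound (hf.pow_const 2).aestronglyMeasurable (K ^ 2) (Eventually.of_forall fun z => by
        rw [norm_pow, Real.norm_eq_abs]; gcongr; exact hK z)
    refine (sq_integral_le_integral_sq hLp2).trans_eq ?_
    simp_rw [← pow_mul]
  have hM0 : 0 ≤ ∫ w, f w ^ 4 ∂ρ := integral_nonneg fun w => by positivity
  induction J using Finset.induction_on with
  | empty => simp
  | insert k J hk ih =>
    have e : ∀ z : ι → Z, (∑ i ∈ insert k J, f (z i)) ^ 4 =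
        (∑ i ∈ J, f (z i)) ^ 4 * f (z k) ^ 0 + 4 * ((∑ i ∈ J, f (z i)) ^ 3 * f (z k) ^ 1)
        + 6 * ((∑ i ∈ J, f (z i)) ^ 2 * f (z k) ^ 2)
        + 4 * ((∑ i ∈ J, f (z i)) ^ 1 * f (z k) ^ 3)
        + (∑ i ∈ J, f (z i)) ^ 0 * f (z k) ^ 4 := by
      intro z; rw [Finset.sum_insert hk]; ring
    have hval : ∀ a b, ∫ z, (∑ i ∈ J, f (z i)) ^ a * f (z k) ^ b ∂(Measure.pi fun _ : ι => ρ) =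
        (∫ z, (∑ i ∈ J, f (z i)) ^ a ∂(Measure.pi fun _ : ι => ρ)) * ∫ w, f w ^ b ∂ρ := by
      intro a b
      exact integral_pi_mul_eval (Φ := fun z => (∑ i ∈ J, f (z i)) ^ a) (g := fun w => f w ^ b)
        (fun z w => by simp only [sum_eval_update hk]) (hint J k a b)
    have h1 : ∫ z, (∑ i ∈ J, f (z i)) ^ 1 ∂(Measure.pi fun _ : ι => ρ) = 0 := by
      simp_rw [pow_one]
      have hi : ∀ i, Integrable (fun z : ι → Z => f (z i)) (Measure.pi fun _ : ι => ρ) := fun i =>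
        (hLp.comp_measurePreserving
          (measurePreserving_eval (fun _ : ι => ρ) i)).integrable (by norm_num)
      rw [integral_finsetSum _ fun i _ => hi i]
      refine Finset.sum_eq_zero fun i _ => ?_
      rw [integral_pi_eval i hf.aestronglyMeasurable, hf0]
    have h2 := integral_sum_eval_sq hLp hf0 J
    have hf1 : ∫ w, f w ^ 1 ∂ρ = 0 := by simpa using hf0
    simp_rw [e]
    rw [integral_add, integral_add, integral_add, integral_add, integral_const_mul,
      integral_const_mul, integral_const_mul, hval, hval, hval, hval, hval, h1, hf1, h2,
      Finset.card_insert_of_notMem hk]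
    · simp only [pow_zero, integral_const, probReal_univ, smul_eq_mul, mul_one, mul_zero, zero_mul,
        add_zero, one_mul]
      push_cast
      -- Jensen bounds the cross term $6m(E f^2)^2$ by $6m\,E f^4$, and the induction closes because
      -- $3m^2+6m+1\le3(m+1)^2$.
      have : (J.card : ℝ) * (∫ w, f w ^ 2 ∂ρ) ^ 2 ≤ J.card * ∫ w, f w ^ 4 ∂ρ := by gcongr
      nlinarith
    all_goals first
      | exact hint J k _ _
      | exact (hint J k _ _).const_mul _
      | skip
    · exact (hint J k _ _).add ((hint J k _ _).const_mul _)
    · exact ((hint J k _ _).add ((hint J k _ _).const_mul _)).add ((hint J k _ _).const_mul _)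
    · exact (((hint J k _ _).add ((hint J k _ _).const_mul _)).add
        ((hint J k _ _).const_mul _)).add ((hint J k _ _).const_mul _)

/-- The larger of $|a|,|b|$ decides: if it is $|a|$, use the cube and $2|a|^3\le\delta
a^2+a^4/\delta$; otherwise use the square. Here $a$ stands for a bounded part with a fourth moment
and $b$ for a tail of which only the variance is known. -/
lemma min_sq_abs_cube_add_le (a b : ℝ) {δ : ℝ} (hδ : 0 < δ) :
    min ((a + b) ^ 2) (|a + b| ^ 3) ≤ 4 * (δ * a ^ 2 + a ^ 4 / δ) + 4 * b ^ 2 := by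
  have h0 : 2 * |a| ^ 3 ≤ δ * a ^ 2 + a ^ 4 / δ := by
    have h1 : a ^ 2 = |a| ^ 2 := (sq_abs a).symm
    have h2 : a ^ 4 = |a| ^ 4 := by rw [show 4 = 2 * 2 from rfl, pow_mul, pow_mul, sq_abs]
    rw [h1, h2]
    have : δ * |a| ^ 2 + |a| ^ 4 / δ - 2 * |a| ^ 3 = |a| ^ 2 * (δ - |a|) ^ 2 / δ := by
      field_simp; ring
    have : 0 ≤ |a| ^ 2 * (δ - |a|) ^ 2 / δ := by positivity
    linarith
  rcases le_total |b| |a| with h | h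
  · refine (min_le_right _ _).trans ?_
    have : |a + b| ≤ 2 * |a| := (abs_add_le a b).trans (by linarith)
    calc |a + b| ^ 3 ≤ (2 * |a|) ^ 3 := by gcongr
      _ = 4 * (2 * |a| ^ 3) := by ring
      _ ≤ _ := by nlinarith [sq_nonneg b]
  · refine (min_le_left _ _).trans ?_
    have h3 : a ^ 2 ≤ b ^ 2 := sq_le_sq.2 h
    have : 0 ≤ δ * a ^ 2 + a ^ 4 / δ := by positivity
    nlinarith [sq_nonneg (a - b)]

/-- The Lindeberg-type remainder of a sum of independent identically distributed centered
variables. -/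
lemma integral_min_sum_eval_le {f : Z → ℝ} (hf : Measurable f) (hf2 : MemLp f 2 ρ)
    (hf0 : ∫ w, f w ∂ρ = 0) (J : Finset ι) {δ c : ℝ} (hδ : 0 < δ) (hc : 0 ≤ c) (u : ℝ) :
    ∫ z, min ((u * ∑ i ∈ J, f (z i)) ^ 2) (|u * ∑ i ∈ J, f (z i)| ^ 3)
        ∂(Measure.pi fun _ : ι => ρ) ≤
      4 * δ * u ^ 2 * J.card * ∫ w, f w ^ 2 ∂ρ
        + 48 / δ * u ^ 4 * (J.card : ℝ) ^ 2 * c * ∫ w, f w ^ 2 ∂ρ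
        + 4 * u ^ 2 * J.card * ∫ w, (if c < f w ^ 2 then f w ^ 2 else 0) ∂ρ := by
  have p₁ : 0 ≤ 4 * δ * u ^ 2 := by positivity
  have p₂ : 0 ≤ 4 / δ * u ^ 4 := by positivity
  have p₃ : 0 ≤ 4 * u ^ 2 := by positivity
  have p₄ : 0 ≤ 3 * (J.card : ℝ) ^ 2 := by positivity
  -- Truncation at $f^2\le c$. Both parts are recentered; their means cancel since $f$ is centered,
  -- so the recentered parts still add up to $f$.
  set f₁ : Z → ℝ := fun w => if c < f w ^ 2 then 0 else f w with hf₁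
  set f₂ : Z → ℝ := fun w => if c < f w ^ 2 then f w else 0 with hf₂
  have hset : MeasurableSet {w | c < f w ^ 2} := measurableSet_lt measurable_const (hf.pow_const 2)
  have m₁ : Measurable f₁ := Measurable.ite hset measurable_const hf
  have m₂ : Measurable f₂ := Measurable.ite hset hf measurable_const
  have L₁ : MemLp f₁ 2 ρ := hf2.mono m₁.aestronglyMeasurable (Eventually.of_forall fun w => by
    simp only [hf₁]; split_ifs <;> simp)
  have L₂ : MemLp f₂ 2 ρ := hf2.mono m₂.aestronglyMeasurable (Eventually.of_forall fun w => by
    simp only [hf₂]; split_ifs <;> simp)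
  have bd₁ : ∀ w, |f₁ w| ≤ √c := by
    intro w
    simp only [hf₁]
    split_ifs with h
    · simp
    · exact Real.abs_le_sqrt (not_lt.1 h)
  set a₁ := ∫ w, f₁ w ∂ρ with ha₁
  set a₂ := ∫ w, f₂ w ∂ρ with ha₂
  have ha : a₁ + a₂ = 0 := by
    rw [ha₁, ha₂, ← integral_add (L₁.integrable (by norm_num)) (L₂.integrable (by norm_num)), ← hf0]
    refine integral_congr_ae (Eventually.of_forall fun w => ?_)
    simp only [hf₁, hf₂]; split_ifs <;> simp
  have hsum : ∀ w, f w = (f₁ w - a₁) + (f₂ w - a₂) := by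
    intro w
    have : f w = f₁ w + f₂ w := by simp only [hf₁, hf₂]; split_ifs <;> simp
    linarith
  have ba₁ : |a₁| ≤ √c := by
    have := norm_integral_le_of_norm_le_const (μ := ρ) (f := f₁) (C := √c)
      (Eventually.of_forall bd₁)
    simpa using this
  have g₁b : ∀ w, |f₁ w - a₁| ≤ 2 * √c := fun w => (abs_sub _ _).trans (by
    linarith [bd₁ w])
  have g₁L : MemLp (fun w => f₁ w - a₁) 2 ρ := L₁.sub (memLp_const _)
  have g₂L : MemLp (fun w => f₂ w - a₂) 2 ρ := L₂.sub (memLp_const _)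
  have g₁0 : ∫ w, (f₁ w - a₁) ∂ρ = 0 := by
    rw [integral_sub (L₁.integrable (by norm_num)) (integrable_const _)]; simp [ha₁]
  have g₂0 : ∫ w, (f₂ w - a₂) ∂ρ = 0 := by
    rw [integral_sub (L₂.integrable (by norm_num)) (integrable_const _)]; simp [ha₂]
  have v₁ : ∫ w, (f₁ w - a₁) ^ 2 ∂ρ ≤ ∫ w, f w ^ 2 ∂ρ := by
    refine (integral_sub_mean_sq_le L₁).trans (integral_mono L₁.integrable_sq hf2.integrable_sq ?_)
    intro w; simp only [hf₁]; split_ifs <;> simp [sq_nonneg]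
  have v₂ : ∫ w, (f₂ w - a₂) ^ 2 ∂ρ ≤ ∫ w, (if c < f w ^ 2 then f w ^ 2 else 0) ∂ρ := by
    refine (integral_sub_mean_sq_le L₂).trans_eq (integral_congr_ae (Eventually.of_forall ?_))
    intro w; simp only [hf₂]; split_ifs <;> simp
  -- Two of the four factors are bounded by $2\sqrt c$. The 48 of the statement is $4\cdot3\cdot4$:
  -- the pointwise bound, the fourth-moment constant, and this $4c$.
  have q₁ : ∫ w, (f₁ w - a₁) ^ 4 ∂ρ ≤ 4 * c * ∫ w, f w ^ 2 ∂ρ := by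
    calc ∫ w, (f₁ w - a₁) ^ 4 ∂ρ ≤ ∫ w, 4 * c * (f₁ w - a₁) ^ 2 ∂ρ := by
          refine integral_mono_of_nonneg (Eventually.of_forall fun w => by positivity)
            (g₁L.integrable_sq.const_mul _) (Eventually.of_forall fun w => ?_)
          have h1 : (f₁ w - a₁) ^ 2 ≤ 4 * c := by
            have := pow_le_pow_left₀ (abs_nonneg _) (g₁b w) 2
            rw [sq_abs, mul_pow, Real.sq_sqrt hc] at this
            linarith
          calc (f₁ w - a₁) ^ 4 = (f₁ w - a₁) ^ 2 * (f₁ w - a₁) ^ 2 := by ring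
            _ ≤ 4 * c * (f₁ w - a₁) ^ 2 := by gcongr
      _ ≤ _ := by rw [integral_const_mul]; gcongr
  have s₁ := integral_sum_eval_sq (ι := ι) g₁L g₁0 J
  have s₂ := integral_sum_eval_sq (ι := ι) g₂L g₂0 J
  have s₄ := integral_sum_eval_pow_four_le (ι := ι) (m₁.sub_const a₁) g₁b g₁0 J
  have i₁ := (memLp_sum_eval (ι := ι) g₁L J).integrable_sq
  have i₂ := (memLp_sum_eval (ι := ι) g₂L J).integrable_sq
  have i₄ : Integrable (fun z : ι → Z => (∑ i ∈ J, (f₁ (z i) - a₁)) ^ 4)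
      (Measure.pi fun _ : ι => ρ) := by
    refine Integrable.of_bound ((Finset.measurable_sum _ fun i _ =>
      (m₁.sub_const a₁).comp (measurable_pi_apply i)).pow_const 4).aestronglyMeasurable
      ((J.card * (2 * √c)) ^ 4) (Eventually.of_forall fun z => ?_)
    rw [norm_pow, Real.norm_eq_abs]
    gcongr
    exact (Finset.abs_sum_le_sum_abs _ _).trans
      ((Finset.sum_le_sum fun i _ => g₁b (z i)).trans (by simp))
  calc ∫ z, min ((u * ∑ i ∈ J, f (z i)) ^ 2) (|u * ∑ i ∈ J, f (z i)| ^ 3)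
        ∂(Measure.pi fun _ : ι => ρ)
      ≤ ∫ z, (4 * δ * u ^ 2 * (∑ i ∈ J, (f₁ (z i) - a₁)) ^ 2 +
          4 / δ * u ^ 4 * (∑ i ∈ J, (f₁ (z i) - a₁)) ^ 4 +
          4 * u ^ 2 * (∑ i ∈ J, (f₂ (z i) - a₂)) ^ 2) ∂(Measure.pi fun _ : ι => ρ) := by
        refine integral_mono_of_nonneg (Eventually.of_forall fun z => by positivity)
          (((i₁.const_mul _).add (i₄.const_mul _)).add (i₂.const_mul _))
          (Eventually.of_forall fun z => ?_)
        have e : u * ∑ i ∈ J, f (z i) =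
            u * ∑ i ∈ J, (f₁ (z i) - a₁) + u * ∑ i ∈ J, (f₂ (z i) - a₂) := by
          rw [← mul_add, ← Finset.sum_add_distrib]
          simp_rw [← hsum]
        simp only [e]
        refine (min_sq_abs_cube_add_le _ _ hδ).trans_eq ?_
        ring
    _ = 4 * δ * u ^ 2 * (J.card * ∫ w, (f₁ w - a₁) ^ 2 ∂ρ) +
        4 / δ * u ^ 4 * (∫ z, (∑ i ∈ J, (f₁ (z i) - a₁)) ^ 4 ∂(Measure.pi fun _ : ι => ρ)) +
        4 * u ^ 2 * (J.card * ∫ w, (f₂ w - a₂) ^ 2 ∂ρ) := by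
        rw [integral_add, integral_add, integral_const_mul, integral_const_mul,
          integral_const_mul, s₁, s₂]
        · exact i₁.const_mul _
        · exact i₄.const_mul _
        · exact (i₁.const_mul _).add (i₄.const_mul _)
        · exact i₂.const_mul _
    _ ≤ 4 * δ * u ^ 2 * (J.card * ∫ w, f w ^ 2 ∂ρ) +
        4 / δ * u ^ 4 * (3 * (J.card : ℝ) ^ 2 * (4 * c * ∫ w, f w ^ 2 ∂ρ)) +
        4 * u ^ 2 * (J.card * ∫ w, (if c < f w ^ 2 then f w ^ 2 else 0) ∂ρ) := by
        have hJ : (0 : ℝ) ≤ J.card := Nat.cast_nonneg _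
        refine add_le_add (add_le_add ?_ ?_) ?_
        · exact mul_le_mul_of_nonneg_left (mul_le_mul_of_nonneg_left v₁ hJ) p₁
        · exact mul_le_mul_of_nonneg_left
            (s₄.trans (mul_le_mul_of_nonneg_left q₁ p₄)) p₂
        · exact mul_le_mul_of_nonneg_left (mul_le_mul_of_nonneg_left v₂ hJ) p₃
    _ = _ := by ring

end IndependentSums

/-! ### Composition of a kernel with itself -/

noncomputable section

/-- The kernel `(x, y) ↦ E h(x, W) h(y, W)`, with `W` of law `ρ`. -/
def composeKernel {Z : Type*} [MeasurableSpace Z] (ρ : Measure Z) (h : Z → Z → ℝ) (x y : Z) : ℝ :=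
  ∫ w, h x w * h y w ∂ρ

/-- The part of the second moment of a kernel that comes from the values with square above `c`. -/
def tailSq {Z : Type*} [MeasurableSpace Z] (ρ : Measure Z) (h : Z → Z → ℝ) (c : ℝ) : ℝ :=
  ∫ p, (if c < h p.1 p.2 ^ 2 then h p.1 p.2 ^ 2 else 0) ∂(ρ.prod ρ)

end

/-- Exchange of the two middle factors. It serves to regroup four independent points, and to view
two points of a product space as a pair in each factor. -/
lemma measurePreserving_prodProdProdComm {α β γ δ : Type*} [MeasurableSpace α] [MeasurableSpace β]
    [MeasurableSpace γ] [MeasurableSpace δ] (a : Measure α) (b : Measure β) (c : Measure γ)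
    (d : Measure δ) [SFinite a] [SFinite b] [SFinite c] [SFinite d] :
    MeasurePreserving (fun r : (α × β) × (γ × δ) => ((r.1.1, r.2.1), (r.1.2, r.2.2)))
      ((a.prod b).prod (c.prod d)) ((a.prod c).prod (b.prod d)) := by
  have h1 := measurePreserving_prodAssoc a b (c.prod d)
  have h2 := (MeasurePreserving.id a).prod ((measurePreserving_prodAssoc b c d).symm)
  have h3 := (MeasurePreserving.id a).prod
    ((Measure.measurePreserving_swap (μ := b) (ν := c)).prod (MeasurePreserving.id d))
  have h4 := (MeasurePreserving.id a).prod (measurePreserving_prodAssoc c b d)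
  have h5 := (measurePreserving_prodAssoc a c (b.prod d)).symm
  exact h5.comp (h4.comp (h3.comp (h2.comp h1)))

section FourFold

variable {Z : Type*} [MeasurableSpace Z] {ρ : Measure Z} [IsProbabilityMeasure ρ] {h : Z → Z → ℝ}

/-- Group the four factors as $h(x,v)h(y,w)$ and $h(x,w)h(y,v)$. Within a group the variables are
disjoint, so each squared group is a product of two integrable copies of $h^2$, and $2ab\le a^2+b^2$
finishes. -/
lemma integrable_fourfold (hm : Measurable (fun p : Z × Z => h p.1 p.2))
    (hL : MemLp (fun p : Z × Z => h p.1 p.2) 2 (ρ.prod ρ)) :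
    Integrable (fun r : (Z × Z) × (Z × Z) =>
      (h r.1.1 r.2.1 * h r.1.2 r.2.1) * (h r.1.1 r.2.2 * h r.1.2 r.2.2))
      ((ρ.prod ρ).prod (ρ.prod ρ)) := by
  have hmp := measurePreserving_prodProdProdComm ρ ρ ρ ρ
  have hmp' : MeasurePreserving (fun r : (Z × Z) × (Z × Z) => ((r.1.1, r.2.2), (r.1.2, r.2.1)))
      ((ρ.prod ρ).prod (ρ.prod ρ)) ((ρ.prod ρ).prod (ρ.prod ρ)) :=
    hmp.comp ((MeasurePreserving.id (ρ.prod ρ)).prod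
      (Measure.measurePreserving_swap (μ := ρ) (ν := ρ)))
  have i1 := hmp.integrable_comp_of_integrable (hL.integrable_sq.mul_prod hL.integrable_sq)
  have i2 := hmp'.integrable_comp_of_integrable (hL.integrable_sq.mul_prod hL.integrable_sq)
  refine (i1.add i2).mono' ?_ (Eventually.of_forall fun r => ?_)
  · have e : ∀ f g : (Z × Z) × (Z × Z) → Z, Measurable f → Measurable g →
        Measurable fun r => h (f r) (g r) := fun f g hf hg => hm.comp (hf.prodMk hg)
    refine Measurable.aestronglyMeasurable ?_
    refine ((e _ _ ?_ ?_).mul (e _ _ ?_ ?_)).mul ((e _ _ ?_ ?_).mul (e _ _ ?_ ?_)) <;> fun_prop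
  · simp only [Function.comp, Pi.add_apply, norm_mul, Real.norm_eq_abs]
    have := two_mul_le_add_sq (|h r.1.1 r.2.1| * |h r.1.2 r.2.2|)
        (|h r.1.1 r.2.2| * |h r.1.2 r.2.1|)
    simp only [mul_pow, sq_abs] at this
    nlinarith [abs_nonneg (h r.1.1 r.2.1), abs_nonneg (h r.1.2 r.2.2), abs_nonneg (h r.1.1 r.2.2),
      abs_nonneg (h r.1.2 r.2.1)]

lemma measurable_composeKernel (hm : Measurable (fun p : Z × Z => h p.1 p.2)) :
    Measurable (fun p : Z × Z => composeKernel ρ h p.1 p.2) := by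
  have : Measurable (fun r : (Z × Z) × Z => h r.1.1 r.2 * h r.1.2 r.2) :=
    (hm.comp (by fun_prop : Measurable fun r : (Z × Z) × Z => (r.1.1, r.2))).mul
      (hm.comp (by fun_prop : Measurable fun r : (Z × Z) × Z => (r.1.2, r.2)))
  exact this.stronglyMeasurable.integral_prod_right.measurable

lemma integral_fourfold_right (x y : Z) :
    ∫ q, (h x q.1 * h y q.1) * (h x q.2 * h y q.2) ∂(ρ.prod ρ) = composeKernel ρ h x y ^ 2 := by
  rw [integral_prod_mul (fun w => h x w * h y w) (fun w => h x w * h y w), sq]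
  rfl

lemma memLp_composeKernel (hm : Measurable (fun p : Z × Z => h p.1 p.2))
    (hL : MemLp (fun p : Z × Z => h p.1 p.2) 2 (ρ.prod ρ)) :
    MemLp (fun p : Z × Z => composeKernel ρ h p.1 p.2) 2 (ρ.prod ρ) := by
  rw [memLp_two_iff_integrable_sq (measurable_composeKernel hm).aestronglyMeasurable]
  have := (integrable_fourfold hm hL).integral_prod_left
  simpa only [integral_fourfold_right] using this

lemma kernelSq_composeKernel (hm : Measurable (fun p : Z × Z => h p.1 p.2))
    (hL : MemLp (fun p : Z × Z => h p.1 p.2) 2 (ρ.prod ρ)) :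
    kernelSq ρ (composeKernel ρ h) =
      ∫ r : (Z × Z) × (Z × Z), (h r.1.1 r.2.1 * h r.1.2 r.2.1) * (h r.1.1 r.2.2 * h r.1.2 r.2.2)
        ∂((ρ.prod ρ).prod (ρ.prod ρ)) := by
  rw [integral_prod _ (integrable_fourfold hm hL)]
  simp only [integral_fourfold_right]
  rfl

end FourFold

namespace IsDegenerateKernel

variable {Z : Type*} [MeasurableSpace Z] {ρ : Measure Z} [IsProbabilityMeasure ρ] {h : Z → Z → ℝ}

lemma ae_memLp (hh : IsDegenerateKernel ρ h) : ∀ᵐ x ∂ρ, MemLp (h x) 2 ρ := by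
  filter_upwards [hh.memLp.integrable_sq.prod_right_ae] with x hx
  exact (memLp_two_iff_integrable_sq (f := h x)
    (hh.meas.comp measurable_prodMk_left).aestronglyMeasurable).2 hx

/-- Degeneracy passes to the composition by Fubini. Hence the off-diagonal part of the conditional
variance again has orthogonal terms. -/
lemma composeKernel (hh : IsDegenerateKernel ρ h) :
    IsDegenerateKernel ρ (composeKernel ρ h) where
  meas := measurable_composeKernel hh.meas
  symm x y := by simp only [_root_.composeKernel, mul_comm]
  memLp := memLp_composeKernel hh.meas hh.memLp
  centered := by
    filter_upwards [hh.ae_memLp] with x hx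
    have h1 : MemLp (fun p : Z × Z => h x p.2) 2 (ρ.prod ρ) :=
      hx.comp_measurePreserving measurePreserving_snd
    have h2 : Integrable (fun p : Z × Z => h x p.2 * h p.1 p.2) (ρ.prod ρ) :=
      h1.integrable_mul hh.memLp
    simp only [_root_.composeKernel]
    rw [integral_integral_swap h2]
    refine (integral_congr_ae ?_).trans (integral_zero _ _)
    filter_upwards [hh.centered] with w hw
    simp_rw [integral_const_mul, hh.symm _ w, hw, mul_zero]

end IsDegenerateKernel

/-! ### Diagonal and off-diagonal parts of the conditional variance -/

section DiagonalBound

variable {ι Z : Type*} [Fintype ι] [DecidableEq ι] [MeasurableSpace Z] {ρ : Measure Z}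
  [IsProbabilityMeasure ρ] {h : Z → Z → ℝ}

/-- The diagonal values are i.i.d. with mean 1 but need not have a variance, so $h^2$ is truncated
at $c$ before the second argument is integrated out. The bounded part has values in $[0,c]$ and mean
at most 1, hence variance at most $c$; the tail is paid twice, once for itself and once for the
recentering. -/
lemma integral_abs_sum_diag_le (hm : Measurable (fun p : Z × Z => h p.1 p.2))
    (hL : MemLp (fun p : Z × Z => h p.1 p.2) 2 (ρ.prod ρ)) (h1 : kernelSq ρ h = 1)
    (J : Finset ι) {c : ℝ} (hc : 0 ≤ c) :
    ∫ z, |∑ k ∈ J, (composeKernel ρ h (z k) (z k) - 1)| ∂(Measure.pi fun _ : ι => ρ) ≤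
      √(J.card * c) + 2 * J.card * tailSq ρ h c := by
  have hset : MeasurableSet {p : Z × Z | c < h p.1 p.2 ^ 2} :=
    measurableSet_lt measurable_const (hm.pow_const 2)
  set F₁ : Z × Z → ℝ := fun p => if c < h p.1 p.2 ^ 2 then 0 else h p.1 p.2 ^ 2 with hF₁
  set F₂ : Z × Z → ℝ := fun p => if c < h p.1 p.2 ^ 2 then h p.1 p.2 ^ 2 else 0 with hF₂
  have m₁ : Measurable F₁ := Measurable.ite hset measurable_const (hm.pow_const 2)
  have m₂ : Measurable F₂ := Measurable.ite hset (hm.pow_const 2) measurable_const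
  have n₁ : ∀ p, 0 ≤ F₁ p := fun p => by simp only [hF₁]; split_ifs <;> simp [sq_nonneg]
  have n₂ : ∀ p, 0 ≤ F₂ p := fun p => by simp only [hF₂]; split_ifs <;> simp [sq_nonneg]
  have b₁ : ∀ p, F₁ p ≤ c := fun p => by
    simp only [hF₁]; split_ifs with hp
    · exact hc
    · exact not_lt.1 hp
  have i₁ : Integrable F₁ (ρ.prod ρ) := Integrable.of_bound m₁.aestronglyMeasurable c
    (Eventually.of_forall fun p => by rw [Real.norm_of_nonneg (n₁ p)]; exact b₁ p)
  have i₂ : Integrable F₂ (ρ.prod ρ) := hL.integrable_sq.mono' m₂.aestronglyMeasurable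
    (Eventually.of_forall fun p => by
      rw [Real.norm_of_nonneg (n₂ p)]; simp only [hF₂]; split_ifs <;> simp [sq_nonneg])
  have hsum : ∀ p : Z × Z, h p.1 p.2 ^ 2 = F₁ p + F₂ p := fun p => by
    simp only [hF₁, hF₂]; split_ifs <;> simp
  set f₁ : Z → ℝ := fun x => ∫ w, F₁ (x, w) ∂ρ with hf₁
  set f₂ : Z → ℝ := fun x => ∫ w, F₂ (x, w) ∂ρ with hf₂
  have mf₁ : Measurable f₁ := m₁.stronglyMeasurable.integral_prod_right.measurable
  have mf₂ : Measurable f₂ := m₂.stronglyMeasurable.integral_prod_right.measurable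
  have nf₁ : ∀ x, 0 ≤ f₁ x := fun x => integral_nonneg fun w => n₁ _
  have nf₂ : ∀ x, 0 ≤ f₂ x := fun x => integral_nonneg fun w => n₂ _
  have bf₁ : ∀ x, f₁ x ≤ c := fun x => by
    have := norm_integral_le_of_norm_le_const (μ := ρ) (f := fun w => F₁ (x, w)) (C := c)
      (Eventually.of_forall fun w => by rw [Real.norm_of_nonneg (n₁ _)]; exact b₁ _)
    simpa using (le_abs_self _).trans this
  have L₁ : MemLp f₁ 2 ρ := MemLp.of_bound mf₁.aestronglyMeasurable c
    (Eventually.of_forall fun x => by rw [Real.norm_of_nonneg (nf₁ x)]; exact bf₁ x)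
  have if₂ : Integrable f₂ ρ := i₂.integral_prod_left
  have e₁ : ∫ x, f₁ x ∂ρ = 1 - tailSq ρ h c := by
    rw [hf₁, ← integral_prod F₁ i₁, eq_sub_iff_add_eq, tailSq, ← integral_add i₁ i₂, ← h1, kernelSq]
    exact integral_congr_ae (Eventually.of_forall fun p => (hsum p).symm)
  have e₂ : ∫ x, f₂ x ∂ρ = tailSq ρ h c := by
    rw [hf₂, ← integral_prod F₂ i₂, tailSq]
  have t0 : 0 ≤ tailSq ρ h c := integral_nonneg n₂
  have hae : ∀ᵐ x ∂ρ, _root_.composeKernel ρ h x x = f₁ x + f₂ x := by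
    filter_upwards [i₁.prod_right_ae, i₂.prod_right_ae] with x h1 h2
    rw [hf₁, hf₂, ← integral_add h1 h2, _root_.composeKernel]
    refine integral_congr_ae (Eventually.of_forall fun w => ?_)
    simp only [← hsum, sq]
  have g₁L : MemLp (fun x => f₁ x - (1 - tailSq ρ h c)) 2 ρ := L₁.sub (memLp_const _)
  have g₁0 : ∫ x, (f₁ x - (1 - tailSq ρ h c)) ∂ρ = 0 := by
    rw [integral_sub (L₁.integrable (by norm_num)) (integrable_const _), e₁]; simp
  have SL := memLp_sum_eval (ι := ι) g₁L J
  have q₁ : ∫ x, (f₁ x - (1 - tailSq ρ h c)) ^ 2 ∂ρ ≤ c := by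
    rw [← e₁]
    refine (integral_sub_mean_sq_le L₁).trans ?_
    calc ∫ x, f₁ x ^ 2 ∂ρ ≤ ∫ x, c * f₁ x ∂ρ := by
          refine integral_mono L₁.integrable_sq ((L₁.integrable (by norm_num)).const_mul _) ?_
          intro x
          simp only [sq]
          exact mul_le_mul_of_nonneg_right (bf₁ x) (nf₁ x)
      _ = c * (1 - tailSq ρ h c) := by rw [integral_const_mul, e₁]
      _ ≤ c := by nlinarith
  have iS₂ : Integrable (fun z : ι → Z => ∑ k ∈ J, f₂ (z k)) (Measure.pi fun _ : ι => ρ) :=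
    memLp_one_iff_integrable.1 (memLp_sum_eval (memLp_one_iff_integrable.2 if₂) J)
  have hz : ∀ᵐ z ∂(Measure.pi fun _ : ι => ρ), ∀ k,
      _root_.composeKernel ρ h (z k) (z k) = f₁ (z k) + f₂ (z k) :=
    ae_all_iff.2 fun k => ae_pi_of_ae k hae
  calc ∫ z, |∑ k ∈ J, (_root_.composeKernel ρ h (z k) (z k) - 1)| ∂(Measure.pi fun _ : ι => ρ)
      ≤ ∫ z, (|∑ k ∈ J, (f₁ (z k) - (1 - tailSq ρ h c))| + ∑ k ∈ J, f₂ (z k)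
          + J.card * tailSq ρ h c) ∂(Measure.pi fun _ : ι => ρ) := by
        refine integral_mono_of_nonneg (Eventually.of_forall fun z => abs_nonneg _)
          (((SL.integrable (by norm_num)).abs.add iS₂).add (integrable_const _)) ?_
        filter_upwards [hz] with z hz
        have e : ∑ k ∈ J, (_root_.composeKernel ρ h (z k) (z k) - 1) =
            ∑ k ∈ J, (f₁ (z k) - (1 - tailSq ρ h c)) + ∑ k ∈ J, f₂ (z k) -
              J.card * tailSq ρ h c := by
          simp only [hz, Finset.sum_sub_distrib, Finset.sum_add_distrib, Finset.sum_const,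
            nsmul_eq_mul]
          ring
        rw [e]
        refine (abs_sub _ _).trans (add_le_add ((abs_add_le _ _).trans (add_le_add le_rfl ?_)) ?_)
        · rw [abs_of_nonneg (Finset.sum_nonneg fun k _ => nf₂ _)]
        · rw [abs_of_nonneg (mul_nonneg (Nat.cast_nonneg _) t0)]
    _ = ∫ z, |∑ k ∈ J, (f₁ (z k) - (1 - tailSq ρ h c))| ∂(Measure.pi fun _ : ι => ρ)
          + J.card * tailSq ρ h c + J.card * tailSq ρ h c := by
        rw [integral_add, integral_add, integral_finsetSum]
        · simp_rw [integral_pi_eval _ mf₂.aestronglyMeasurable, e₂]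
          simp
        · exact fun k _ =>
            (measurePreserving_eval (fun _ : ι => ρ) k).integrable_comp_of_integrable if₂
        · exact (SL.integrable (by norm_num)).abs
        · exact iS₂
        · exact (SL.integrable (by norm_num)).abs.add iS₂
        · exact integrable_const _
    _ ≤ √(J.card * c) + J.card * tailSq ρ h c + J.card * tailSq ρ h c := by
        refine add_le_add (add_le_add ((integral_abs_le_sqrt SL).trans (Real.sqrt_le_sqrt ?_))
          le_rfl) le_rfl
        rw [integral_sum_eval_sq g₁L g₁0]
        exact mul_le_mul_of_nonneg_left q₁ (Nat.cast_nonneg _)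
    _ = _ := by ring

/-- Orthogonality: the second moment is at most $2|J|^2$ times that of the kernel, so the sum has
size $|J|$ rather than $|J|^2$. It is applied to the composed kernel. -/
lemma IsDegenerateKernel.integral_abs_sum_offDiag_le (hh : IsDegenerateKernel ρ h)
    (J : Finset ι) :
    ∫ z, |∑ k ∈ J, ∑ l ∈ J, offDiag h z k l| ∂(Measure.pi fun _ : ι => ρ) ≤
      2 * J.card * √(kernelSq ρ h) := by
  have e : ∀ z : ι → Z, ∑ k ∈ J, ∑ l ∈ J, offDiag h z k l =
      ∑ k, ∑ l, (if k ∈ J ∧ l ∈ J then (1 : ℝ) else 0) * offDiag h z k l := by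
    intro z
    simp [ite_and, Finset.sum_ite_mem]
  have h0 : 0 ≤ kernelSq ρ h := integral_nonneg fun _ => sq_nonneg _
  simp_rw [e]
  have hL : MemLp (fun z : ι → Z =>
      ∑ k, ∑ l, (if k ∈ J ∧ l ∈ J then (1 : ℝ) else 0) * offDiag h z k l) 2
      (Measure.pi fun _ : ι => ρ) :=
    memLp_finsetSum _ fun k _ => memLp_finsetSum _ fun l _ => (hh.memLp_offDiag k l).const_mul _
  refine (integral_abs_le_sqrt hL).trans ?_
  rw [hh.integral_sum_offDiag_sq, mul_comm (2 * (J.card : ℝ)),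
    show (2 * (J.card : ℝ)) = √((2 * (J.card : ℝ)) ^ 2) from (Real.sqrt_sq (by positivity)).symm,
    ← Real.sqrt_mul h0]
  refine Real.sqrt_le_sqrt (mul_le_mul_of_nonneg_left ?_ h0)
  calc _ ≤ ∑ k : ι, ∑ l : ι, (if k ∈ J then (1 : ℝ) else 0) * (if l ∈ J then 2 else 0) := by
        refine Finset.sum_le_sum fun k _ => Finset.sum_le_sum fun l _ => ?_
        by_cases h1 : k ∈ J <;> by_cases h2 : l ∈ J <;> by_cases h3 : k = l <;>
          (simp [h1, h2, h3]; try norm_num)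
    _ ≤ _ := by
        simp_rw [← Finset.mul_sum, ← Finset.sum_mul]
        simp
        nlinarith [Nat.cast_nonneg (α := ℝ) J.card]

end DiagonalBound

/-! ### One telescoping step for characteristic functions -/

lemma norm_exp_mul_I_remainder_le (x : ℝ) :
    ‖Complex.exp (x * Complex.I) - 1 - x * Complex.I + (x : ℂ) ^ 2 / 2‖ ≤
      4 * min (x ^ 2) (|x| ^ 3) := by
  -- The cubic Taylor bound near 0 and a crude quadratic one elsewhere; with the minimum of the two,
  -- second moments suffice for integrability.
  rcases le_total |x| 1 with h | h
  · have hmin : min (x ^ 2) (|x| ^ 3) = |x| ^ 3 := by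
      refine min_eq_right ?_
      rw [← sq_abs x]
      exact pow_le_pow_of_le_one (abs_nonneg _) h (by norm_num)
    have hn : ‖(x : ℂ) * Complex.I‖ = |x| := by simp
    have := Complex.exp_bound (x := (x : ℂ) * Complex.I) (hn.trans_le h) (n := 3) (by norm_num)
    rw [hn] at this
    have e : Complex.exp (x * Complex.I) - 1 - x * Complex.I + (x : ℂ) ^ 2 / 2 =
        Complex.exp (x * Complex.I) -
          ∑ m ∈ Finset.range 3, ((x : ℂ) * Complex.I) ^ m / (m.factorial : ℂ) := by
      simp only [Finset.sum_range_succ, Finset.sum_range_zero, mul_pow, Complex.I_sq]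
      simp
      ring
    rw [e, hmin]
    refine this.trans ?_
    have h3 : (0 : ℝ) ≤ |x| ^ 3 := by positivity
    norm_num [Nat.factorial]
    nlinarith
  · have hmin : min (x ^ 2) (|x| ^ 3) = x ^ 2 := by
      refine min_eq_left ?_
      rw [← sq_abs x]
      exact pow_le_pow_right₀ h (by norm_num)
    rw [hmin]
    have h2 : 1 ≤ x ^ 2 := by rw [← sq_abs]; nlinarith
    have h3 : |x| ≤ x ^ 2 := by rw [← sq_abs x]; nlinarith
    have n1 : ‖Complex.exp (x * Complex.I)‖ = 1 := Complex.norm_exp_ofReal_mul_I x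
    have n2 : ‖(x : ℂ) * Complex.I‖ = |x| := by simp
    have n3 : ‖(x : ℂ) ^ 2 / 2‖ = x ^ 2 / 2 := by simp
    calc _ ≤ ‖Complex.exp (x * Complex.I)‖ + ‖(1 : ℂ)‖ + ‖(x : ℂ) * Complex.I‖ +
          ‖(x : ℂ) ^ 2 / 2‖ :=
          (norm_add_le _ _).trans (add_le_add ((norm_sub_le _ _).trans
            (add_le_add (norm_sub_le _ _) le_rfl)) le_rfl)
      _ ≤ 4 * x ^ 2 := by rw [n1, n2, n3, norm_one]; linarith

lemma abs_one_sub_sub_exp_neg_le {a : ℝ} (ha : 0 ≤ a) : |1 - a - Real.exp (-a)| ≤ a ^ 2 := by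
  rcases le_total a 1 with h | h
  · have := Real.abs_exp_sub_one_sub_id_le (x := -a) (by rwa [abs_neg, abs_of_nonneg ha])
    rw [abs_sub_comm]
    convert this using 1
    · congr 1; ring
    · ring
  · have h1 := Real.add_one_le_exp (-a)
    have h2 := Real.exp_le_one_iff.2 (neg_nonpos.2 ha)
    rw [abs_le]
    constructor <;> nlinarith

section Step

variable {ι Z : Type*} [Fintype ι] [DecidableEq ι] [MeasurableSpace Z] {ρ : Measure Z}
  [IsProbabilityMeasure ρ] {h : Z → Z → ℝ}

lemma IsDegenerateKernel.memLp_row (hh : IsDegenerateKernel ρ h) {J : Finset ι} {j : ι}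
    (hj : j ∉ J) :
    MemLp (fun z : ι → Z => ∑ k ∈ J, h (z k) (z j)) 2 (Measure.pi fun _ : ι => ρ) := by
  refine memLp_finsetSum _ fun k hk => ?_
  have hkj : k ≠ j := fun e => hj (e ▸ hk)
  exact hh.memLp.comp_measurePreserving (measurePreserving_pair hkj)

lemma row_update {J : Finset ι} {j : ι} (hj : j ∉ J) (z : ι → Z) (w : Z) :
    ∑ k ∈ J, h (Function.update z j w k) (Function.update z j w j) = ∑ k ∈ J, h (z k) w := by
  refine Finset.sum_congr rfl fun k hk => ?_
  rw [Function.update_self, Function.update_of_ne (by rintro rfl; exact hj hk)]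

/-- Conditional mean and variance of the increment contributed by a new observation `w`, given the
observations in `J`: degeneracy gives the first, expanding the square the second. -/
lemma IsDegenerateKernel.ae_integral_row (hh : IsDegenerateKernel ρ h) (J : Finset ι) :
    ∀ᵐ z ∂(Measure.pi fun _ : ι => ρ), ∫ w, ∑ k ∈ J, h (z k) w ∂ρ = 0 ∧
      ∫ w, (∑ k ∈ J, h (z k) w) ^ 2 ∂ρ =
        ∑ k ∈ J, ∑ l ∈ J, _root_.composeKernel ρ h (z k) (z l) := by
  have h1 : ∀ᵐ z ∂(Measure.pi fun _ : ι => ρ), ∀ k, MemLp (h (z k)) 2 ρ :=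
    ae_all_iff.2 fun k => ae_pi_of_ae k hh.ae_memLp
  have h2 : ∀ᵐ z ∂(Measure.pi fun _ : ι => ρ), ∀ k, ∫ w, h (z k) w ∂ρ = 0 :=
    ae_all_iff.2 fun k => ae_pi_of_ae k hh.centered
  filter_upwards [h1, h2] with z h1 h2
  constructor
  · rw [integral_finsetSum _ fun k _ => (h1 k).integrable (by norm_num)]
    simp [h2]
  · simp_rw [sq, Finset.sum_mul_sum]
    have hi : ∀ k l, Integrable (fun w => h (z k) w * h (z l) w) ρ := fun k l =>
      (h1 k).integrable_mul (h1 l)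
    rw [integral_finsetSum _ fun k _ => integrable_finsetSum _ fun l _ => hi k l]
    refine Finset.sum_congr rfl fun k _ => ?_
    rw [integral_finsetSum _ fun l _ => hi k l]
    rfl

/-- One step of the characteristic-function telescoping for a degenerate `U`-statistic. -/
lemma IsDegenerateKernel.norm_integral_step_le (hh : IsDegenerateKernel ρ h) {J : Finset ι} {j : ι}
    (hj : j ∉ J) {Φ : (ι → Z) → ℂ} (hΦm : Measurable Φ) (hΦ1 : ∀ z, ‖Φ z‖ ≤ 1)
    (hΦ : ∀ z w, Φ (Function.update z j w) = Φ z) (u : ℝ)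
    (hG : Integrable (fun z : ι → Z => ∑ k ∈ J, ∑ l ∈ J, _root_.composeKernel ρ h (z k) (z l))
      (Measure.pi fun _ : ι => ρ)) :
    ‖∫ z, Φ z * (Complex.exp (((u * ∑ k ∈ J, h (z k) (z j) : ℝ) : ℂ) * Complex.I) -
        (Real.exp (-(u ^ 2 * J.card / 2)) : ℂ)) ∂(Measure.pi fun _ : ι => ρ)‖ ≤
      4 * ∫ z, min ((u * ∑ k ∈ J, h (z k) (z j)) ^ 2) (|u * ∑ k ∈ J, h (z k) (z j)| ^ 3)
          ∂(Measure.pi fun _ : ι => ρ) +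
      u ^ 2 / 2 * ∫ z, |∑ k ∈ J, ∑ l ∈ J, _root_.composeKernel ρ h (z k) (z l) - J.card|
          ∂(Measure.pi fun _ : ι => ρ) +
      (u ^ 2 * J.card / 2) ^ 2 := by
  set π := Measure.pi fun _ : ι => ρ with hπ
  set U : (ι → Z) → ℝ := fun z => ∑ k ∈ J, h (z k) (z j) with hU
  set G : (ι → Z) → ℝ := fun z => ∑ k ∈ J, ∑ l ∈ J, _root_.composeKernel ρ h (z k) (z l) with hGdef
  set m : ℝ := (J.card : ℝ) with hm
  have UL : MemLp U 2 π := hh.memLp_row hj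
  have Ui : Integrable U π := UL.integrable (by norm_num)
  have bdd : ∀ {f : (ι → Z) → ℂ}, Integrable f π → Integrable (fun z => Φ z * f z) π := fun hf =>
    hf.bdd_mul hΦm.aestronglyMeasurable (Eventually.of_forall hΦ1)
  have Uci : Integrable (fun z => (U z : ℂ)) π := Ui.ofReal
  have U2i : Integrable (fun z => ((U z ^ 2 : ℝ) : ℂ)) π := UL.integrable_sq.ofReal
  have Gci : Integrable (fun z => (G z : ℂ)) π := hG.ofReal
  have hae := hh.ae_integral_row (ι := ι) J
  -- `Φ` ignores coordinate `j`, so $z_j$ can be integrated first: the linear Taylor term vanishes,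
  -- and in the quadratic one $U^2$ becomes the conditional variance `G`.
  have hA : ∫ z, Φ z * (U z : ℂ) ∂π = 0 := by
    rw [hπ, integral_pi_eq_integral_update j (bdd Uci)]
    refine (integral_congr_ae ?_).trans (integral_zero _ _)
    filter_upwards [hae] with z hz
    simp only [hU, hΦ, row_update hj]
    rw [integral_const_mul, integral_complex_ofReal, hz.1]
    simp
  have hB : ∫ z, Φ z * ((U z ^ 2 : ℝ) : ℂ) ∂π = ∫ z, Φ z * (G z : ℂ) ∂π := by
    rw [hπ, integral_pi_eq_integral_update j (bdd U2i)]
    refine integral_congr_ae ?_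
    filter_upwards [hae] with z hz
    simp only [hU, hΦ, row_update hj]
    rw [integral_const_mul, integral_complex_ofReal, hz.2]
  have expm : AEStronglyMeasurable (fun z => Complex.exp (((u * U z : ℝ) : ℂ) * Complex.I)) π := by
    have := (UL.1.const_mul u)
    exact (by fun_prop : Continuous fun x : ℝ => Complex.exp ((x : ℂ) * Complex.I)
      ).comp_aestronglyMeasurable this
  have expi : Integrable (fun z => Complex.exp (((u * U z : ℝ) : ℂ) * Complex.I)) π :=
    Integrable.of_bound expm 1 (Eventually.of_forall fun z =>
      (Complex.norm_exp_ofReal_mul_I _).le)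
  set R : (ι → Z) → ℂ := fun z => Complex.exp (((u * U z : ℝ) : ℂ) * Complex.I) - 1 -
    ((u * U z : ℝ) : ℂ) * Complex.I + ((u * U z : ℝ) : ℂ) ^ 2 / 2 with hR
  have Ri : Integrable R π := by
    have i1 : Integrable (fun z => ((u * U z : ℝ) : ℂ) * Complex.I) π :=
      ((Ui.const_mul u).ofReal).mul_const _
    have i2 : Integrable (fun z => ((u * U z : ℝ) : ℂ) ^ 2 / 2) π := by
      have : Integrable (fun z => (((u * U z) ^ 2 : ℝ) : ℂ) / 2) π :=
        ((UL.const_mul u).integrable_sq.ofReal).div_const _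
      simpa only [Complex.ofReal_pow] using this
    exact ((expi.sub (integrable_const _)).sub i1).add i2
  set κ : ℝ := 1 - u ^ 2 * m / 2 - Real.exp (-(u ^ 2 * m / 2)) with hκ
  -- Both exponentials are expanded to second order:
  -- $e^{iuU}-e^{-u^2m/2}=R+iuU+\kappa+\tfrac{u^2}{2}(m-U^2)$, with `R` and `κ` the two remainders.
  have hdecomp : ∀ z, Φ z * (Complex.exp (((u * U z : ℝ) : ℂ) * Complex.I) -
      (Real.exp (-(u ^ 2 * m / 2)) : ℂ)) =
      Φ z * R z + (u * Complex.I) * (Φ z * (U z : ℂ)) + Φ z * (κ : ℂ)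
        + (u ^ 2 / 2 : ℂ) * (Φ z * (m : ℂ)) - (u ^ 2 / 2 : ℂ) * (Φ z * ((U z ^ 2 : ℝ) : ℂ)) := by
    intro z
    simp only [hR, hκ]
    push_cast
    ring
  have Φi : ∀ a : ℂ, Integrable (fun z => Φ z * a) π := fun a => bdd (integrable_const a)
  have hval : ∫ z, Φ z * (Complex.exp (((u * U z : ℝ) : ℂ) * Complex.I) -
      (Real.exp (-(u ^ 2 * m / 2)) : ℂ)) ∂π =
      ∫ z, Φ z * R z ∂π + ∫ z, Φ z * (κ : ℂ) ∂π
        - (u ^ 2 / 2 : ℂ) * ∫ z, Φ z * ((G z - m : ℝ) : ℂ) ∂π := by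
    simp_rw [hdecomp]
    rw [integral_sub, integral_add, integral_add, integral_add, integral_const_mul,
      integral_const_mul, integral_const_mul, hA, hB]
    · have : ∫ z, Φ z * ((G z - m : ℝ) : ℂ) ∂π =
          ∫ z, Φ z * (G z : ℂ) ∂π - ∫ z, Φ z * (m : ℂ) ∂π := by
        rw [← integral_sub (bdd Gci) (Φi _)]
        congr 1; ext z; push_cast; ring
      rw [this]
      ring
    · exact bdd Ri
    · exact (bdd Uci).const_mul _
    · exact (bdd Ri).add ((bdd Uci).const_mul _)
    · exact Φi _
    · exact ((bdd Ri).add ((bdd Uci).const_mul _)).add (Φi _)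
    · exact (Φi _).const_mul _
    · exact (((bdd Ri).add ((bdd Uci).const_mul _)).add (Φi _)).add ((Φi _).const_mul _)
    · exact (bdd U2i).const_mul _
  have Φle : ∀ (z : ι → Z) (a : ℂ), ‖Φ z * a‖ ≤ ‖a‖ := fun z a => by
    rw [norm_mul]; exact mul_le_of_le_one_left (norm_nonneg _) (hΦ1 z)
  have mini : Integrable (fun z => min ((u * U z) ^ 2) (|u * U z| ^ 3)) π := by
    refine (UL.const_mul u).integrable_sq.mono' ?_ (Eventually.of_forall fun z => ?_)
    · exact (by fun_prop : Continuous fun x : ℝ => min (x ^ 2) (|x| ^ 3)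
        ).comp_aestronglyMeasurable (UL.1.const_mul u)
    · rw [Real.norm_of_nonneg (by positivity)]
      exact min_le_left _ _
  have b1 : ‖∫ z, Φ z * R z ∂π‖ ≤ 4 * ∫ z, min ((u * U z) ^ 2) (|u * U z| ^ 3) ∂π := by
    rw [← integral_const_mul]
    exact norm_integral_le_of_norm_le (mini.const_mul 4) (Eventually.of_forall fun z =>
      (Φle z _).trans (norm_exp_mul_I_remainder_le _))
  have b2 : ‖∫ z, Φ z * (κ : ℂ) ∂π‖ ≤ (u ^ 2 * m / 2) ^ 2 := by
    have := norm_integral_le_of_norm_le_const (μ := π) (f := fun z => Φ z * (κ : ℂ))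
      (C := (u ^ 2 * m / 2) ^ 2) (Eventually.of_forall fun z => (Φle z _).trans (by
        rw [Complex.norm_real, Real.norm_eq_abs]
        exact abs_one_sub_sub_exp_neg_le (by positivity)))
    simpa using this
  have b3 : ‖∫ z, Φ z * ((G z - m : ℝ) : ℂ) ∂π‖ ≤ ∫ z, |G z - m| ∂π :=
    norm_integral_le_of_norm_le (hG.sub (integrable_const m)).abs (Eventually.of_forall fun z =>
      (Φle z _).trans_eq (by rw [Complex.norm_real, Real.norm_eq_abs]))
  rw [hval]
  have n3 : ‖(u ^ 2 / 2 : ℂ)‖ = u ^ 2 / 2 := by simp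
  calc _ ≤ ‖∫ z, Φ z * R z ∂π‖ + ‖∫ z, Φ z * (κ : ℂ) ∂π‖ +
        ‖(u ^ 2 / 2 : ℂ) * ∫ z, Φ z * ((G z - m : ℝ) : ℂ) ∂π‖ :=
        (norm_sub_le _ _).trans (add_le_add (norm_add_le _ _) le_rfl)
    _ ≤ 4 * ∫ z, min ((u * U z) ^ 2) (|u * U z| ^ 3) ∂π + (u ^ 2 * m / 2) ^ 2 +
        u ^ 2 / 2 * ∫ z, |G z - m| ∂π := by
        rw [norm_mul, n3]
        exact add_le_add (add_le_add b1 b2) (mul_le_mul_of_nonneg_left b3 (by positivity))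
    _ = _ := by ring

end Step

/-! ### Bounds for one row of a degenerate $U$-statistic -/

section RowBounds

variable {ι Z : Type*} [Fintype ι] [DecidableEq ι] [MeasurableSpace Z] {ρ : Measure Z}
  [IsProbabilityMeasure ρ] {h : Z → Z → ℝ}

lemma kernelSq_eq_integral_integral (hh : IsDegenerateKernel ρ h) :
    ∫ w, ∫ y, h y w ^ 2 ∂ρ ∂ρ = kernelSq ρ h := by
  simp_rw [hh.symm _ (_ : Z)]
  rw [kernelSq, integral_prod _ hh.memLp.integrable_sq]

lemma IsDegenerateKernel.integrable_tail (hh : IsDegenerateKernel ρ h) (c : ℝ) :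
    Integrable (fun p : Z × Z => if c < h p.1 p.2 ^ 2 then h p.1 p.2 ^ 2 else 0) (ρ.prod ρ) := by
  have hset : MeasurableSet {p : Z × Z | c < h p.1 p.2 ^ 2} :=
    measurableSet_lt measurable_const (hh.meas.pow_const 2)
  refine hh.memLp.integrable_sq.mono' (Measurable.ite hset (hh.meas.pow_const 2)
    measurable_const).aestronglyMeasurable (Eventually.of_forall fun p => ?_)
  rw [Real.norm_of_nonneg (by split_ifs <;> positivity)]
  split_ifs
  · exact le_rfl
  · positivity

/-- Given $z_j=w$, the row is a sum of i.i.d. centered variables $h(z_k,w)$, so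
`integral_min_sum_eval_le` applies for almost every $w$. Integrating its bound over $w$ turns the
sectional second moments and tails into those of the kernel. -/
lemma IsDegenerateKernel.integral_min_row_le (hh : IsDegenerateKernel ρ h)
    (h1 : kernelSq ρ h = 1) {J : Finset ι} {j : ι} (hj : j ∉ J) {δ c : ℝ} (hδ : 0 < δ)
    (hc : 0 ≤ c) (u : ℝ) :
    ∫ z, min ((u * ∑ k ∈ J, h (z k) (z j)) ^ 2) (|u * ∑ k ∈ J, h (z k) (z j)| ^ 3)
        ∂(Measure.pi fun _ : ι => ρ) ≤
      4 * δ * u ^ 2 * J.card + 48 / δ * u ^ 4 * (J.card : ℝ) ^ 2 * c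
        + 4 * u ^ 2 * J.card * tailSq ρ h c := by
  set π := Measure.pi fun _ : ι => ρ with hπ
  have UL := (hh.memLp_row hj).const_mul u
  have hi : Integrable (fun z : ι → Z => min ((u * ∑ k ∈ J, h (z k) (z j)) ^ 2)
      (|u * ∑ k ∈ J, h (z k) (z j)| ^ 3)) π := by
    refine UL.integrable_sq.mono' ?_ (Eventually.of_forall fun z => ?_)
    · exact (by fun_prop : Continuous fun x : ℝ => min (x ^ 2) (|x| ^ 3)
        ).comp_aestronglyMeasurable UL.1
    · rw [Real.norm_of_nonneg (by positivity)]
      exact min_le_left _ _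
  have hi' : Integrable (fun p : (ι → Z) × Z => min ((u * ∑ k ∈ J, h (p.1 k) p.2) ^ 2)
      (|u * ∑ k ∈ J, h (p.1 k) p.2| ^ 3)) (π.prod ρ) := by
    have := (measurePreserving_update (ρ := ρ) j).integrable_comp_of_integrable hi
    simpa only [Function.comp_def, row_update hj] using this
  rw [integral_pi_eq_integral_update j hi]
  simp only [row_update hj]
  rw [← integral_prod _ hi', integral_prod_symm _ hi']
  have t := hh.integrable_tail c
  have s1 : ∫ w, ∫ y, h y w ^ 2 ∂ρ ∂ρ = 1 := by rw [kernelSq_eq_integral_integral hh, h1]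
  have s2 : ∫ w, ∫ y, (if c < h y w ^ 2 then h y w ^ 2 else 0) ∂ρ ∂ρ = tailSq ρ h c := by
    rw [tailSq, integral_prod_symm _ t]
  have j1 : Integrable (fun w => ∫ y, h y w ^ 2 ∂ρ) ρ := hh.memLp.integrable_sq.integral_prod_right
  have j2 : Integrable (fun w => ∫ y, (if c < h y w ^ 2 then h y w ^ 2 else 0) ∂ρ) ρ :=
    t.integral_prod_right
  calc ∫ w, ∫ z, min ((u * ∑ k ∈ J, h (z k) w) ^ 2) (|u * ∑ k ∈ J, h (z k) w| ^ 3) ∂π ∂ρ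
      ≤ ∫ w, (4 * δ * u ^ 2 * J.card * ∫ y, h y w ^ 2 ∂ρ
        + 48 / δ * u ^ 4 * (J.card : ℝ) ^ 2 * c * ∫ y, h y w ^ 2 ∂ρ
        + 4 * u ^ 2 * J.card * ∫ y, (if c < h y w ^ 2 then h y w ^ 2 else 0) ∂ρ) ∂ρ := by
        refine integral_mono_ae hi'.integral_prod_right
          (((j1.const_mul _).add (j1.const_mul _)).add (j2.const_mul _)) ?_
        filter_upwards [hh.ae_memLp, hh.centered] with w hw1 hw2
        have e : h w = fun y => h y w := funext fun y => hh.symm w y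
        rw [e] at hw1
        simp_rw [hh.symm w] at hw2
        exact integral_min_sum_eval_le (f := fun y => h y w)
          (hh.meas.comp measurable_prodMk_right) hw1 hw2 J hδ hc u
    _ = _ := by
        rw [integral_add, integral_add, integral_const_mul, integral_const_mul, integral_const_mul,
          s1, s2, mul_one, mul_one]
        · exact j1.const_mul _
        · exact j1.const_mul _
        · exact (j1.const_mul _).add (j1.const_mul _)
        · exact j2.const_mul _

lemma IsDegenerateKernel.integrable_composeKernel_diag (hh : IsDegenerateKernel ρ h) (k l : ι) :
    Integrable (fun z : ι → Z => _root_.composeKernel ρ h (z k) (z l))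
      (Measure.pi fun _ : ι => ρ) := by
  by_cases hkl : k = l
  · subst hkl
    have : Integrable (fun x => _root_.composeKernel ρ h x x) ρ := by
      simpa only [_root_.composeKernel, ← sq] using hh.memLp.integrable_sq.integral_prod_left
    exact (measurePreserving_eval (fun _ : ι => ρ) k).integrable_comp_of_integrable this
  · exact (measurePreserving_pair hkl).integrable_comp_of_integrable
      (hh.composeKernel.memLp.integrable (by norm_num))

/-- The conditional variance of a row is close to its mean $|J|$: law of large numbers on the
diagonal, orthogonality off it. The last term is where the four-point moment enters. -/
lemma IsDegenerateKernel.integral_abs_sum_composeKernel_le (hh : IsDegenerateKernel ρ h)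
    (h1 : kernelSq ρ h = 1) (J : Finset ι) {c : ℝ} (hc : 0 ≤ c) :
    ∫ z, |∑ k ∈ J, ∑ l ∈ J, _root_.composeKernel ρ h (z k) (z l) - J.card|
        ∂(Measure.pi fun _ : ι => ρ) ≤
      √(J.card * c) + 2 * J.card * tailSq ρ h c +
        2 * J.card * √(kernelSq ρ (_root_.composeKernel ρ h)) := by
  have i1 : Integrable (fun z : ι → Z => |∑ k ∈ J, (_root_.composeKernel ρ h (z k) (z k) - 1)|)
      (Measure.pi fun _ : ι => ρ) := (integrable_finsetSum _ fun k _ =>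
        (hh.integrable_composeKernel_diag k k).sub (integrable_const _)).abs
  have i2 : Integrable (fun z : ι → Z =>
      |∑ k ∈ J, ∑ l ∈ J, offDiag (_root_.composeKernel ρ h) z k l|)
      (Measure.pi fun _ : ι => ρ) := (integrable_finsetSum _ fun k _ => integrable_finsetSum _
        fun l _ => (hh.composeKernel.memLp_offDiag k l).integrable (by norm_num)).abs
  refine le_trans ?_ (add_le_add (integral_abs_sum_diag_le hh.meas hh.memLp h1 J hc)
    (hh.composeKernel.integral_abs_sum_offDiag_le J))
  rw [← integral_add i1 i2]
  refine integral_mono_of_nonneg (Eventually.of_forall fun _ => abs_nonneg _) (i1.add i2)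
    (Eventually.of_forall fun z => ?_)
  have e : ∑ k ∈ J, ∑ l ∈ J, _root_.composeKernel ρ h (z k) (z l) - J.card =
      ∑ k ∈ J, (_root_.composeKernel ρ h (z k) (z k) - 1) +
        ∑ k ∈ J, ∑ l ∈ J, offDiag (_root_.composeKernel ρ h) z k l := by
    have : ∀ k ∈ J, ∑ l ∈ J, _root_.composeKernel ρ h (z k) (z l) =
        _root_.composeKernel ρ h (z k) (z k) +
          ∑ l ∈ J, offDiag (_root_.composeKernel ρ h) z k l := by
      intro k hk
      rw [← Finset.add_sum_erase J _ hk, ← Finset.add_sum_erase J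
        (fun l => offDiag (_root_.composeKernel ρ h) z k l) hk]
      simp only [offDiag, if_true, zero_add]
      congr 1
      refine Finset.sum_congr rfl fun l hl => ?_
      rw [if_neg (Finset.ne_of_mem_erase hl).symm]
    rw [Finset.sum_congr rfl this, Finset.sum_add_distrib, Finset.sum_sub_distrib]
    simp
    ring
  simp only [e]
  exact abs_add_le _ _

end RowBounds

/-! ### Central limit theorem for degenerate $U$-statistics -/

section CentralLimit

variable {Z : Type*} [MeasurableSpace Z] {ρ : Measure Z} [IsProbabilityMeasure ρ] {h : Z → Z → ℝ}
  {n : ℕ}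

/-- The sum of the kernel values over the pairs whose larger index is below `m`. -/
def partialPairSum (h : Z → Z → ℝ) (m : ℕ) (z : Fin n → Z) : ℝ :=
  ∑ i ∈ Finset.univ.filter (fun i : Fin n => i.val < m), ∑ k ∈ Finset.Iio i, h (z k) (z i)

lemma partialPairSum_succ (m : Fin n) (z : Fin n → Z) :
    partialPairSum h (m.val + 1) z =
      partialPairSum h m.val z + ∑ k ∈ Finset.Iio m, h (z k) (z m) := by
  have : Finset.univ.filter (fun i : Fin n => i.val < m.val + 1) =
      insert m (Finset.univ.filter (fun i : Fin n => i.val < m.val)) := by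
    ext i
    simp only [Finset.mem_filter, Finset.mem_univ, true_and, Finset.mem_insert, Fin.ext_iff]
    omega
  rw [partialPairSum, this, Finset.sum_insert (by simp), add_comm]
  rfl

/-- Predictability: all indices in the sum are strictly below `m`, so the past factor of the step
does not see observation `m`. -/
lemma partialPairSum_update (m : Fin n) (z : Fin n → Z) (w : Z) :
    partialPairSum h m.val (Function.update z m w) = partialPairSum h m.val z := by
  refine Finset.sum_congr rfl fun i hi => Finset.sum_congr rfl fun k hk => ?_
  have hi' : i < m := by simpa using hi
  have hk' : k < m := (Finset.mem_Iio.1 hk).trans hi'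
  rw [Function.update_of_ne hi'.ne, Function.update_of_ne hk'.ne]

lemma measurable_partialPairSum (hm : Measurable (fun p : Z × Z => h p.1 p.2)) (m : ℕ) :
    Measurable (fun z : Fin n → Z => partialPairSum h m z) :=
  Finset.measurable_sum _ fun i _ => Finset.measurable_sum _ fun k _ =>
    hm.comp (f := fun z : Fin n → Z => (z k, z i))
      ((measurable_pi_apply k).prodMk (measurable_pi_apply i))

/-- A quantitative central limit theorem for degenerate `U`-statistics, in terms of
characteristic functions. -/
lemma IsDegenerateKernel.norm_integral_exp_sub_le (hh : IsDegenerateKernel ρ h)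
    (h1 : kernelSq ρ h = 1) (u : ℝ) {ε : ℝ} (hε : 0 < ε) :
    ‖∫ z, Complex.exp (((u * partialPairSum h n z : ℝ) : ℂ) * Complex.I)
        ∂(Measure.pi fun _ : Fin n => ρ) -
        (Real.exp (-(u ^ 2 * ((n : ℝ) * (n - 1) / 2) / 2)) : ℂ)‖ ≤
      (17 * (u ^ 2 * n ^ 2) + 192 * (u ^ 2 * n ^ 2) ^ 2) *
        (ε + tailSq ρ h (ε ^ 2 * n) + √(kernelSq ρ (_root_.composeKernel ρ h)) + 1 / n) := by
  rcases Nat.eq_zero_or_pos n with hn | hn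
  · subst hn; simp [partialPairSum]
  set π := Measure.pi fun _ : Fin n => ρ with hπ
  set T : ℝ := tailSq ρ h (ε ^ 2 * n) with hT
  set g : ℝ := √(kernelSq ρ (_root_.composeKernel ρ h)) with hg
  have hn0 : (0 : ℝ) < n := Nat.cast_pos.2 hn
  have T0 : 0 ≤ T := integral_nonneg fun p => by
    show (0 : ℝ) ≤ if _ then _ else _
    split_ifs <;> positivity
  have g0 : 0 ≤ g := Real.sqrt_nonneg _
  set Φ : ℕ → (Fin n → Z) → ℂ := fun m z =>
    Complex.exp (((u * partialPairSum h m z : ℝ) : ℂ) * Complex.I) with hΦ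
  set V : ℕ → ℝ := fun m => u ^ 2 * ((m : ℝ) * (m - 1) / 2) / 2 with hV
  -- The characteristic function divided by its Gaussian target, so that $a_0=1$ and the claim is
  -- that $a_n$ is near 1. Since $V_{m+1}-V_m=u^2m/2$, each increment is one telescoping step times
  -- $e^{V_{m+1}}\le e^{V_n}$, and this factor is cancelled by the final $e^{-V_n}$.
  set a : ℕ → ℂ := fun m => (∫ z, Φ m z ∂π) * (Real.exp (V m) : ℂ) with ha
  -- The row bounds with $m\le n$ and the choices $\delta=\varepsilon$, $c=\varepsilon^2n$, which
  -- make both the fourth-moment term and $\sqrt{mc}$ proportional to $\varepsilon$.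
  set B : ℝ := 4 * (4 * ε * u ^ 2 * n + 48 / ε * u ^ 4 * (n : ℝ) ^ 2 * (ε ^ 2 * n)
        + 4 * u ^ 2 * n * T) + u ^ 2 / 2 * (ε * n + 2 * n * T + 2 * n * g) +
        (u ^ 2 * n / 2) ^ 2 with hB
  have mΦ : ∀ m, Measurable (Φ m) := fun m =>
    (by fun_prop : Continuous fun x : ℝ => Complex.exp (((u * x : ℝ) : ℂ) * Complex.I)
      ).measurable.comp (measurable_partialPairSum hh.meas m)
  have nΦ : ∀ m z, ‖Φ m z‖ ≤ 1 := fun m z => (Complex.norm_exp_ofReal_mul_I _).le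
  have iΦ : ∀ m, Integrable (Φ m) π := fun m =>
    Integrable.of_bound (mΦ m).aestronglyMeasurable 1 (Eventually.of_forall (nΦ m))
  have Vmono : ∀ m, m + 1 ≤ n → V (m + 1) ≤ V n := by
    intro m hm
    have h1 : ((m : ℝ) + 1) ≤ n := by exact_mod_cast hm
    have h2 : (0 : ℝ) ≤ m := Nat.cast_nonneg m
    simp only [hV]
    push_cast
    have : ((m : ℝ) + 1) * (m + 1 - 1) ≤ n * (n - 1) := by nlinarith
    have hu := sq_nonneg u
    nlinarith
  have step : ∀ m : ℕ, m < n → ‖a (m + 1) - a m‖ ≤ Real.exp (V n) * B := by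
    intro m hm
    set j : Fin n := ⟨m, hm⟩ with hj
    have hjJ : j ∉ Finset.Iio j := by simp
    have hcard : ((Finset.Iio j).card : ℝ) = m := by simp [hj]
    have hmn : (m : ℝ) ≤ n := by exact_mod_cast hm.le
    have hm0 : (0 : ℝ) ≤ m := Nat.cast_nonneg m
    have hstep := hh.norm_integral_step_le hjJ (mΦ m) (nΦ m)
      (fun z w => by simp only [hΦ]; rw [show m = j.val from rfl, partialPairSum_update]) u
      (integrable_finsetSum _ fun k _ => integrable_finsetSum _ fun l _ =>
        hh.integrable_composeKernel_diag k l)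
    have hrow := hh.integral_min_row_le h1 hjJ hε (c := ε ^ 2 * n) (by positivity) u
    have hcomp := hh.integral_abs_sum_composeKernel_le h1 (Finset.Iio j) (c := ε ^ 2 * n)
      (by positivity)
    rw [hcard] at hstep hrow hcomp
    have hsq : √((m : ℝ) * (ε ^ 2 * n)) ≤ ε * n := by
      rw [Real.sqrt_le_iff]
      refine ⟨by positivity, ?_⟩
      have : (m : ℝ) * (ε ^ 2 * n) ≤ n * (ε ^ 2 * n) := by gcongr
      nlinarith
    have hle : ‖∫ z, Φ m z * (Complex.exp (((u * ∑ k ∈ Finset.Iio j, h (z k) (z j) : ℝ) : ℂ) *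
        Complex.I) - (Real.exp (-(u ^ 2 * m / 2)) : ℂ)) ∂π‖ ≤ B := by
      refine hstep.trans (add_le_add (add_le_add ?_ ?_) ?_)
      · refine mul_le_mul_of_nonneg_left (hrow.trans ?_) (by norm_num)
        gcongr
      · refine mul_le_mul_of_nonneg_left (hcomp.trans ?_) (by positivity)
        gcongr
      · gcongr
    have hdiff : a (m + 1) - a m = (Real.exp (V (m + 1)) : ℂ) *
        ∫ z, Φ m z * (Complex.exp (((u * ∑ k ∈ Finset.Iio j, h (z k) (z j) : ℝ) : ℂ) *
        Complex.I) - (Real.exp (-(u ^ 2 * m / 2)) : ℂ)) ∂π := by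
      have e1 : ∀ z, Φ m z * (Complex.exp (((u * ∑ k ∈ Finset.Iio j, h (z k) (z j) : ℝ) : ℂ) *
          Complex.I) - (Real.exp (-(u ^ 2 * m / 2)) : ℂ)) =
          Φ (m + 1) z - Φ m z * (Real.exp (-(u ^ 2 * m / 2)) : ℂ) := by
        intro z
        have : partialPairSum h (m + 1) z =
            partialPairSum h m z + ∑ k ∈ Finset.Iio j, h (z k) (z j) := partialPairSum_succ j z
        simp only [hΦ, this]
        rw [mul_sub, ← Complex.exp_add]
        congr 2
        push_cast
        ring
      simp_rw [e1]
      rw [integral_sub (iΦ _) ((iΦ m).mul_const _), integral_mul_const]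
      have e2 : Real.exp (V (m + 1)) * Real.exp (-(u ^ 2 * m / 2)) = Real.exp (V m) := by
        rw [← Real.exp_add]
        congr 1
        simp only [hV]
        push_cast
        ring
      have e2' : (Real.exp (V (m + 1)) : ℂ) * (Real.exp (-(u ^ 2 * m / 2)) : ℂ) =
          (Real.exp (V m) : ℂ) := by exact_mod_cast e2
      simp only [ha]
      rw [← e2']
      ring
    rw [hdiff, norm_mul, Complex.norm_real, Real.norm_of_nonneg (Real.exp_nonneg _)]
    exact mul_le_mul (Real.exp_le_exp.2 (Vmono m hm)) hle (norm_nonneg _) (Real.exp_nonneg _)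
  have htel : ‖a n - a 0‖ ≤ n * (Real.exp (V n) * B) := by
    have := dist_le_range_sum_of_dist_le (f := a) n (d := fun _ => Real.exp (V n) * B)
      (fun {k} hk => by rw [dist_comm, dist_eq_norm]; exact step k hk)
    rw [dist_comm, dist_eq_norm] at this
    simpa using this
  have ha0 : a 0 = 1 := by simp [ha, hΦ, hV, partialPairSum]
  have hfin : (∫ z, Φ n z ∂π) - (Real.exp (-V n) : ℂ) = (a n - a 0) * (Real.exp (-V n) : ℂ) := by
    rw [ha0, sub_mul, one_mul]
    simp only [ha]
    rw [mul_assoc]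
    have : (Real.exp (V n) : ℂ) * (Real.exp (-V n) : ℂ) = 1 := by
      rw [← Complex.ofReal_mul, ← Real.exp_add]; simp
    rw [this, mul_one]
  have hnB : n * B ≤ (17 * (u ^ 2 * n ^ 2) + 192 * (u ^ 2 * n ^ 2) ^ 2) * (ε + T + g + 1 / n) := by
    set b : ℝ := u ^ 2 * n ^ 2 with hb
    have hb0 : 0 ≤ b := by positivity
    -- In terms of $b=u^2n^2$, which stays bounded when $u$ is of order $1/n$. The coefficients 17
    -- and 192 are $16+1$, from the tail terms, and $4\cdot48$.
    have : n * B = 16 * ε * b + 192 * ε * b ^ 2 + 16 * b * T + b / 2 * (ε + 2 * T + 2 * g) +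
        b ^ 2 / 4 * (1 / n) := by
      simp only [hB, hb]
      field_simp
      ring
    rw [this]
    have p1 : 0 ≤ b * T := by positivity
    have p2 : 0 ≤ b * g := by positivity
    have p3 : 0 ≤ b ^ 2 * T := by positivity
    have p4 : 0 ≤ b ^ 2 * g := by positivity
    have p5 : 0 ≤ b * (1 / n) := by positivity
    have p6 : 0 ≤ b ^ 2 * (1 / n) := by positivity
    have p7 : 0 ≤ b * ε := by positivity
    nlinarith
  have hgoal : ‖(∫ z, Φ n z ∂π) - (Real.exp (-V n) : ℂ)‖ ≤ n * B := by
    rw [hfin, norm_mul, Complex.norm_real, Real.norm_of_nonneg (Real.exp_nonneg _)]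
    calc _ ≤ n * (Real.exp (V n) * B) * Real.exp (-V n) := by gcongr
      _ = n * B * (Real.exp (V n) * Real.exp (-V n)) := by ring
      _ = n * B := by rw [← Real.exp_add]; simp
  exact hgoal.trans hnB

end CentralLimit

/-! ### Product kernels on pairs of independent variables -/

section ProductKernel

/-- The product of two kernels, as a kernel on the product space. -/
def prodKernel {A B : Type*} (f : A → A → ℝ) (g : B → B → ℝ) (z w : A × B) : ℝ :=
  f z.1 w.1 * g z.2 w.2

variable {A B : Type*} [MeasurableSpace A] [MeasurableSpace B] {μ : Measure A} {ν : Measure B}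
  [IsProbabilityMeasure μ] [IsProbabilityMeasure ν] {f : A → A → ℝ} {g : B → B → ℝ}

/-- The regrouping is a measurable equivalence, so no measurability or integrability of `F` and `G`
is needed. This is why second moments, absolute moments and four-point moments of a product kernel
all factor. -/
lemma integral_prod_four (F : A × A → ℝ) (G : B × B → ℝ) :
    ∫ r : (A × B) × (A × B), F (r.1.1, r.2.1) * G (r.1.2, r.2.2) ∂((μ.prod ν).prod (μ.prod ν)) =
      (∫ p, F p ∂(μ.prod μ)) * ∫ q, G q ∂(ν.prod ν) := by
  have hmp := measurePreserving_prodProdProdComm μ ν μ ν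
  have hemb : MeasurableEmbedding
      (fun r : (A × B) × (A × B) => ((r.1.1, r.2.1), (r.1.2, r.2.2))) := by
    let e : (A × B) × (A × B) ≃ᵐ (A × A) × (B × B) :=
      { toFun := fun r => ((r.1.1, r.2.1), (r.1.2, r.2.2))
        invFun := fun r => ((r.1.1, r.2.1), (r.1.2, r.2.2))
        left_inv := fun _ => rfl
        right_inv := fun _ => rfl
        measurable_toFun := by simp only [Equiv.coe_fn_mk]; fun_prop
        measurable_invFun := by simp only [Equiv.coe_fn_symm_mk]; fun_prop }
    exact e.measurableEmbedding
  rw [← integral_prod_mul F G]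
  exact hmp.integral_comp hemb (fun p : (A × A) × (B × B) => F p.1 * G p.2)

lemma integrable_prod_four {F : A × A → ℝ} {G : B × B → ℝ} (hF : Integrable F (μ.prod μ))
    (hG : Integrable G (ν.prod ν)) :
    Integrable (fun r : (A × B) × (A × B) => F (r.1.1, r.2.1) * G (r.1.2, r.2.2))
      ((μ.prod ν).prod (μ.prod ν)) :=
  (measurePreserving_prodProdProdComm μ ν μ ν).integrable_comp_of_integrable (hF.mul_prod hG)

lemma kernelSq_prodKernel :
    kernelSq (μ.prod ν) (prodKernel f g) = kernelSq μ f * kernelSq ν g := by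
  simp only [kernelSq, prodKernel, mul_pow]
  exact integral_prod_four (fun p => f p.1 p.2 ^ 2) (fun p => g p.1 p.2 ^ 2)

lemma composeKernel_prodKernel :
    composeKernel (μ.prod ν) (prodKernel f g) =
      prodKernel (composeKernel μ f) (composeKernel ν g) := by
  ext z w
  simp only [composeKernel, prodKernel]
  rw [← integral_prod_mul]
  congr 1; ext x; ring

lemma IsDegenerateKernel.prodKernel (hf : IsDegenerateKernel μ f) (hg : IsDegenerateKernel ν g) :
    IsDegenerateKernel (μ.prod ν) (prodKernel f g) := by
  have hm : Measurable (fun p : (A × B) × (A × B) => _root_.prodKernel f g p.1 p.2) :=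
    (hf.meas.comp (f := fun p : (A × B) × (A × B) => (p.1.1, p.2.1)) (by fun_prop)).mul
      (hg.meas.comp (f := fun p : (A × B) × (A × B) => (p.1.2, p.2.2)) (by fun_prop))
  refine ⟨hm, fun x y => by simp only [_root_.prodKernel, hf.symm x.1, hg.symm x.2], ?_, ?_⟩
  · filter_upwards [(measurePreserving_fst (μ := μ) (ν := ν)).quasiMeasurePreserving.ae hf.centered]
      with z hz
    simp only [_root_.prodKernel]
    rw [integral_prod_mul, hz, zero_mul]
  · rw [memLp_two_iff_integrable_sq hm.aestronglyMeasurable]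
    simp only [_root_.prodKernel, mul_pow]
    exact integrable_prod_four hf.memLp.integrable_sq hg.memLp.integrable_sq

lemma offDiag_prodKernel {ι : Type*} [DecidableEq ι] (z : ι → A × B) (k l : ι) :
    offDiag (prodKernel f g) z k l =
      offDiag f (fun i => (z i).1) k l * offDiag g (fun i => (z i).2) k l := by
  simp only [offDiag, prodKernel]
  split_ifs <;> simp

variable {ι : Type*} [Fintype ι]

lemma integral_pi_prod_mul (F : (ι → A) → ℝ) (G : (ι → B) → ℝ) :
    ∫ z, F (fun i => (z i).1) * G (fun i => (z i).2) ∂(Measure.pi fun _ : ι => μ.prod ν) =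
      (∫ x, F x ∂(Measure.pi fun _ : ι => μ)) * ∫ y, G y ∂(Measure.pi fun _ : ι => ν) := by
  rw [← integral_prod_mul F G]
  have h := measurePreserving_arrowProdEquivProdArrow A B ι (fun _ => μ) (fun _ => ν)
  exact h.integral_comp (MeasurableEquiv.measurableEmbedding _)
    (fun p : (ι → A) × (ι → B) => F p.1 * G p.2)

lemma measurePreserving_pi_fst :
    MeasurePreserving (fun (z : ι → A × B) i => (z i).1) (Measure.pi fun _ : ι => μ.prod ν)
      (Measure.pi fun _ : ι => μ) :=
  measurePreserving_fst.comp
    (measurePreserving_arrowProdEquivProdArrow A B ι (fun _ => μ) (fun _ => ν))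

lemma measurePreserving_pi_snd :
    MeasurePreserving (fun (z : ι → A × B) i => (z i).2) (Measure.pi fun _ : ι => μ.prod ν)
      (Measure.pi fun _ : ι => ν) :=
  measurePreserving_snd.comp
    (measurePreserving_arrowProdEquivProdArrow A B ι (fun _ => μ) (fun _ => ν))

lemma integrable_pi_prod_mul {F : (ι → A) → ℝ} {G : (ι → B) → ℝ}
    (hF : Integrable F (Measure.pi fun _ : ι => μ)) (hG : Integrable G (Measure.pi fun _ : ι => ν))
        :
    Integrable (fun z : ι → A × B => F (fun i => (z i).1) * G (fun i => (z i).2))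
      (Measure.pi fun _ : ι => μ.prod ν) :=
  (measurePreserving_arrowProdEquivProdArrow A B ι
    (fun _ => μ) (fun _ => ν)).integrable_comp_of_integrable (hF.mul_prod hG)

end ProductKernel

/-! ### Weak law of large numbers over pairs -/

section PairAverage

variable {ι Z : Type*} [Fintype ι] [DecidableEq ι] [MeasurableSpace Z] {ρ : Measure Z}
  [IsProbabilityMeasure ρ]

/-- Counts, with multiplicity, the quadruples of indices whose two pairs overlap; only these
contribute to the variance of a sum over pairs. -/
lemma sum_shared_index (N : ℕ) (hN : Fintype.card ι = N) :
    ∑ k : ι, ∑ l : ι, ∑ k' : ι, ∑ l' : ι, ((if k = k' then (1 : ℝ) else 0) +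
      (if k = l' then 1 else 0) + (if l = k' then 1 else 0) + (if l = l' then 1 else 0)) =
      4 * (N : ℝ) ^ 3 := by
  simp [Finset.sum_add_distrib, hN, Finset.sum_const]
  ring

/-- The second moment of the sum of a bounded centered kernel over all pairs. -/
lemma integral_sum_pairs_sq_le {K : Z × Z → ℝ} (hK : Measurable K) {b : ℝ}
    (hb : ∀ p, |K p| ≤ b) (h0 : ∫ p, K p ∂(ρ.prod ρ) = 0) :
    ∫ z, (∑ k, ∑ l, if k = l then 0 else K (z k, z l)) ^ 2 ∂(Measure.pi fun _ : ι => ρ) ≤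
      4 * (Fintype.card ι : ℝ) ^ 3 * ∫ p, K p ^ 2 ∂(ρ.prod ρ) := by
  set π := Measure.pi fun _ : ι => ρ with hπ
  set D : ι → ι → (ι → Z) → ℝ := fun k l z => if k = l then 0 else K (z k, z l) with hD
  have mD : ∀ k l, Measurable (D k l) := fun k l => by
    simp only [hD]
    split_ifs
    · exact measurable_const
    · exact hK.comp ((measurable_pi_apply k).prodMk (measurable_pi_apply l))
  have bD : ∀ k l z, |D k l z| ≤ b := fun k l z => by
    simp only [hD]
    split_ifs
    · rw [abs_zero]; exact (abs_nonneg _).trans (hb (z k, z k))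
    · exact hb _
  have LD : ∀ k l, MemLp (D k l) 2 π := fun k l =>
    MemLp.of_bound (mD k l).aestronglyMeasurable b (Eventually.of_forall (bD k l))
  have iD : ∀ k l k' l', Integrable (fun z => D k l z * D k' l' z) π := fun k l k' l' =>
    (LD k l).integrable_mul (LD k' l')
  set M := ∫ p, K p ^ 2 ∂(ρ.prod ρ) with hM
  have M0 : 0 ≤ M := integral_nonneg fun _ => sq_nonneg _
  have sqD : ∀ k l, ∫ z, D k l z ^ 2 ∂π ≤ M := by
    intro k l
    simp only [hD]
    split_ifs with h
    · simpa using M0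
    · rw [hπ, integral_pi_pair h (f := fun p => K p ^ 2) (hK.pow_const 2).aestronglyMeasurable]
  have hle : ∀ k l k' l', ∫ z, D k l z * D k' l' z ∂π ≤ M := by
    intro k l k' l'
    calc ∫ z, D k l z * D k' l' z ∂π ≤ ∫ z, (D k l z ^ 2 / 2 + D k' l' z ^ 2 / 2) ∂π := by
          refine integral_mono (iD k l k' l')
            (((LD k l).integrable_sq.div_const 2).add ((LD k' l').integrable_sq.div_const 2)) ?_
          intro z
          have := two_mul_le_add_sq (D k l z) (D k' l' z)
          simp only
          linarith
      _ ≤ M := by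
          rw [integral_add ((LD k l).integrable_sq.div_const 2)
            ((LD k' l').integrable_sq.div_const 2), integral_div, integral_div]
          linarith [sqD k l, sqD k' l']
  have hind : iIndepFun (fun i (z : ι → Z) => z i) π :=
    iIndepFun_pi (X := fun _ => id) fun _ => aemeasurable_id
  -- The kernel here is centered but not degenerate, so only disjoint pairs are uncorrelated.
  -- Overlapping ones are bounded by $E K^2$, which leaves order $N^3$ out of $N^4$.
  have hzero : ∀ k l k' l', k ≠ k' → k ≠ l' → l ≠ k' → l ≠ l' →
      ∫ z, D k l z * D k' l' z ∂π = 0 := by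
    intro k l k' l' h1 h2 h3 h4
    by_cases hkl : k = l
    · simp [hD, hkl]
    by_cases hkl' : k' = l'
    · simp [hD, hkl']
    simp only [hD, if_neg hkl, if_neg hkl']
    have hi := (hind.indepFun_prodMk_prodMk (fun i => measurable_pi_apply i) k l k' l'
      h1 h2 h3 h4).comp hK hK
    have := hi.integral_fun_mul_eq_mul_integral
      (hK.comp ((measurable_pi_apply k).prodMk (measurable_pi_apply l))).aestronglyMeasurable
      (hK.comp ((measurable_pi_apply k').prodMk (measurable_pi_apply l'))).aestronglyMeasurable
    simp only [Function.comp_def] at this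
    rw [this, hπ, integral_pi_pair hkl hK.aestronglyMeasurable, h0, zero_mul]
  have hbound : ∀ k l k' l', ∫ z, D k l z * D k' l' z ∂π ≤
      ((if k = k' then (1 : ℝ) else 0) + (if k = l' then 1 else 0) +
        (if l = k' then 1 else 0) + (if l = l' then 1 else 0)) * M := by
    intro k l k' l'
    by_cases hs : k = k' ∨ k = l' ∨ l = k' ∨ l = l'
    · refine (hle k l k' l').trans (le_mul_of_one_le_left M0 ?_)
      rcases hs with h | h | h | h <;> rw [if_pos h] <;> split_ifs <;> norm_num
    · push Not at hs
      rw [hzero k l k' l' hs.1 hs.2.1 hs.2.2.1 hs.2.2.2]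
      simp [hs]
  have e : ∀ z, (∑ k, ∑ l, D k l z) ^ 2 = ∑ k, ∑ l, ∑ k', ∑ l', D k l z * D k' l' z := by
    intro z
    simp only [sq, Finset.sum_mul, Finset.mul_sum]
    refine Finset.sum_congr rfl fun k _ => Finset.sum_congr rfl fun l _ =>
      Finset.sum_congr rfl fun k' _ => Finset.sum_congr rfl fun l' _ => mul_comm _ _
  show ∫ z, (∑ k, ∑ l, D k l z) ^ 2 ∂π ≤ _
  simp_rw [e]
  rw [integral_finsetSum _ fun k _ => integrable_finsetSum _ fun l _ =>
    integrable_finsetSum _ fun k' _ => integrable_finsetSum _ fun l' _ => iD k l k' l',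
    ← sum_shared_index _ rfl, Finset.sum_mul]
  refine Finset.sum_le_sum fun k _ => ?_
  rw [integral_finsetSum _ fun l _ =>
    integrable_finsetSum _ fun k' _ => integrable_finsetSum _ fun l' _ => iD k l k' l',
    Finset.sum_mul]
  refine Finset.sum_le_sum fun l _ => ?_
  rw [integral_finsetSum _ fun k' _ => integrable_finsetSum _ fun l' _ => iD k l k' l',
    Finset.sum_mul]
  refine Finset.sum_le_sum fun k' _ => ?_
  rw [integral_finsetSum _ fun l' _ => iD k l k' l', Finset.sum_mul]
  exact Finset.sum_le_sum fun l' _ => hbound k l k' l'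

lemma sum_offDiag_const (N : ℕ) (hN : Fintype.card ι = N) (a : ℝ) :
    ∑ k : ι, ∑ l : ι, (if k = l then 0 else a) = N * (N - 1) * a := by
  have : ∀ k l : ι, (if k = l then 0 else a) = a - if k = l then a else 0 := by
    intro k l; split_ifs <;> simp
  simp_rw [this, Finset.sum_sub_distrib]
  simp [hN]
  ring

variable {h : Z → Z → ℝ}

/-- The weak law of large numbers for the squares of the pairwise kernel values. -/
lemma IsDegenerateKernel.integral_abs_sum_sq_sub_le (hh : IsDegenerateKernel ρ h)
    (h1 : kernelSq ρ h = 1) {c : ℝ} (hc : 0 ≤ c) {n : ℕ} (hn : 1 ≤ n) (hcard : Fintype.card ι = n) :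
    ∫ z, |∑ k, ∑ l, offDiag h z k l ^ 2 - n * (n - 1)| ∂(Measure.pi fun _ : ι => ρ) ≤
      √(4 * (n : ℝ) ^ 3 * c) + 2 * (n * (n - 1)) * tailSq ρ h c := by
  set π := Measure.pi fun _ : ι => ρ with hπ
  have hset : MeasurableSet {p : Z × Z | c < h p.1 p.2 ^ 2} :=
    measurableSet_lt measurable_const (hh.meas.pow_const 2)
  -- Truncation at level $c$: $F_1\in[0,c]$ has mean at most 1, hence variance at most $c$, while
  -- $F_2$ is controlled through its mean `tailSq`. No fourth moment of `h` is used.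
  set F₁ : Z × Z → ℝ := fun p => if c < h p.1 p.2 ^ 2 then 0 else h p.1 p.2 ^ 2 with hF₁
  set F₂ : Z × Z → ℝ := fun p => if c < h p.1 p.2 ^ 2 then h p.1 p.2 ^ 2 else 0 with hF₂
  have m₁ : Measurable F₁ := Measurable.ite hset measurable_const (hh.meas.pow_const 2)
  have m₂ : Measurable F₂ := Measurable.ite hset (hh.meas.pow_const 2) measurable_const
  have n₁ : ∀ p, 0 ≤ F₁ p := fun p => by simp only [hF₁]; split_ifs <;> simp [sq_nonneg]
  have n₂ : ∀ p, 0 ≤ F₂ p := fun p => by simp only [hF₂]; split_ifs <;> simp [sq_nonneg]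
  have b₁ : ∀ p, F₁ p ≤ c := fun p => by
    simp only [hF₁]; split_ifs with hp
    · exact hc
    · exact not_lt.1 hp
  have L₁ : MemLp F₁ 2 (ρ.prod ρ) := MemLp.of_bound m₁.aestronglyMeasurable c
    (Eventually.of_forall fun p => by rw [Real.norm_of_nonneg (n₁ p)]; exact b₁ p)
  have i₁ : Integrable F₁ (ρ.prod ρ) := L₁.integrable (by norm_num)
  have i₂ : Integrable F₂ (ρ.prod ρ) := hh.integrable_tail c
  have hsum : ∀ p : Z × Z, h p.1 p.2 ^ 2 = F₁ p + F₂ p := fun p => by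
    simp only [hF₁, hF₂]; split_ifs <;> simp
  set T := tailSq ρ h c with hT
  have T0 : 0 ≤ T := integral_nonneg n₂
  have e₁ : ∫ p, F₁ p ∂(ρ.prod ρ) = 1 - T := by
    rw [eq_sub_iff_add_eq, hT, tailSq, ← integral_add i₁ i₂, ← h1, kernelSq]
    exact integral_congr_ae (Eventually.of_forall fun p => (hsum p).symm)
  have K0 : ∫ p, (F₁ p - (1 - T)) ∂(ρ.prod ρ) = 0 := by
    rw [integral_sub i₁ (integrable_const _), e₁]; simp
  have Kb : ∀ p, |F₁ p - (1 - T)| ≤ c + |1 - T| := fun p =>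
    (abs_sub _ _).trans (by rw [abs_of_nonneg (n₁ p)]; linarith [b₁ p])
  have K2 : ∫ p, (F₁ p - (1 - T)) ^ 2 ∂(ρ.prod ρ) ≤ c := by
    rw [← e₁]
    refine (integral_sub_mean_sq_le L₁).trans ?_
    calc ∫ p, F₁ p ^ 2 ∂(ρ.prod ρ) ≤ ∫ p, c * F₁ p ∂(ρ.prod ρ) := by
          refine integral_mono L₁.integrable_sq (i₁.const_mul _) ?_
          intro p
          simp only [sq]
          exact mul_le_mul_of_nonneg_right (b₁ p) (n₁ p)
      _ = c * (1 - T) := by rw [integral_const_mul, e₁]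
      _ ≤ c := by nlinarith
  have hvar := integral_sum_pairs_sq_le (ι := ι) (m₁.sub_const (1 - T)) Kb K0
  set W : (ι → Z) → ℝ := fun z =>
    ∑ k, ∑ l, if k = l then 0 else (F₁ (z k, z l) - (1 - T)) with hW
  set W₂ : (ι → Z) → ℝ := fun z => ∑ k, ∑ l, if k = l then 0 else F₂ (z k, z l) with hW₂
  have WL : MemLp W 2 π := by
    refine memLp_finsetSum _ fun k _ => memLp_finsetSum _ fun l _ => ?_
    split_ifs with hkl
    · simp
    · exact (L₁.sub (memLp_const _)).comp_measurePreserving (measurePreserving_pair hkl)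
  have i₂' : ∀ k l : ι, Integrable (fun z : ι → Z => if k = l then 0 else F₂ (z k, z l)) π := by
    intro k l
    split_ifs with hkl
    · simp
    · exact (measurePreserving_pair hkl).integrable_comp_of_integrable i₂
  have W₂i : Integrable W₂ π := integrable_finsetSum _ fun k _ => integrable_finsetSum _
    fun l _ => i₂' k l
  have hn1 : (0 : ℝ) ≤ n * (n - 1) := by
    have : (1 : ℝ) ≤ n := by exact_mod_cast hn
    nlinarith
  have W₂e : ∫ z, W₂ z ∂π = n * (n - 1) * T := by
    simp only [hW₂]
    rw [integral_finsetSum _ fun k _ => integrable_finsetSum _ fun l _ => i₂' k l]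
    simp_rw [integral_finsetSum _ fun l _ => i₂' _ l]
    rw [← sum_offDiag_const n hcard T]
    refine Finset.sum_congr rfl fun k _ => Finset.sum_congr rfl fun l _ => ?_
    split_ifs with hkl
    · simp
    · rw [hπ, integral_pi_pair hkl m₂.aestronglyMeasurable]
      rfl
  have W₂n : ∀ z, 0 ≤ W₂ z := fun z => Finset.sum_nonneg fun k _ => Finset.sum_nonneg fun l _ => by
    split_ifs
    · exact le_rfl
    · exact n₂ _
  calc ∫ z, |∑ k, ∑ l, offDiag h z k l ^ 2 - n * (n - 1)| ∂π
      ≤ ∫ z, (|W z| + W₂ z + n * (n - 1) * T) ∂π := by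
        refine integral_mono_of_nonneg (Eventually.of_forall fun z => abs_nonneg _)
          (((WL.integrable (by norm_num)).abs.add W₂i).add (integrable_const _))
          (Eventually.of_forall fun z => ?_)
        have e : ∑ k, ∑ l, offDiag h z k l ^ 2 - n * (n - 1) = W z + W₂ z - n * (n - 1) * T := by
          have e' : ∑ k, ∑ l, offDiag h z k l ^ 2 = W z + W₂ z +
              ∑ k : ι, ∑ l : ι, (if k = l then 0 else (1 - T)) := by
            simp only [hW, hW₂, ← Finset.sum_add_distrib]
            refine Finset.sum_congr rfl fun k _ => Finset.sum_congr rfl fun l _ => ?_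
            simp only [offDiag]
            split_ifs
            · simp
            · rw [hsum (z k, z l)]; ring
          rw [e', sum_offDiag_const n hcard]
          ring
        simp only [e]
        refine (abs_sub _ _).trans (add_le_add ((abs_add_le _ _).trans (add_le_add le_rfl ?_)) ?_)
        · rw [abs_of_nonneg (W₂n z)]
        · rw [abs_of_nonneg (mul_nonneg hn1 T0)]
    _ = ∫ z, |W z| ∂π + n * (n - 1) * T + n * (n - 1) * T := by
        rw [integral_add, integral_add, W₂e]
        · simp
        · exact (WL.integrable (by norm_num)).abs
        · exact W₂i
        · exact (WL.integrable (by norm_num)).abs.add W₂i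
        · exact integrable_const _
    _ ≤ √(4 * (n : ℝ) ^ 3 * c) + n * (n - 1) * T + n * (n - 1) * T := by
        refine add_le_add (add_le_add ((integral_abs_le_sqrt WL).trans (Real.sqrt_le_sqrt ?_))
          le_rfl) le_rfl
        rw [hcard] at hvar
        exact hvar.trans (mul_le_mul_of_nonneg_left K2 (by positivity))
    _ = _ := by ring

end PairAverage

/-! ### Algebra of U-centering -/

noncomputable section

/-- The inner product of the `𝒰`-centered versions of two symmetric matrices with zero diagonal,
written in terms of the matrices themselves. -/
def uInner {n : ℕ} (D E : Fin n → Fin n → ℝ) : ℝ :=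
  1 / ((n : ℝ) * ((n : ℝ) - 3)) * (∑ k, ∑ l, D k l * E k l
    - 2 / ((n : ℝ) - 2) * ∑ k, (∑ l, D k l) * (∑ l, E k l)
    + 1 / (((n : ℝ) - 1) * ((n : ℝ) - 2)) * ((∑ k, ∑ l, D k l) * (∑ k, ∑ l, E k l)))

/-- The `𝒰`-centering of a matrix. -/
def uMatrix {n : ℕ} (D : Fin n → Fin n → ℝ) (k l : Fin n) : ℝ :=
  D k l - 1 / ((n : ℝ) - 2) * ∑ i, D i l - 1 / ((n : ℝ) - 2) * ∑ j, D k j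
    + 1 / (((n : ℝ) - 1) * ((n : ℝ) - 2)) * ∑ i, ∑ j, D i j

end

section UCentering

variable {n : ℕ}

/-- `𝒰`-centering kills additive perturbations of the off-diagonal entries. -/
lemma uMatrix_eq_of_additive (hn : 4 ≤ n) {a D : Fin n → Fin n → ℝ} {u : Fin n → ℝ}
    (h : ∀ k l, a k l = D k l + if k = l then 0 else u k + u l) {k l : Fin n} (hkl : k ≠ l) :
    uMatrix a k l = uMatrix D k l := by
  have hn' : (4 : ℝ) ≤ n := by exact_mod_cast hn
  have h2 : (n : ℝ) - 2 ≠ 0 := by linarith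
  have h1 : (n : ℝ) - 1 ≠ 0 := by linarith
  -- The diagonal is not perturbed, so a column gains $(n-1)u_l+\sum_{i\ne
  -- l}u_i=(n-2)u_l+\sum_iu_i$. This explains the divisor $n-2$ of U-centering.
  have hcol : ∀ l, ∑ i, a i l = ∑ i, D i l + (((n : ℝ) - 2) * u l + ∑ i, u i) := by
    intro l
    have : ∀ i, a i l = D i l + (u i + u l - if i = l then u i + u l else 0) := by
      intro i; rw [h]; split_ifs <;> ring
    simp_rw [this, Finset.sum_add_distrib, Finset.sum_sub_distrib, Finset.sum_add_distrib]
    simp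
    ring
  have hrow : ∀ k, ∑ j, a k j = ∑ j, D k j + (((n : ℝ) - 2) * u k + ∑ i, u i) := by
    intro k
    have : ∀ j, a k j = D k j + (u k + u j - if k = j then u k + u j else 0) := by
      intro j; rw [h]; split_ifs <;> ring
    simp_rw [this, Finset.sum_add_distrib, Finset.sum_sub_distrib, Finset.sum_add_distrib]
    simp
    ring
  have htot : ∑ i, ∑ j, a i j = ∑ i, ∑ j, D i j + 2 * ((n : ℝ) - 1) * ∑ i, u i := by
    simp_rw [hrow, Finset.sum_add_distrib, ← Finset.mul_sum]
    simp
    ring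
  rw [uMatrix, htot, hcol, hrow, h k l, if_neg hkl, uMatrix]
  field_simp
  ring

/-- Expresses the off-diagonal inner product through entries, row sums and totals of the raw
matrices, whose moments are computable. A U-centered matrix as defined here may have a nonzero
diagonal, so the sum is the full one minus the diagonal one. -/
lemma sum_uMatrix_mul (hn : 4 ≤ n) {D E : Fin n → Fin n → ℝ} (hD : ∀ k l, D k l = D l k)
    (hE : ∀ k l, E k l = E l k) (hD0 : ∀ k, D k k = 0) (hE0 : ∀ k, E k k = 0) :
    1 / ((n : ℝ) * ((n : ℝ) - 3)) *
      ∑ k, ∑ l, (if k ≠ l then uMatrix D k l * uMatrix E k l else 0) = uInner D E := by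
  have hn' : (4 : ℝ) ≤ n := by exact_mod_cast hn
  have h2 : (n : ℝ) - 2 ≠ 0 := by linarith
  have h1 : (n : ℝ) - 1 ≠ 0 := by linarith
  rw [uInner]
  congr 1
  set r : ℝ := 1 / ((n : ℝ) - 2) with hr
  set q : ℝ := 1 / (((n : ℝ) - 1) * ((n : ℝ) - 2)) with hq
  set d : Fin n → ℝ := fun k => ∑ l, D k l with hd
  set e : Fin n → ℝ := fun k => ∑ l, E k l with he
  set dt : ℝ := ∑ k, d k with hdt
  set et : ℝ := ∑ k, e k with het
  have uD : ∀ k l, uMatrix D k l = D k l - r * d l - r * d k + q * dt := by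
    intro k l
    have : ∑ i, D i l = d l := Finset.sum_congr rfl fun i _ => hD i l
    simp only [uMatrix, this]
    rfl
  have uE : ∀ k l, uMatrix E k l = E k l - r * e l - r * e k + q * et := by
    intro k l
    have : ∑ i, E i l = e l := Finset.sum_congr rfl fun i _ => hE i l
    simp only [uMatrix, this]
    rfl
  have hoff : ∑ k, ∑ l, (if k ≠ l then uMatrix D k l * uMatrix E k l else 0) =
      ∑ k, ∑ l, uMatrix D k l * uMatrix E k l - ∑ k, uMatrix D k k * uMatrix E k k := by
    rw [← Finset.sum_sub_distrib]
    refine Finset.sum_congr rfl fun k _ => ?_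
    have : ∀ l, (if k ≠ l then uMatrix D k l * uMatrix E k l else 0) =
        uMatrix D k l * uMatrix E k l - if k = l then uMatrix D k l * uMatrix E k l else 0 := by
      intro l; by_cases h : k = l <;> simp [h]
    simp_rw [this, Finset.sum_sub_distrib]
    simp
  have s1 : ∑ k, ∑ l, D k l * e l = ∑ k, d k * e k := by
    rw [Finset.sum_comm]
    refine Finset.sum_congr rfl fun l _ => ?_
    rw [← Finset.sum_mul]
    congr 1
    exact Finset.sum_congr rfl fun i _ => hD i l
  have s2 : ∑ k, ∑ l, E k l * d l = ∑ k, d k * e k := by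
    rw [Finset.sum_comm]
    refine Finset.sum_congr rfl fun l _ => ?_
    rw [← Finset.sum_mul, mul_comm]
    congr 1
    exact Finset.sum_congr rfl fun i _ => hE i l
  have inner : ∀ k, ∑ l, uMatrix D k l * uMatrix E k l =
      ∑ l, D k l * E k l - r * ∑ l, D k l * e l - r * ∑ l, E k l * d l
        + r ^ 2 * ∑ l, d l * e l
        - 2 * r * (d k * e k) + q * et * d k + q * dt * e k
        + r ^ 2 * (dt * e k) + r ^ 2 * (d k * et)
        - 2 * r * q * (dt * et) + n * (r * d k - q * dt) * (r * e k - q * et) := by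
    intro k
    have : ∀ l, uMatrix D k l * uMatrix E k l = D k l * E k l - r * (D k l * e l)
        - r * (E k l * d l) + r ^ 2 * (d l * e l) - (r * e k - q * et) * D k l
        - (r * d k - q * dt) * E k l + r * (r * e k - q * et) * d l
        + r * (r * d k - q * dt) * e l + (r * d k - q * dt) * (r * e k - q * et) := by
      intro l; rw [uD, uE]; ring
    simp_rw [this, Finset.sum_add_distrib, Finset.sum_sub_distrib, Finset.sum_add_distrib,
      Finset.sum_sub_distrib, ← Finset.mul_sum, Finset.sum_const, Finset.card_univ,
      Fintype.card_fin, nsmul_eq_mul]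
    rw [show ∑ l, D k l = d k from rfl, show ∑ l, E k l = e k from rfl, ← hdt, ← het]
    ring
  have diag : ∀ k, uMatrix D k k * uMatrix E k k =
      4 * r ^ 2 * (d k * e k) - 2 * r * q * et * d k - 2 * r * q * dt * e k
        + q ^ 2 * (dt * et) := by
    intro k; rw [uD, uE, hD0, hE0]; ring
  have full : ∑ k, ∑ l, uMatrix D k l * uMatrix E k l =
      ∑ k, ∑ l, D k l * E k l + (2 * n * r ^ 2 - 4 * r) * ∑ k, d k * e k
        + (2 * q + 2 * r ^ 2 - 4 * n * r * q + n ^ 2 * q ^ 2) * (dt * et) := by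
    have e1 : ∀ k, (n : ℝ) * (r * d k - q * dt) * (r * e k - q * et) =
        n * r ^ 2 * (d k * e k) - n * r * q * et * d k - n * r * q * dt * e k
          + n * q ^ 2 * (dt * et) := fun k => by ring
    have e2 : ∀ k, r ^ 2 * (dt * e k) = r ^ 2 * dt * e k := fun k => by ring
    have e3 : ∀ k, r ^ 2 * (d k * et) = r ^ 2 * et * d k := fun k => by ring
    simp only [inner, e1, e2, e3, Finset.sum_add_distrib, Finset.sum_sub_distrib,
      ← Finset.mul_sum, Finset.sum_const, Finset.card_univ, Fintype.card_fin, nsmul_eq_mul]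
    rw [s1, s2, ← hdt, ← het]
    ring
  have dsum : ∑ k, uMatrix D k k * uMatrix E k k =
      4 * r ^ 2 * ∑ k, d k * e k + (n * q ^ 2 - 4 * r * q) * (dt * et) := by
    simp_rw [diag, Finset.sum_add_distrib, Finset.sum_sub_distrib, ← Finset.mul_sum,
      Finset.sum_const, Finset.card_univ, Fintype.card_fin, nsmul_eq_mul]
    rw [← hdt, ← het]
    ring
  rw [hoff, full, dsum]
  -- The coefficients of $\sum_kd_ke_k$ and of the product of the totals collapse after substituting
  -- $r=1/(n-2)$ and $q=1/((n-1)(n-2))$.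
  have c1 : 2 * (n : ℝ) * r ^ 2 - 4 * r - 4 * r ^ 2 = -(2 / ((n : ℝ) - 2)) := by
    rw [hr]; field_simp; ring
  have c2 : 2 * q + 2 * r ^ 2 - 4 * n * r * q + n ^ 2 * q ^ 2 - (n * q ^ 2 - 4 * r * q) = q := by
    rw [hr, hq]; field_simp; ring
  linear_combination (∑ k, d k * e k) * c1 + (dt * et) * c2

end UCentering

/-! ### Row sums and totals of degenerate kernels -/

section PairStatistics

variable {Z : Type*} [MeasurableSpace Z] {ρ : Measure Z} [IsProbabilityMeasure ρ] {h : Z → Z → ℝ}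
  {n : ℕ}

lemma IsDegenerateKernel.sum_offDiag_eq (hh : IsDegenerateKernel ρ h) (z : Fin n → Z) :
    ∑ k, ∑ l, offDiag h z k l = 2 * partialPairSum h n z := by
  have e1 : partialPairSum h n z = ∑ i, ∑ k, if k < i then h (z k) (z i) else 0 := by
    simp only [partialPairSum, Fin.is_lt, Finset.filter_true]
    refine Finset.sum_congr rfl fun i _ => ?_
    rw [← Finset.sum_filter]
    refine Finset.sum_congr ?_ fun _ _ => rfl
    ext; simp
  have e2 : partialPairSum h n z = ∑ i, ∑ k, if i < k then h (z i) (z k) else 0 := by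
    rw [e1, Finset.sum_comm]
  rw [two_mul]
  nth_rw 1 [e1]
  rw [e2, ← Finset.sum_add_distrib]
  refine Finset.sum_congr rfl fun i _ => ?_
  rw [← Finset.sum_add_distrib]
  refine Finset.sum_congr rfl fun k _ => ?_
  rcases lt_trichotomy i k with hik | hik | hik
  · simp [offDiag, hik, hik.ne, hik.not_gt]
  · simp [offDiag, hik]
  · simp [offDiag, hik, hik.ne', hik.not_gt, hh.symm (z i)]

lemma IsDegenerateKernel.integral_total_sq (hh : IsDegenerateKernel ρ h) (h1 : kernelSq ρ h = 1) :
    ∫ z, (∑ k, ∑ l, offDiag h z k l) ^ 2 ∂(Measure.pi fun _ : Fin n => ρ) =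
      2 * ((n : ℝ) * (n - 1)) := by
  have := hh.integral_sum_offDiag_sq (ι := Fin n) (fun _ _ => 1)
  simp only [one_mul, h1] at this
  rw [this, sum_offDiag_const n (Fintype.card_fin n)]
  ring

lemma IsDegenerateKernel.memLp_total (hh : IsDegenerateKernel ρ h) :
    MemLp (fun z : Fin n → Z => ∑ k, ∑ l, offDiag h z k l) 2 (Measure.pi fun _ : Fin n => ρ) :=
  memLp_finsetSum _ fun k _ => memLp_finsetSum _ fun l _ => hh.memLp_offDiag k l

lemma IsDegenerateKernel.memLp_rowSum (hh : IsDegenerateKernel ρ h) (k : Fin n) :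
    MemLp (fun z : Fin n → Z => ∑ l, offDiag h z k l) 2 (Measure.pi fun _ : Fin n => ρ) :=
  memLp_finsetSum _ fun l _ => hh.memLp_offDiag k l

/-- The covariances of the row sums. -/
lemma IsDegenerateKernel.integral_rowSum_mul (hh : IsDegenerateKernel ρ h) (h1 : kernelSq ρ h = 1)
    (k k' : Fin n) :
    ∫ z, (∑ l, offDiag h z k l) * (∑ l, offDiag h z k' l) ∂(Measure.pi fun _ : Fin n => ρ) =
      if k = k' then (n : ℝ) - 1 else 1 := by
  have hi : ∀ l l', Integrable (fun z : Fin n → Z => offDiag h z k l * offDiag h z k' l')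
      (Measure.pi fun _ : Fin n => ρ) := fun l l' => hh.integrable_offDiag_mul k l k' l'
  simp_rw [Finset.sum_mul_sum]
  rw [integral_finsetSum _ fun l _ => integrable_finsetSum _ fun l' _ => hi l l']
  simp_rw [integral_finsetSum _ fun l' _ => hi _ l', hh.integral_offDiag_mul, h1, one_mul]
  -- For equal rows the $n-1$ off-diagonal entries each contribute 1; two distinct rows share only
  -- the entry of the pair $\{k,k'\}$.
  by_cases hk : k = k'
  · subst hk
    have : ∀ l l', (if k = l then (0 : ℝ) else ((if k = k ∧ l = l' then 1 else 0) +
        (if k = l' ∧ l = k then 1 else 0))) =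
        (if l = l' then 1 else 0) - (if k = l then (if k = l' then 1 else 0) else 0) := by
      intro l l'
      by_cases h1 : k = l
      · subst h1; simp
      · simp [h1, Ne.symm h1]
    refine (Finset.sum_congr rfl fun l _ => Finset.sum_congr rfl fun l' _ => this l l').trans ?_
    simp [Finset.sum_sub_distrib]
  · have : ∀ l l', (if k = l then (0 : ℝ) else ((if k = k' ∧ l = l' then 1 else 0) +
        (if k = l' ∧ l = k' then 1 else 0))) =
        if k' = l then (if k = l' then 1 else 0) else 0 := by
      intro l l'
      by_cases h1 : k = l
      · subst h1; simp [Ne.symm hk]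
      · by_cases h2 : k' = l
        · subst h2; simp [hk]
        · simp [h1, h2, hk, Ne.symm h2]
    simp_rw [this]
    simp [hk]

end PairStatistics

/-! ### Concentration of the sample distance variance -/

section SampleVariance

variable {Z : Type*} [MeasurableSpace Z] {ρ : Measure Z} [IsProbabilityMeasure ρ] {h : Z → Z → ℝ}
  {n : ℕ}

lemma IsDegenerateKernel.integrable_sum_sq (hh : IsDegenerateKernel ρ h) :
    Integrable (fun z : Fin n → Z => ∑ k, ∑ l, offDiag h z k l ^ 2)
      (Measure.pi fun _ : Fin n => ρ) :=
  integrable_finsetSum _ fun k _ => integrable_finsetSum _ fun l _ =>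
    (hh.memLp_offDiag k l).integrable_sq

/-- The bias-corrected sample distance variance concentrates. -/
lemma IsDegenerateKernel.integral_abs_uInner_sub_one_le (hh : IsDegenerateKernel ρ h)
    (h1 : kernelSq ρ h = 1) (hn : 6 ≤ n) {ε : ℝ} (hε : 0 < ε) :
    ∫ z, |uInner (offDiag h z) (offDiag h z) - 1| ∂(Measure.pi fun _ : Fin n => ρ) ≤
      4 * ε + 4 * tailSq ρ h (ε ^ 2 * n) + 10 / n := by
  have hn' : (6 : ℝ) ≤ n := by exact_mod_cast hn
  have p0 : (0 : ℝ) < n := by linarith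
  have p1 : (0 : ℝ) < (n : ℝ) - 1 := by linarith
  have p2 : (0 : ℝ) < (n : ℝ) - 2 := by linarith
  have p3 : (0 : ℝ) < (n : ℝ) - 3 := by linarith
  set π := Measure.pi fun _ : Fin n => ρ with hπ
  have T0 : 0 ≤ tailSq ρ h (ε ^ 2 * n) := integral_nonneg fun p => by
    show (0 : ℝ) ≤ if _ then _ else _
    split_ifs <;> positivity
  have hW := hh.integral_abs_sum_sq_sub_le h1 (c := ε ^ 2 * n) (by positivity)
    (by omega : 1 ≤ n) (Fintype.card_fin n)
  have hsqrt : √(4 * (n : ℝ) ^ 3 * (ε ^ 2 * n)) = 2 * n ^ 2 * ε := by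
    rw [show 4 * (n : ℝ) ^ 3 * (ε ^ 2 * n) = (2 * n ^ 2 * ε) ^ 2 by ring]
    exact Real.sqrt_sq (by positivity)
  rw [hsqrt] at hW
  set T := tailSq ρ h (ε ^ 2 * n) with hT
  have iW : Integrable (fun z : Fin n → Z => |∑ k, ∑ l, offDiag h z k l ^ 2 - n * (n - 1)|) π :=
    (hh.integrable_sum_sq.sub (integrable_const _)).abs
  have iR : Integrable (fun z : Fin n → Z => ∑ k, (∑ l, offDiag h z k l) ^ 2) π :=
    integrable_finsetSum _ fun k _ => (hh.memLp_rowSum k).integrable_sq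
  have iT : Integrable (fun z : Fin n → Z => (∑ k, ∑ l, offDiag h z k l) ^ 2) π :=
    hh.memLp_total.integrable_sq
  have vR : ∫ z, ∑ k, (∑ l, offDiag h z k l) ^ 2 ∂π = n * ((n : ℝ) - 1) := by
    rw [integral_finsetSum _ fun k _ => (hh.memLp_rowSum k).integrable_sq]
    have hk : ∀ k : Fin n, ∫ z, (∑ l, offDiag h z k l) ^ 2 ∂π = (n : ℝ) - 1 := fun k => by
      have := hh.integral_rowSum_mul h1 k k
      rw [if_pos rfl] at this
      simpa only [sq] using this
    exact (Finset.sum_congr rfl fun k _ => hk k).trans (by simp [mul_sub])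
  have vT := hh.integral_total_sq (n := n) h1
  set c₁ : ℝ := 1 / ((n : ℝ) * (n - 3)) with hc₁
  have c₁0 : 0 ≤ c₁ := by positivity
  set q : ℝ := 1 / (((n : ℝ) - 1) * (n - 2)) with hq
  have q0 : 0 ≤ q := by positivity
  calc ∫ z, |uInner (offDiag h z) (offDiag h z) - 1| ∂π
      ≤ ∫ z, (c₁ * |∑ k, ∑ l, offDiag h z k l ^ 2 - n * (n - 1)| +
          c₁ * (2 / ((n : ℝ) - 2)) * ∑ k, (∑ l, offDiag h z k l) ^ 2 +
          c₁ * q * (∑ k, ∑ l, offDiag h z k l) ^ 2 + 2 / ((n : ℝ) - 3)) ∂π := by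
        refine integral_mono_of_nonneg (Eventually.of_forall fun z => abs_nonneg _)
          ((((iW.const_mul _).add (iR.const_mul _)).add (iT.const_mul _)).add
            (integrable_const _)) (Eventually.of_forall fun z => ?_)
        -- The constant $2/(n-3)$ is the mismatch $n(n-1)/(n(n-3))-1$. The row and total terms are
        -- nonnegative, and by orthogonality their means make them $O(1/n)$ and $O(1/n^2)$ after
        -- weighting.
        have e : uInner (offDiag h z) (offDiag h z) - 1 =
            c₁ * (∑ k, ∑ l, offDiag h z k l ^ 2 - n * (n - 1)) -
            c₁ * (2 / ((n : ℝ) - 2)) * ∑ k, (∑ l, offDiag h z k l) ^ 2 +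
            c₁ * q * (∑ k, ∑ l, offDiag h z k l) ^ 2 + 2 / ((n : ℝ) - 3) := by
          simp only [uInner, ← sq]
          have : c₁ * (n * ((n : ℝ) - 1)) - 1 = 2 / ((n : ℝ) - 3) := by
            rw [hc₁]; field_simp; ring
          rw [← this]
          ring
        have r0 : 0 ≤ ∑ k, (∑ l, offDiag h z k l) ^ 2 := Finset.sum_nonneg fun _ _ => sq_nonneg _
        simp only [e]
        refine (abs_add_le _ _).trans (add_le_add ((abs_add_le _ _).trans (add_le_add
          ((abs_sub _ _).trans (add_le_add ?_ ?_)) ?_)) ?_)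
        · rw [abs_mul, abs_of_nonneg c₁0]
        · rw [abs_of_nonneg]; positivity
        · rw [abs_of_nonneg]; positivity
        · rw [abs_of_nonneg]; positivity
    _ = c₁ * ∫ z, |∑ k, ∑ l, offDiag h z k l ^ 2 - n * (n - 1)| ∂π +
          c₁ * (2 / ((n : ℝ) - 2)) * (n * ((n : ℝ) - 1)) +
          c₁ * q * (2 * (n * ((n : ℝ) - 1))) + 2 / ((n : ℝ) - 3) := by
        rw [integral_add, integral_add, integral_add, integral_const_mul, integral_const_mul,
          integral_const_mul, vR, vT]
        · simp
        · exact iW.const_mul _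
        · exact iR.const_mul _
        · exact (iW.const_mul _).add (iR.const_mul _)
        · exact iT.const_mul _
        · exact ((iW.const_mul _).add (iR.const_mul _)).add (iT.const_mul _)
        · exact integrable_const _
    _ ≤ c₁ * (2 * n ^ 2 * ε + 2 * (n * (n - 1)) * T) +
          c₁ * (2 / ((n : ℝ) - 2)) * (n * ((n : ℝ) - 1)) +
          c₁ * q * (2 * (n * ((n : ℝ) - 1))) + 2 / ((n : ℝ) - 3) := by
        have := mul_le_mul_of_nonneg_left hW c₁0
        linarith
    _ = 2 * ε * (n / ((n : ℝ) - 3)) + 2 * T * (((n : ℝ) - 1) / (n - 3)) +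
          2 * (n - 1) / ((n - 2) * (n - 3)) + 2 / ((n - 2) * (n - 3)) + 2 / ((n : ℝ) - 3) := by
        rw [hc₁, hq]; field_simp
    _ ≤ 2 * ε * 2 + 2 * T * 2 + 5 / n + 1 / n + 4 / n := by
        have b1 : n / ((n : ℝ) - 3) ≤ 2 := by rw [div_le_iff₀ p3]; linarith
        have b2 : ((n : ℝ) - 1) / (n - 3) ≤ 2 := by rw [div_le_iff₀ p3]; linarith
        have b3 : 2 * ((n : ℝ) - 1) / ((n - 2) * (n - 3)) ≤ 5 / n := by
          rw [div_le_div_iff₀ (by positivity) p0]; nlinarith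
        have b4 : 2 / (((n : ℝ) - 2) * (n - 3)) ≤ 1 / n := by
          rw [div_le_div_iff₀ (by positivity) p0]; nlinarith
        have b5 : 2 / ((n : ℝ) - 3) ≤ 4 / n := by
          rw [div_le_div_iff₀ p3 p0]; linarith
        gcongr
    _ = _ := by ring

end SampleVariance

/-! ### The sample distance covariance as a $U$-statistic -/

section SampleCovariance

variable {A B : Type*} [MeasurableSpace A] [MeasurableSpace B] {μ : Measure A} {ν : Measure B}
  [IsProbabilityMeasure μ] [IsProbabilityMeasure ν] {f : A → A → ℝ} {g : B → B → ℝ} {n : ℕ}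

/-- Independence of the two samples factors the expectation, and each total has second moment
$2n(n-1)$. -/
lemma integral_abs_total_mul_le (hf : IsDegenerateKernel μ f) (hg : IsDegenerateKernel ν g)
    (hf1 : kernelSq μ f = 1) (hg1 : kernelSq ν g = 1) (hn : 1 ≤ n) :
    ∫ z, |(∑ k, ∑ l, offDiag f (fun i => (z i).1) k l) *
        (∑ k, ∑ l, offDiag g (fun i => (z i).2) k l)| ∂(Measure.pi fun _ : Fin n => μ.prod ν) ≤
      2 * (n * ((n : ℝ) - 1)) := by
  have hn' : (1 : ℝ) ≤ n := by exact_mod_cast hn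
  simp_rw [abs_mul]
  rw [integral_pi_prod_mul (fun x : Fin n → A => |∑ k, ∑ l, offDiag f x k l|)
    (fun y : Fin n → B => |∑ k, ∑ l, offDiag g y k l|)]
  have h1 := integral_abs_le_sqrt (hf.memLp_total (n := n))
  have h2 := integral_abs_le_sqrt (hg.memLp_total (n := n))
  rw [hf.integral_total_sq hf1] at h1
  rw [hg.integral_total_sq hg1] at h2
  refine (mul_le_mul h1 h2 (integral_nonneg fun _ => abs_nonneg _) (Real.sqrt_nonneg _)).trans_eq ?_
  exact Real.mul_self_sqrt (by nlinarith)

/-- By independence the covariances of the products of row sums are $(n-1)^2$ on the diagonal and 1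
off it; their sum $n^2(n-1)$ is below $n^3$. Bounding each product separately would give order $n^2$
instead of $n^{3/2}$. -/
lemma integral_abs_sum_rowSum_mul_le (hf : IsDegenerateKernel μ f) (hg : IsDegenerateKernel ν g)
    (hf1 : kernelSq μ f = 1) (hg1 : kernelSq ν g = 1) :
    ∫ z, |∑ k, (∑ l, offDiag f (fun i => (z i).1) k l) *
        (∑ l, offDiag g (fun i => (z i).2) k l)| ∂(Measure.pi fun _ : Fin n => μ.prod ν) ≤
      √((n : ℝ) ^ 3) := by
  set π := Measure.pi fun _ : Fin n => μ.prod ν with hπ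
  set R : Fin n → (Fin n → A × B) → ℝ := fun k z =>
    (∑ l, offDiag f (fun i => (z i).1) k l) * (∑ l, offDiag g (fun i => (z i).2) k l) with hR
  have mR : ∀ k, AEStronglyMeasurable (R k) π := fun k =>
    ((hf.memLp_rowSum k).comp_measurePreserving measurePreserving_pi_fst).1.mul
      ((hg.memLp_rowSum k).comp_measurePreserving measurePreserving_pi_snd).1
  have LR : ∀ k, MemLp (R k) 2 π := fun k => by
    rw [memLp_two_iff_integrable_sq (mR k)]
    simp only [hR, mul_pow]
    exact integrable_pi_prod_mul (hf.memLp_rowSum k).integrable_sq (hg.memLp_rowSum k).integrable_sq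
  refine (integral_abs_le_sqrt (memLp_finsetSum _ fun k _ => LR k)).trans (Real.sqrt_le_sqrt ?_)
  have hv : ∀ k k', ∫ z, R k z * R k' z ∂π = if k = k' then ((n : ℝ) - 1) ^ 2 else 1 := by
    intro k k'
    have e : ∀ z, R k z * R k' z = ((∑ l, offDiag f (fun i => (z i).1) k l) *
        (∑ l, offDiag f (fun i => (z i).1) k' l)) * ((∑ l, offDiag g (fun i => (z i).2) k l) *
        (∑ l, offDiag g (fun i => (z i).2) k' l)) := fun z => by simp only [hR]; ring
    simp_rw [e]
    refine (integral_pi_prod_mul (fun x : Fin n → A => (∑ l, offDiag f x k l) *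
      (∑ l, offDiag f x k' l)) (fun y : Fin n → B => (∑ l, offDiag g y k l) *
      (∑ l, offDiag g y k' l))).trans ?_
    rw [hf.integral_rowSum_mul hf1, hg.integral_rowSum_mul hg1]
    split_ifs <;> ring
  have hi : ∀ k k', Integrable (fun z => R k z * R k' z) π := fun k k' =>
    (LR k).integrable_mul (LR k')
  simp_rw [sq, Finset.sum_mul_sum]
  rw [integral_finsetSum _ fun k _ => integrable_finsetSum _ fun k' _ => hi k k']
  simp_rw [integral_finsetSum _ fun k' _ => hi _ k', hv]
  have e2 : ∀ k k' : Fin n, (if k = k' then ((n : ℝ) - 1) ^ 2 else 1) =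
      1 + if k = k' then ((n : ℝ) - 1) ^ 2 - 1 else 0 := by
    intro k k'; split_ifs <;> ring
  simp_rw [e2, Finset.sum_add_distrib]
  simp
  have : (0 : ℝ) ≤ n := Nat.cast_nonneg n
  nlinarith

/-- The bias-corrected sample distance covariance is close to the degenerate `U`-statistic of the
product kernel. -/
lemma integral_abs_uInner_sub_le (hf : IsDegenerateKernel μ f) (hg : IsDegenerateKernel ν g)
    (hf1 : kernelSq μ f = 1) (hg1 : kernelSq ν g = 1) (hn : 6 ≤ n) :
    ∫ z, |√((n : ℝ) * (n - 1) / 2) *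
        uInner (offDiag f fun i => (z i).1) (offDiag g fun i => (z i).2) -
        1 / √((n : ℝ) * (n - 1) / 2) * partialPairSum (prodKernel f g) n z|
        ∂(Measure.pi fun _ : Fin n => μ.prod ν) ≤ 16 / √n := by
  have hn' : (6 : ℝ) ≤ n := by exact_mod_cast hn
  have p0 : (0 : ℝ) < n := by linarith
  have p1 : (0 : ℝ) < (n : ℝ) - 1 := by linarith
  have p2 : (0 : ℝ) < (n : ℝ) - 2 := by linarith
  have p3 : (0 : ℝ) < (n : ℝ) - 3 := by linarith
  set π := Measure.pi fun _ : Fin n => μ.prod ν with hπ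
  set s : ℝ := √((n : ℝ) * (n - 1) / 2) with hs
  have s0 : 0 < s := Real.sqrt_pos.2 (by positivity)
  have s2 : s ^ 2 = (n : ℝ) * (n - 1) / 2 := Real.sq_sqrt (by positivity)
  have sn : s ≤ n := by
    rw [hs, Real.sqrt_le_iff]; constructor <;> nlinarith
  have hk := hf.prodKernel hg
  have hk1 : kernelSq (μ.prod ν) (prodKernel f g) = 1 := by
    rw [kernelSq_prodKernel, hf1, hg1, one_mul]
  set M : (Fin n → A × B) → ℝ := fun z => ∑ k, ∑ l, offDiag (prodKernel f g) z k l with hM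
  set R : (Fin n → A × B) → ℝ := fun z => ∑ k, (∑ l, offDiag f (fun i => (z i).1) k l) *
        (∑ l, offDiag g (fun i => (z i).2) k l) with hR
  set T : (Fin n → A × B) → ℝ := fun z => (∑ k, ∑ l, offDiag f (fun i => (z i).1) k l) *
        (∑ k, ∑ l, offDiag g (fun i => (z i).2) k l) with hT
  have iM : Integrable M π := hk.memLp_total.integrable (by norm_num)
  have iR : Integrable R π := integrable_finsetSum _ fun k _ => integrable_pi_prod_mul
    ((hf.memLp_rowSum k).integrable (by norm_num)) ((hg.memLp_rowSum k).integrable (by norm_num))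
  have iT : Integrable T π := integrable_pi_prod_mul
    (hf.memLp_total.integrable (by norm_num)) (hg.memLp_total.integrable (by norm_num))
  have bM : ∫ z, |M z| ∂π ≤ 2 * s := by
    refine (integral_abs_le_sqrt hk.memLp_total).trans_eq ?_
    rw [hk.integral_total_sq hk1,
      show 2 * ((n : ℝ) * (n - 1)) = (2 * s) ^ 2 by rw [mul_pow, s2]; ring]
    exact Real.sqrt_sq (by positivity)
  have bR : ∫ z, |R z| ∂π ≤ √((n : ℝ) ^ 3) := integral_abs_sum_rowSum_mul_le hf hg hf1 hg1
  have bT : ∫ z, |T z| ∂π ≤ 2 * (n * ((n : ℝ) - 1)) :=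
    integral_abs_total_mul_le hf hg hf1 hg1 (by omega)
  -- Weights of the main sum, the row term and the total term in the difference; $a_1$ comes from
  -- the normalization $n(n-3)$ in place of $n(n-1)$. The row term dominates, being of order
  -- $n^{-2}\cdot n^{3/2}$.
  set a₁ : ℝ := 1 / (s * (n - 3)) with ha₁
  set a₂ : ℝ := s * (2 / (n * (n - 2) * (n - 3))) with ha₂
  set a₃ : ℝ := s * (1 / (n * (n - 1) * (n - 2) * (n - 3))) with ha₃
  have a₁0 : 0 ≤ a₁ := by positivity
  have a₂0 : 0 ≤ a₂ := by positivity
  have a₃0 : 0 ≤ a₃ := by positivity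
  have sq3 : √((n : ℝ) ^ 3) = n * √n := by
    rw [show (n : ℝ) ^ 3 = n ^ 2 * n by ring, Real.sqrt_mul (by positivity),
      Real.sqrt_sq p0.le]
  have rn0 : 0 < √(n : ℝ) := Real.sqrt_pos.2 p0
  have rn2 : √(n : ℝ) * √n = n := Real.mul_self_sqrt p0.le
  have rn1 : 1 ≤ √(n : ℝ) := Real.one_le_sqrt.2 (by linarith)
  have i1 := iM.abs.const_mul a₁
  have i2 := iR.abs.const_mul a₂
  have i3 := iT.abs.const_mul a₃
  calc _ ≤ ∫ z, (a₁ * |M z| + a₂ * |R z| + a₃ * |T z|) ∂π := by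
        refine integral_mono_of_nonneg (Eventually.of_forall fun z => abs_nonneg _)
          ((i1.add i2).add i3) (Eventually.of_forall fun z => ?_)
        have hpp : partialPairSum (prodKernel f g) n z = M z / 2 := by
          simp only [hM]; rw [hk.sum_offDiag_eq]; ring
        have hu : uInner (offDiag f fun i => (z i).1) (offDiag g fun i => (z i).2) =
            1 / ((n : ℝ) * (n - 3)) * (M z - 2 / ((n : ℝ) - 2) * R z +
              1 / (((n : ℝ) - 1) * (n - 2)) * T z) := by
          simp only [uInner, hM, hR, hT, offDiag_prodKernel]
        have e : s * uInner (offDiag f fun i => (z i).1) (offDiag g fun i => (z i).2) -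
            1 / s * partialPairSum (prodKernel f g) n z = a₁ * M z - a₂ * R z + a₃ * T z := by
          rw [hpp, hu]
          have c1 : s * (1 / ((n : ℝ) * (n - 3))) - 1 / s * (1 / 2) = a₁ := by
            rw [ha₁]
            field_simp
            rw [s2]
            ring
          have c2 : s * (1 / ((n : ℝ) * (n - 3))) * (2 / ((n : ℝ) - 2)) = a₂ := by
            rw [ha₂]; field_simp
          have c3 : s * (1 / ((n : ℝ) * (n - 3))) * (1 / (((n : ℝ) - 1) * (n - 2))) = a₃ := by
            rw [ha₃]; field_simp
          rw [← c1, ← c2, ← c3]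
          ring
        simp only [e]
        refine (abs_add_le _ _).trans (add_le_add ((abs_sub _ _).trans (add_le_add ?_ ?_)) ?_)
        · rw [abs_mul, abs_of_nonneg a₁0]
        · rw [abs_mul, abs_of_nonneg a₂0]
        · rw [abs_mul, abs_of_nonneg a₃0]
    _ = a₁ * ∫ z, |M z| ∂π + a₂ * ∫ z, |R z| ∂π + a₃ * ∫ z, |T z| ∂π := by
        rw [integral_add, integral_add, integral_const_mul, integral_const_mul, integral_const_mul]
        · exact i1
        · exact i2
        · exact i1.add i2
        · exact i3
    _ ≤ a₁ * (2 * s) + a₂ * √((n : ℝ) ^ 3) + a₃ * (2 * (n * ((n : ℝ) - 1))) := by gcongr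
    _ = 2 / (n - 3) + s * √n * (2 / ((n - 2) * (n - 3))) + s * (2 / ((n - 2) * (n - 3))) := by
        rw [sq3, ha₁, ha₂, ha₃]; field_simp
    _ ≤ 4 / n + 6 / √n + 6 / n := by
        have b1 : 2 / ((n : ℝ) - 3) ≤ 4 / n := by
          rw [div_le_div_iff₀ p3 p0]; linarith
        have b0 : 2 / (((n : ℝ) - 2) * (n - 3)) ≤ 6 / (n * n) := by
          rw [div_le_div_iff₀ (by positivity) (by positivity)]; nlinarith
        have b2 : s * √n * (2 / (((n : ℝ) - 2) * (n - 3))) ≤ 6 / √n := by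
          calc _ ≤ (n : ℝ) * √n * (6 / (n * n)) := by gcongr
            _ = 6 * √n / n := by field_simp
            _ = 6 / √n := by
              rw [div_eq_div_iff p0.ne' rn0.ne']; rw [mul_assoc, rn2]
        have b3 : s * (2 / (((n : ℝ) - 2) * (n - 3))) ≤ 6 / n := by
          calc _ ≤ (n : ℝ) * (6 / (n * n)) := by gcongr
            _ = 6 / n := by field_simp
        linarith
    _ ≤ 16 / √n := by
        have : 1 / (n : ℝ) ≤ 1 / √n := by
          apply one_div_le_one_div_of_le rn0
          nlinarith
        have e1 : 4 / (n : ℝ) + 6 / √n + 6 / n = 10 * (1 / n) + 6 * (1 / √n) := by ring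
        have e2 : 16 / √(n : ℝ) = 16 * (1 / √n) := by ring
        rw [e1, e2]
        linarith

end SampleCovariance

/-! ### The Euclidean norm as an integral of $1-\cos$ -/

section DistanceIntegral

open Set in
lemma lintegral_rpow_mul_exp_neg_mul {a r : ℝ} (ha : 0 < a) (hr : 0 < r) :
    ∫⁻ t in Ioi (0 : ℝ), ENNReal.ofReal (t ^ (a - 1) * Real.exp (-(r * t))) =
      ENNReal.ofReal ((1 / r) ^ a * Real.Gamma a) := by
  have key := Real.integral_rpow_mul_exp_neg_mul_Ioi ha hr
  have hG := Real.Gamma_pos_of_pos ha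
  -- A nonzero Bochner integral forces integrability, so the known value is enough.
  have hint : IntegrableOn (fun t : ℝ => t ^ (a - 1) * Real.exp (-(r * t))) (Ioi 0) :=
    .of_integral_ne_zero (by rw [key]; positivity)
  rw [← key, ofReal_integral_eq_lintegral_ofReal hint]
  exact (ae_restrict_iff' measurableSet_Ioi).2 (ae_of_all _ fun t (ht : 0 < t) => by positivity)

-- The substitution $y=1/u$ turns this into the integral for $\Gamma(1/2)=\sqrt\pi$.
open Set in
lemma lintegral_rpow_mul_exp_neg_div {b : ℝ} (hb : 0 < b) :
    ∫⁻ u in Ioi (0 : ℝ), ENNReal.ofReal (u ^ (-(3 / 2) : ℝ) * Real.exp (-(b / u))) =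
      ENNReal.ofReal (√Real.pi * b ^ (-(1 / 2) : ℝ)) := by
  have key := Real.integral_rpow_mul_exp_neg_mul_Ioi (a := 1 / 2) (by norm_num) hb
  rw [Real.Gamma_one_half_eq] at key
  have hcv := integral_comp_rpow_Ioi (fun y : ℝ => y ^ ((1 / 2 : ℝ) - 1) * Real.exp (-(b * y)))
    (p := -1) (by norm_num)
  have hcongr : ∫ u in Ioi (0 : ℝ), u ^ (-(3 / 2) : ℝ) * Real.exp (-(b / u)) =
      (1 / b) ^ (1 / 2 : ℝ) * √Real.pi := by
    rw [← key, ← hcv]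
    refine setIntegral_congr_fun measurableSet_Ioi fun u (hu : 0 < u) => ?_
    simp only [smul_eq_mul, abs_neg, abs_one, one_mul]
    rw [← Real.rpow_mul hu.le, ← mul_assoc, ← Real.rpow_add hu, Real.rpow_neg_one]
    norm_num
    left; rfl
  have hint : IntegrableOn (fun u : ℝ => u ^ (-(3 / 2) : ℝ) * Real.exp (-(b / u))) (Ioi 0) :=
    .of_integral_ne_zero (by rw [hcongr]; positivity)
  rw [← ofReal_integral_eq_lintegral_ofReal hint, hcongr]
  · congr 1
    rw [one_div, Real.inv_rpow hb.le, ← Real.rpow_neg hb.le, mul_comm]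
  · exact (ae_restrict_iff' measurableSet_Ioi).2 (ae_of_all _ fun t (ht : 0 < t) => by positivity)

-- Write $1-e^{-a/u}=\int_0^au^{-1}e^{-b/u}\,db$ and exchange the integrals; what remains is
-- $\sqrt\pi\int_0^ab^{-1/2}\,db$.
open Set in
lemma lintegral_rpow_mul_one_sub_exp_neg_div {a : ℝ} (ha : 0 ≤ a) :
    ∫⁻ u in Ioi (0 : ℝ), ENNReal.ofReal (u ^ (-(1 / 2) : ℝ) * (1 - Real.exp (-(a / u)))) =
      ENNReal.ofReal (2 * √Real.pi * √a) := by
  have h1 : ∀ u ∈ Ioi (0 : ℝ), ENNReal.ofReal (u ^ (-(1 / 2) : ℝ) * (1 - Real.exp (-(a / u)))) =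
      ∫⁻ b in Ioc 0 a, ENNReal.ofReal (u ^ (-(3 / 2) : ℝ) * Real.exp (-(b / u))) := by
    intro u (hu : 0 < u)
    rw [← ofReal_integral_eq_lintegral_ofReal]
    · congr 1
      rw [← intervalIntegral.integral_of_le ha]
      have hd : ∀ b ∈ uIcc 0 a,
          HasDerivAt (fun b : ℝ => -(u ^ (-(1 / 2) : ℝ) * Real.exp (-(b / u))))
          (u ^ (-(3 / 2) : ℝ) * Real.exp (-(b / u))) b := by
        intro b _
        have := (((hasDerivAt_id b).div_const u).neg.exp.const_mul (u ^ (-(1 / 2) : ℝ))).neg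
        refine this.congr_deriv ?_
        have e : u ^ (-(3 / 2) : ℝ) = u ^ (-(1 / 2) : ℝ) * u⁻¹ := by
          rw [← Real.rpow_neg_one u, ← Real.rpow_add hu]; norm_num
        rw [e]; simp only [id, Pi.neg_apply]; ring_nf
      rw [intervalIntegral.integral_eq_sub_of_hasDerivAt hd
        (Continuous.intervalIntegrable (by fun_prop) _ _)]
      simp; ring
    · exact (Continuous.integrableOn_Icc (by fun_prop)).mono_set Ioc_subset_Icc_self
    · exact ae_of_all _ fun b => by positivity
  rw [setLIntegral_congr_fun measurableSet_Ioi h1,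
    lintegral_lintegral_swap (by
      refine Measurable.aemeasurable (Measurable.ennreal_ofReal ?_)
      fun_prop)]
  rw [setLIntegral_congr_fun measurableSet_Ioc
    (fun b hb => lintegral_rpow_mul_exp_neg_div (b := b) hb.1)]
  have hint : IntegrableOn (fun b : ℝ => √Real.pi * b ^ (-(1 / 2) : ℝ)) (Ioc 0 a) :=
    ((intervalIntegrable_iff_integrableOn_Ioc_of_le ha).1
      (intervalIntegral.intervalIntegrable_rpow' (by norm_num))).const_mul _
  rw [← ofReal_integral_eq_lintegral_ofReal hint]
  · rw [← intervalIntegral.integral_of_le ha, intervalIntegral.integral_const_mul,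
      integral_rpow (Or.inl (by norm_num)), Real.sqrt_eq_rpow a]
    congr 1
    norm_num; ring
  · exact (ae_restrict_iff' measurableSet_Ioc).2 (ae_of_all _ fun b hb => by
      have := hb.1; positivity)

variable {p : ℕ}

local notation "E" => EuclideanSpace ℝ (Fin p)

/-- Real part of the Gaussian Fourier transform, frequency 0 minus frequency $x$. -/
lemma lintegral_exp_neg_mul_one_sub_cos (x : E) {u : ℝ} (hu : 0 < u) :
    ∫⁻ t : E, ENNReal.ofReal (Real.exp (-(u * ‖t‖ ^ 2)) * (1 - Real.cos (inner ℝ t x))) =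
      ENNReal.ofReal ((Real.pi / u) ^ ((p : ℝ) / 2) * (1 - Real.exp (-(‖x‖ ^ 2 / 4 / u)))) := by
  have hu' : 0 < ((u : ℂ)).re := by simpa using hu
  have hI1 := GaussianFourier.integrable_cexp_neg_mul_sq_norm_add hu' Complex.I x
  have hI0 := GaussianFourier.integrable_cexp_neg_mul_sq_norm_add hu' 0 x
  have hv1 := GaussianFourier.integral_cexp_neg_mul_sq_norm_add hu' Complex.I x
  have hv0 := GaussianFourier.integral_cexp_neg_mul_sq_norm_add hu' 0 x
  have hpt : ∀ t : E, Real.exp (-(u * ‖t‖ ^ 2)) * (1 - Real.cos (inner ℝ t x)) =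
      RCLike.re (Complex.exp (-(u : ℂ) * (‖t‖ : ℂ) ^ 2 + 0 * ((inner ℝ x t : ℝ) : ℂ)) -
        Complex.exp (-(u : ℂ) * (‖t‖ : ℂ) ^ 2 + Complex.I * ((inner ℝ x t : ℝ) : ℂ))) := by
    intro t
    rw [RCLike.re_eq_complex_re, Complex.sub_re, Complex.exp_re, Complex.exp_re,
      real_inner_comm t x]
    simp [← Complex.ofReal_pow]
    ring
  have hint : Integrable (fun t : E =>
      Real.exp (-(u * ‖t‖ ^ 2)) * (1 - Real.cos (inner ℝ t x))) := by
    simp_rw [hpt]; exact (hI0.sub hI1).re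
  rw [← ofReal_integral_eq_lintegral_ofReal hint]
  · congr 1
    simp_rw [hpt]
    refine (integral_re (hI0.sub hI1)).trans ?_
    simp only [Pi.sub_apply]
    rw [integral_sub hI0 hI1, hv0, hv1]
    rw [RCLike.re_eq_complex_re, finrank_euclideanSpace_fin]
    have e1 : ((Real.pi : ℂ) / u) ^ ((p : ℂ) / 2) = (((Real.pi / u) ^ ((p : ℝ) / 2) : ℝ) : ℂ) := by
      rw [Complex.ofReal_cpow (by positivity)]; push_cast; rfl
    have e2 : Complex.exp (Complex.I ^ 2 * (‖x‖ : ℂ) ^ 2 / (4 * u)) =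
        ((Real.exp (-(‖x‖ ^ 2 / 4 / u)) : ℝ) : ℂ) := by
      push_cast; congr 1; rw [Complex.I_sq]; field_simp
    rw [e1, e2]
    simp only [ne_eq, OfNat.ofNat_ne_zero, not_false_eq_true, zero_pow, zero_mul, zero_div,
      Complex.exp_zero, mul_one]
    rw [← Complex.ofReal_mul, ← Complex.ofReal_sub, Complex.ofReal_re]
    ring
  · exact ae_of_all _ fun t =>
      mul_nonneg (Real.exp_pos _).le (by linarith [Real.cos_le_one (inner ℝ t x)])

-- The weight $\|t\|^{-(p+1)}$ is a Gamma mixture of the Gaussians $e^{-u\|t\|^2}$. After Tonelli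
-- the $t$-integral is explicit, the powers of $u$ combine to $u^{-1/2}$ in every dimension, and the
-- $u$-integral produces $\sqrt{\|x\|^2/4}$. At $t=0$ both sides are 0 since the numerator vanishes.
open Set in
lemma lintegral_one_sub_cos_div (x : E) :
    ∫⁻ t : E, ENNReal.ofReal ((1 - Real.cos (inner ℝ t x)) / (dcovConst p * ‖t‖ ^ (p + 1))) =
      ENNReal.ofReal ‖x‖ := by
  set r : ℝ := ((p : ℝ) + 1) / 2 with hr
  have hr0 : 0 < r := by positivity
  have hG := Real.Gamma_pos_of_pos hr0
  have hcos : ∀ t : E, 0 ≤ 1 - Real.cos (inner ℝ t x) := fun t => by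
    linarith [Real.cos_le_one (inner ℝ t x)]
  have hpi : (0 : ℝ) < Real.pi ^ r := by positivity
  have h1 : ∀ t : E, ENNReal.ofReal ((1 - Real.cos (inner ℝ t x)) / (dcovConst p * ‖t‖ ^ (p + 1))) =
      ∫⁻ u in Ioi (0 : ℝ), ENNReal.ofReal ((Real.pi ^ r)⁻¹ * (u ^ (r - 1) *
        (Real.exp (-(u * ‖t‖ ^ 2)) * (1 - Real.cos (inner ℝ t x))))) := by
    intro t
    by_cases ht : t = 0
    · simp [ht]
    have ht' : 0 < ‖t‖ := norm_pos_iff.2 ht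
    have e : ∀ u ∈ Ioi (0 : ℝ), ENNReal.ofReal ((Real.pi ^ r)⁻¹ * (u ^ (r - 1) *
        (Real.exp (-(u * ‖t‖ ^ 2)) * (1 - Real.cos (inner ℝ t x))))) =
        ENNReal.ofReal ((Real.pi ^ r)⁻¹ * (1 - Real.cos (inner ℝ t x))) *
          ENNReal.ofReal (u ^ (r - 1) * Real.exp (-(‖t‖ ^ 2 * u))) := by
      intro u _
      rw [← ENNReal.ofReal_mul (mul_nonneg (by positivity) (hcos t))]
      congr 1; rw [mul_comm u]; ring
    rw [setLIntegral_congr_fun measurableSet_Ioi e, lintegral_const_mul' _ _ ENNReal.ofReal_ne_top,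
      lintegral_rpow_mul_exp_neg_mul hr0 (by positivity),
      ← ENNReal.ofReal_mul (mul_nonneg (by positivity) (hcos t))]
    congr 1
    have e2 : (1 / ‖t‖ ^ 2) ^ r = (‖t‖ ^ (p + 1))⁻¹ := by
      rw [one_div, Real.inv_rpow (by positivity), ← Real.rpow_natCast, ← Real.rpow_mul ht'.le,
        ← Real.rpow_natCast]
      congr 2; rw [hr]; push_cast; ring
    rw [e2, dcovConst, ← hr]
    field_simp
  simp_rw [h1]
  rw [lintegral_lintegral_swap (by
      refine Measurable.aemeasurable (Measurable.ennreal_ofReal ?_)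
      fun_prop)]
  have h2 : ∀ u ∈ Ioi (0 : ℝ), ∫⁻ t : E, ENNReal.ofReal ((Real.pi ^ r)⁻¹ * (u ^ (r - 1) *
        (Real.exp (-(u * ‖t‖ ^ 2)) * (1 - Real.cos (inner ℝ t x))))) =
      ENNReal.ofReal ((√Real.pi)⁻¹) * ENNReal.ofReal (u ^ (-(1 / 2) : ℝ) *
        (1 - Real.exp (-(‖x‖ ^ 2 / 4 / u)))) := by
    intro u (hu : 0 < u)
    have e : ∀ t : E, ENNReal.ofReal ((Real.pi ^ r)⁻¹ * (u ^ (r - 1) *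
        (Real.exp (-(u * ‖t‖ ^ 2)) * (1 - Real.cos (inner ℝ t x))))) =
        ENNReal.ofReal ((Real.pi ^ r)⁻¹ * u ^ (r - 1)) *
          ENNReal.ofReal (Real.exp (-(u * ‖t‖ ^ 2)) * (1 - Real.cos (inner ℝ t x))) := by
      intro t
      rw [← ENNReal.ofReal_mul (by positivity)]
      congr 1; ring
    simp_rw [e]
    rw [lintegral_const_mul' _ _ ENNReal.ofReal_ne_top, lintegral_exp_neg_mul_one_sub_cos x hu,
      ← ENNReal.ofReal_mul (by positivity), ← ENNReal.ofReal_mul (by positivity)]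
    congr 1
    have e3 : (Real.pi ^ r)⁻¹ * u ^ (r - 1) * (Real.pi / u) ^ ((p : ℝ) / 2) =
        (√Real.pi)⁻¹ * u ^ (-(1 / 2) : ℝ) := by
      rw [Real.div_rpow Real.pi_pos.le hu.le, Real.sqrt_eq_rpow, ← Real.rpow_neg Real.pi_pos.le,
        ← Real.rpow_neg Real.pi_pos.le, div_eq_mul_inv, ← Real.rpow_neg hu.le]
      calc _ = (Real.pi ^ (-r) * Real.pi ^ ((p : ℝ) / 2)) * (u ^ (r - 1) * u ^ (-((p : ℝ) / 2))) :=
          by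
            ring
        _ = _ := by
            rw [← Real.rpow_add Real.pi_pos, ← Real.rpow_add hu]
            congr 2 <;> (rw [hr]; ring)
    rw [← mul_assoc, e3]; ring
  rw [setLIntegral_congr_fun measurableSet_Ioi h2, lintegral_const_mul' _ _ ENNReal.ofReal_ne_top,
    lintegral_rpow_mul_one_sub_exp_neg_div (by positivity), ← ENNReal.ofReal_mul (by positivity)]
  congr 1
  have : √(‖x‖ ^ 2 / 4) = ‖x‖ / 2 := by
    rw [show ‖x‖ ^ 2 / 4 = (‖x‖ / 2) ^ 2 by ring]; exact Real.sqrt_sq (by positivity)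
  rw [this]
  have hs : √Real.pi ≠ 0 := by positivity
  field_simp

end DistanceIntegral

/-! ### Centered characters as a feature map for $d$ -/

section DistanceVariance

/-- The measure on `ℝ^p` with the density that weights the distance covariance. -/
noncomputable def dcovMeasure (p : ℕ) : Measure (EuclideanSpace ℝ (Fin p)) :=
  volume.withDensity fun t => ENNReal.ofReal (1 / (dcovConst p * ‖t‖ ^ (p + 1)))

instance (p : ℕ) : SigmaFinite (dcovMeasure p) := SigmaFinite.withDensity_ofReal _

variable {p : ℕ}

lemma dcovConst_pos (p : ℕ) : 0 < dcovConst p := by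
  have := Real.Gamma_pos_of_pos (s := ((p : ℝ) + 1) / 2) (by positivity)
  unfold dcovConst; positivity

lemma lintegral_dcovMeasure_one_sub_cos (x : EuclideanSpace ℝ (Fin p)) :
    ∫⁻ t, ENNReal.ofReal (1 - Real.cos (inner ℝ t x)) ∂(dcovMeasure p) = ENNReal.ofReal ‖x‖ := by
  have hc := dcovConst_pos p
  rw [dcovMeasure, lintegral_withDensity_eq_lintegral_mul _ (by fun_prop) (by fun_prop),
    ← lintegral_one_sub_cos_div x]
  refine lintegral_congr fun t => ?_
  simp only [Pi.mul_apply]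
  rw [← ENNReal.ofReal_mul (by positivity)]
  congr 1; ring

lemma one_sub_cos_nonneg (x : ℝ) : 0 ≤ 1 - Real.cos x := by linarith [Real.cos_le_one x]

lemma integrable_dcovMeasure_one_sub_cos (x : EuclideanSpace ℝ (Fin p)) :
    Integrable (fun t => 1 - Real.cos (inner ℝ t x)) (dcovMeasure p) := by
  refine ⟨by fun_prop, ?_⟩
  rw [hasFiniteIntegral_iff_ofReal (ae_of_all _ fun t => one_sub_cos_nonneg _),
    lintegral_dcovMeasure_one_sub_cos]
  exact ENNReal.ofReal_lt_top

lemma integral_dcovMeasure_one_sub_cos (x : EuclideanSpace ℝ (Fin p)) :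
    ∫ t, (1 - Real.cos (inner ℝ t x)) ∂(dcovMeasure p) = ‖x‖ := by
  rw [integral_eq_lintegral_of_nonneg_ae (ae_of_all _ fun t => one_sub_cos_nonneg _)
    (by fun_prop), lintegral_dcovMeasure_one_sub_cos, ENNReal.toReal_ofReal (norm_nonneg _)]

/-- The integrand is nonnegative and integrating over $t$ first leaves $\|f(s)\|$. This justifies
Fubini although the weight measure may be infinite. -/
lemma integrable_prod_one_sub_cos {S : Type*} [MeasurableSpace S] {σ : Measure S} [SFinite σ]
    {f : S → EuclideanSpace ℝ (Fin p)} (hf : Measurable f) (hi : Integrable (fun s => ‖f s‖) σ) :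
    Integrable (fun r : EuclideanSpace ℝ (Fin p) × S => 1 - Real.cos (inner ℝ r.1 (f r.2)))
      ((dcovMeasure p).prod σ) := by
  have hm : Measurable (fun r : EuclideanSpace ℝ (Fin p) × S =>
      1 - Real.cos (inner ℝ r.1 (f r.2))) := by fun_prop
  rw [integrable_prod_iff' hm.aestronglyMeasurable]
  refine ⟨ae_of_all _ fun s => integrable_dcovMeasure_one_sub_cos (f s), ?_⟩
  have e : (fun s => ∫ t, ‖1 - Real.cos (inner ℝ t (f s))‖ ∂(dcovMeasure p)) = fun s => ‖f s‖ := by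
    ext s
    rw [← integral_dcovMeasure_one_sub_cos (f s)]
    congr 1; ext t
    exact Real.norm_of_nonneg (one_sub_cos_nonneg _)
  exact e ▸ hi

lemma integral_add_sub_sub {𝕜 S : Type*} [RCLike 𝕜] [MeasurableSpace S] {σ : Measure S}
    {a b c d : S → 𝕜}
    (ha : Integrable a σ) (hb : Integrable b σ) (hc : Integrable c σ) (hd : Integrable d σ) :
    ∫ s, (a s + b s - c s - d s) ∂σ =
      ∫ s, a s ∂σ + ∫ s, b s ∂σ - ∫ s, c s ∂σ - ∫ s, d s ∂σ := by
  have hab : Integrable (fun s => a s + b s) σ := ha.add hb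
  have habc : Integrable (fun s => a s + b s - c s) σ := hab.sub hc
  rw [integral_sub habc hd, integral_sub hab hc, integral_add ha hb]

variable (μ : Measure (EuclideanSpace ℝ (Fin p))) [IsProbabilityMeasure μ]

/-- The centered character `x ↦ exp (i⟨x, t⟩) - f(t)`, where `f` is the characteristic function
of `μ`. -/
noncomputable def centeredChar (t x : EuclideanSpace ℝ (Fin p)) : ℂ :=
  Complex.exp (((inner ℝ x t : ℝ) : ℂ) * Complex.I) - charFun μ t

lemma measurable_centeredChar :
    Measurable (fun r : EuclideanSpace ℝ (Fin p) × EuclideanSpace ℝ (Fin p) =>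
        centeredChar μ r.1 r.2) := by
  unfold centeredChar
  have h1 : Measurable (fun r : EuclideanSpace ℝ (Fin p) × EuclideanSpace ℝ (Fin p) =>
      charFun μ r.1) :=
    (stronglyMeasurable_charFun (μ := μ)).measurable.comp measurable_fst
  fun_prop

lemma integrable_character (t : EuclideanSpace ℝ (Fin p)) :
    Integrable (fun x : EuclideanSpace ℝ (Fin p) =>
      Complex.exp (((inner ℝ x t : ℝ) : ℂ) * Complex.I)) μ :=
  Integrable.of_bound (by fun_prop) 1 (ae_of_all _ fun x => by
    rw [Complex.norm_exp_ofReal_mul_I])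

/-- Each centered character is an average of differences $e^{i\langle y,t\rangle}-e^{i\langle
z,t\rangle}$. In the product the signs of the four cosines balance, so each may be replaced by
$1-\cos$, which the weight can integrate. -/
lemma re_centeredChar_mul_conj (t x x' : EuclideanSpace ℝ (Fin p)) :
    (centeredChar μ t x * (starRingEnd ℂ) (centeredChar μ t x')).re =
      ∫ w : EuclideanSpace ℝ (Fin p) × EuclideanSpace ℝ (Fin p),
          ((1 - Real.cos (inner ℝ t (x - w.2))) + (1 - Real.cos (inner ℝ t (w.1 - x'))) -
        (1 - Real.cos (inner ℝ t (x - x'))) - (1 - Real.cos (inner ℝ t (w.1 - w.2))))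
        ∂(μ.prod μ) := by
  have hi := integrable_character μ t
  have hc : ∀ y : EuclideanSpace ℝ (Fin p), centeredChar μ t y =
      ∫ z, (Complex.exp (((inner ℝ y t : ℝ) : ℂ) * Complex.I) -
        Complex.exp (((inner ℝ z t : ℝ) : ℂ) * Complex.I)) ∂μ := by
    intro y
    rw [integral_sub (integrable_const _) hi, integral_const]
    simp [centeredChar, charFun_apply]
  have hd : ∀ y : EuclideanSpace ℝ (Fin p),
      Integrable (fun z => Complex.exp (((inner ℝ y t : ℝ) : ℂ) * Complex.I) -
        Complex.exp (((inner ℝ z t : ℝ) : ℂ) * Complex.I)) μ :=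
    fun y => (integrable_const _).sub hi
  have hd' : Integrable (fun z => (starRingEnd ℂ)
      (Complex.exp (((inner ℝ x' t : ℝ) : ℂ) * Complex.I) -
        Complex.exp (((inner ℝ z t : ℝ) : ℂ) * Complex.I))) μ := by
    have := (hd x').norm
    refine ((hd x').norm.mono (by fun_prop) (ae_of_all _ fun z => ?_))
    rw [RCLike.norm_conj, norm_norm]
  rw [hc x, hc x', ← integral_conj, ← integral_prod_mul, ← RCLike.re_eq_complex_re,
    ← integral_re ((hd x).mul_prod hd')]
  refine integral_congr_ae (ae_of_all _ fun w => ?_)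
  simp only [map_sub, RCLike.re_eq_complex_re, inner_sub_right, Real.cos_sub,
    ← Complex.exp_conj, map_mul, Complex.conj_ofReal, Complex.conj_I, Complex.mul_re,
    Complex.sub_re, Complex.sub_im, Complex.exp_re, Complex.exp_im, real_inner_comm t]
  simp
  ring

variable {μ}

lemma integrable_norm_sub (hμ : Integrable (fun x : EuclideanSpace ℝ (Fin p) => ‖x‖) μ)
    (x : EuclideanSpace ℝ (Fin p)) :
    Integrable (fun z => ‖x - z‖) μ :=
  ((integrable_const ‖x‖).add hμ).mono' (by fun_prop) (ae_of_all _ fun z => by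
    simpa using norm_sub_le x z)

lemma integrable_norm_sub_prod (hμ : Integrable (fun x : EuclideanSpace ℝ (Fin p) => ‖x‖) μ) :
    Integrable (fun w : EuclideanSpace ℝ (Fin p) × EuclideanSpace ℝ (Fin p) => ‖w.1 - w.2‖)
      (μ.prod μ) :=
  ((hμ.comp_fst μ).add (hμ.comp_snd μ)).mono' (by fun_prop) (ae_of_all _ fun z => by
    simpa using norm_sub_le z.1 z.2)

/-- Integrating over $t$ turns each $1-\cos$ into a distance, and averaging over the two auxiliary
points produces exactly the double centering. -/
lemma integral_re_centeredChar (hμ : Integrable (fun x : EuclideanSpace ℝ (Fin p) => ‖x‖) μ)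
    (x x' : EuclideanSpace ℝ (Fin p)) :
    Integrable (fun t => (centeredChar μ t x * (starRingEnd ℂ) (centeredChar μ t x')).re)
      (dcovMeasure p) ∧
    ∫ t, (centeredChar μ t x * (starRingEnd ℂ) (centeredChar μ t x')).re ∂(dcovMeasure p) =
      -doubleCentered μ x x' := by
  simp_rw [re_centeredChar_mul_conj]
  have n1 : Integrable (fun w : EuclideanSpace ℝ (Fin p) × EuclideanSpace ℝ (Fin p) => ‖x - w.2‖)
      (μ.prod μ) :=
    (integrable_norm_sub hμ x).comp_snd μ
  have n2 : Integrable (fun w : EuclideanSpace ℝ (Fin p) × EuclideanSpace ℝ (Fin p) => ‖w.1 - x'‖)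
      (μ.prod μ) := by
    have := (integrable_norm_sub hμ x').comp_fst μ
    simpa only [norm_sub_rev x'] using this
  have n3 : Integrable (fun w : EuclideanSpace ℝ (Fin p) × EuclideanSpace ℝ (Fin p) => ‖x - x'‖)
      (μ.prod μ) := integrable_const _
  have n4 := integrable_norm_sub_prod hμ
  have h1 := integrable_prod_one_sub_cos (σ := μ.prod μ)
      (f := fun w : EuclideanSpace ℝ (Fin p) × EuclideanSpace ℝ (Fin p) => x - w.2)
    (by fun_prop) n1
  have h2 := integrable_prod_one_sub_cos (σ := μ.prod μ)
      (f := fun w : EuclideanSpace ℝ (Fin p) × EuclideanSpace ℝ (Fin p) => w.1 - x')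
    (by fun_prop) n2
  have h3 := integrable_prod_one_sub_cos (σ := μ.prod μ)
      (f := fun w : EuclideanSpace ℝ (Fin p) × EuclideanSpace ℝ (Fin p) => x - x')
    (by fun_prop) n3
  have h4 := integrable_prod_one_sub_cos (σ := μ.prod μ)
      (f := fun w : EuclideanSpace ℝ (Fin p) × EuclideanSpace ℝ (Fin p) => w.1 - w.2)
    (by fun_prop) n4
  have h := ((h1.add h2).sub h3).sub h4
  refine ⟨h.integral_prod_left, ?_⟩
  refine (integral_integral_swap h).trans ?_
  have e : ∀ w : EuclideanSpace ℝ (Fin p) × EuclideanSpace ℝ (Fin p), ∫ t,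
      ((1 - Real.cos (inner ℝ t (x - w.2))) +
      (1 - Real.cos (inner ℝ t (w.1 - x'))) -
        (1 - Real.cos (inner ℝ t (x - x'))) - (1 - Real.cos (inner ℝ t (w.1 - w.2))))
        ∂(dcovMeasure p) = ‖x - w.2‖ + ‖w.1 - x'‖ - ‖x - x'‖ - ‖w.1 - w.2‖ := by
    intro w
    have g := fun y : EuclideanSpace ℝ (Fin p) => integrable_dcovMeasure_one_sub_cos y
    rw [integral_add_sub_sub (g _) (g _) (g _) (g _)]
    simp only [integral_dcovMeasure_one_sub_cos]
  refine (integral_congr_ae (ae_of_all _ e)).trans ?_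
  rw [integral_add_sub_sub n1 n2 n3 n4, integral_const,
      integral_fun_snd (fun z : EuclideanSpace ℝ (Fin p) => ‖x - z‖),
          integral_fun_fst (fun z : EuclideanSpace ℝ (Fin p) => ‖z - x'‖)]
  simp [doubleCentered]
  ring

/-- The squared norm over $t$ is $-d(x,x)$, which is integrable once $\|X\|$ is. -/
lemma integrable_sq_norm_centeredChar (hμ : Integrable (fun x : EuclideanSpace ℝ (Fin p) => ‖x‖) μ)
    :
    Integrable (fun r : EuclideanSpace ℝ (Fin p) × EuclideanSpace ℝ (Fin p) =>
      ‖centeredChar μ r.1 r.2‖ ^ 2) ((dcovMeasure p).prod μ) := by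
  have e : ∀ t x : EuclideanSpace ℝ (Fin p), ‖centeredChar μ t x‖ ^ 2 =
      (centeredChar μ t x * (starRingEnd ℂ) (centeredChar μ t x)).re := by
    intro t x
    rw [Complex.mul_conj, Complex.ofReal_re, Complex.normSq_eq_norm_sq]
  have hm := measurable_centeredChar μ
  rw [integrable_prod_iff' (by fun_prop)]
  refine ⟨ae_of_all _ fun x => ?_, ?_⟩
  · simp only [e]; exact (integral_re_centeredChar hμ x x).1
  · simp only [norm_pow, norm_norm]
    simp only [e, (integral_re_centeredChar hμ _ _).2]
    unfold doubleCentered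
    have m1 : Integrable (fun x : EuclideanSpace ℝ (Fin p) => ∫ z, ‖x - z‖ ∂μ) μ :=
      (integrable_norm_sub_prod hμ).integral_prod_left
    have m2 : Integrable (fun x : EuclideanSpace ℝ (Fin p) => ∫ z, ‖z - x‖ ∂μ) μ :=
        by simpa only [norm_sub_rev] using m1
    simp only [sub_self, norm_zero]
    exact ((((integrable_const _).sub m1).sub m2).add (integrable_const _)).neg

end DistanceVariance

/-! ### Exchange of frequency and sample integrals -/

section FourfoldFubini

variable {T Z : Type*} [MeasurableSpace T] [MeasurableSpace Z] {κ : Measure T} {ρ : Measure Z}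
  [SFinite κ] [SFinite ρ] {Φ : T → Z → ℂ}

/-- The pairing of factors with disjoint variables used in `integrable_fourfold`, now for complex
functions of a frequency and a point. -/
lemma integrable_fourfold_complex (hm : Measurable (fun r : T × Z => Φ r.1 r.2))
    (hi : Integrable (fun r : T × Z => ‖Φ r.1 r.2‖ ^ 2) (κ.prod ρ)) :
    Integrable (fun r : (T × T) × (Z × Z) => (Φ r.1.1 r.2.1 * Φ r.1.2 r.2.1) *
      (starRingEnd ℂ) (Φ r.1.1 r.2.2 * Φ r.1.2 r.2.2)) ((κ.prod κ).prod (ρ.prod ρ)) := by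
  have hmp := measurePreserving_prodProdProdComm κ κ ρ ρ
  have hmp' : MeasurePreserving (fun r : (T × T) × (Z × Z) => ((r.1.1, r.2.2), (r.1.2, r.2.1)))
      ((κ.prod κ).prod (ρ.prod ρ)) ((κ.prod ρ).prod (κ.prod ρ)) :=
    hmp.comp ((MeasurePreserving.id (κ.prod κ)).prod
      (Measure.measurePreserving_swap (μ := ρ) (ν := ρ)))
  have i1 := hmp.integrable_comp_of_integrable (hi.mul_prod hi)
  have i2 := hmp'.integrable_comp_of_integrable (hi.mul_prod hi)
  refine (i1.add i2).mono' ?_ (Eventually.of_forall fun r => ?_)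
  · have e : ∀ (f : (T × T) × (Z × Z) → T) (g : (T × T) × (Z × Z) → Z), Measurable f →
        Measurable g → Measurable fun r => Φ (f r) (g r) := fun f g hf hg => hm.comp (hf.prodMk hg)
    refine Measurable.aestronglyMeasurable ?_
    refine ((e _ _ ?_ ?_).mul (e _ _ ?_ ?_)).mul
      (Complex.continuous_conj.measurable.comp ((e _ _ ?_ ?_).mul (e _ _ ?_ ?_))) <;> fun_prop
  · simp only [Function.comp, Pi.add_apply, norm_mul, RCLike.norm_conj]
    have := two_mul_le_add_sq (‖Φ r.1.1 r.2.1‖ * ‖Φ r.1.2 r.2.2‖)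
        (‖Φ r.1.1 r.2.2‖ * ‖Φ r.1.2 r.2.1‖)
    simp only [mul_pow] at this
    have h0 : 0 ≤ ‖Φ r.1.1 r.2.1‖ * ‖Φ r.1.2 r.2.2‖ * (‖Φ r.1.1 r.2.2‖ * ‖Φ r.1.2 r.2.1‖) := by
      positivity
    nlinarith [this, h0]

/-- Expanding the squared modulus introduces a second copy of the sample point. After exchanging the
integrals, the two frequencies are independent and contribute the same factor, hence a complex
square. -/
lemma integral_sq_norm_integral_mul (hm : Measurable (fun r : T × Z => Φ r.1 r.2))
    (hi : Integrable (fun r : T × Z => ‖Φ r.1 r.2‖ ^ 2) (κ.prod ρ)) :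
    Integrable (fun w : Z × Z => (∫ t, Φ t w.1 * (starRingEnd ℂ) (Φ t w.2) ∂κ) ^ 2) (ρ.prod ρ) ∧
    ((∫ z : T × T, ‖∫ x, Φ z.1 x * Φ z.2 x ∂ρ‖ ^ 2 ∂(κ.prod κ) : ℝ) : ℂ) =
      ∫ w : Z × Z, (∫ t, Φ t w.1 * (starRingEnd ℂ) (Φ t w.2) ∂κ) ^ 2 ∂(ρ.prod ρ) := by
  have h := integrable_fourfold_complex hm hi
  have e1 : ∀ z : T × T, ∫ w : Z × Z, (Φ z.1 w.1 * Φ z.2 w.1) *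
      (starRingEnd ℂ) (Φ z.1 w.2 * Φ z.2 w.2) ∂(ρ.prod ρ) =
      ((‖∫ x, Φ z.1 x * Φ z.2 x ∂ρ‖ ^ 2 : ℝ) : ℂ) := by
    intro z
    rw [integral_prod_mul (fun x => Φ z.1 x * Φ z.2 x)
      (fun x => (starRingEnd ℂ) (Φ z.1 x * Φ z.2 x)), integral_conj, Complex.mul_conj,
      Complex.normSq_eq_norm_sq]
  have e2 : ∀ w : Z × Z, ∫ z : T × T, (Φ z.1 w.1 * Φ z.2 w.1) *
      (starRingEnd ℂ) (Φ z.1 w.2 * Φ z.2 w.2) ∂(κ.prod κ) =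
      (∫ t, Φ t w.1 * (starRingEnd ℂ) (Φ t w.2) ∂κ) ^ 2 := by
    intro w
    rw [sq, ← integral_prod_mul]
    congr 1; ext z; rw [map_mul]; ring
  refine ⟨h.integral_prod_right.congr (ae_of_all _ e2), ?_⟩
  rw [← integral_complex_ofReal]
  refine (integral_congr_ae (ae_of_all _ fun z => (e1 z).symm)).trans ?_
  refine (integral_integral_swap h).trans ?_
  exact integral_congr_ae (ae_of_all _ e2)

end FourfoldFubini

/-! ### Comparison of $\mathcal V^2(X)$ with $E\,d(X_1,X_2)^2$ -/

section DistanceVarianceBound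

variable {p : ℕ}

lemma integral_prod_dcovMeasure (F : EuclideanSpace ℝ (Fin p) × EuclideanSpace ℝ (Fin p) → ℝ) :
    ∫ z : EuclideanSpace ℝ (Fin p) × EuclideanSpace ℝ (Fin p),
        F z ∂((dcovMeasure p).prod (dcovMeasure p)) =
      ∫ z : EuclideanSpace ℝ (Fin p) × EuclideanSpace ℝ (Fin p),
          F z / (dcovConst p * dcovConst p * ‖z.1‖ ^ (p + 1) * ‖z.2‖ ^ (p + 1)) := by
  have hc := dcovConst_pos p
  rw [dcovMeasure, prod_withDensity (by fun_prop) (by fun_prop), ← Measure.volume_eq_prod,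
    integral_withDensity_eq_integral_toReal_smul (by fun_prop)
      (ae_of_all _ fun z => ENNReal.mul_lt_top ENNReal.ofReal_lt_top ENNReal.ofReal_lt_top)]
  refine integral_congr_ae (ae_of_all _ fun z => ?_)
  simp only [smul_eq_mul]
  rw [ENNReal.toReal_mul, ENNReal.toReal_ofReal (by positivity),
    ENNReal.toReal_ofReal (by positivity)]
  ring

/-- For $Y=X$ the numerator is a covariance without conjugation, because the joint characteristic
function multiplies the two characters. -/
lemma jointCharFun_self_sub {Ω : Type*} [MeasurableSpace Ω] {P : Measure Ω} [IsProbabilityMeasure P]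
    {X : Ω → EuclideanSpace ℝ (Fin p)} (hX : AEMeasurable X P) (t s : EuclideanSpace ℝ (Fin p)) :
    jointCharFun P X X t s - charFun (P.map X) t * charFun (P.map X) s =
      ∫ x, centeredChar (P.map X) t x * centeredChar (P.map X) s x ∂(P.map X) := by
  have : IsProbabilityMeasure (P.map X) := Measure.isProbabilityMeasure_map hX
  have hj : jointCharFun P X X t s = ∫ x, Complex.exp (((inner ℝ x t : ℝ) : ℂ) * Complex.I) *
      Complex.exp (((inner ℝ x s : ℝ) : ℂ) * Complex.I) ∂(P.map X) := by
    rw [integral_map hX (by fun_prop), jointCharFun]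
    congr 1; ext ω
    rw [← Complex.exp_add, real_inner_comm (X ω) t, real_inner_comm (X ω) s]
    push_cast; ring_nf
  set μ := P.map X
  have h1 := integrable_character μ t
  have h2 := integrable_character μ s
  have h12 : Integrable
      (fun x : EuclideanSpace ℝ (Fin p) => Complex.exp (((inner ℝ x t : ℝ) : ℂ) * Complex.I) *
      Complex.exp (((inner ℝ x s : ℝ) : ℂ) * Complex.I)) μ :=
    Integrable.of_bound (by fun_prop) 1 (ae_of_all _ fun x => by
      rw [norm_mul, Complex.norm_exp_ofReal_mul_I, Complex.norm_exp_ofReal_mul_I, one_mul])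
  have e : ∀ x, centeredChar μ t x * centeredChar μ s x =
      Complex.exp (((inner ℝ x t : ℝ) : ℂ) * Complex.I) *
        Complex.exp (((inner ℝ x s : ℝ) : ℂ) * Complex.I) + charFun μ t * charFun μ s -
      charFun μ s * Complex.exp (((inner ℝ x t : ℝ) : ℂ) * Complex.I) -
      charFun μ t * Complex.exp (((inner ℝ x s : ℝ) : ℂ) * Complex.I) := by
    intro x; simp only [centeredChar]; ring
  simp_rw [e]
  rw [integral_add_sub_sub h12 (integrable_const _) (h1.const_mul _) (h2.const_mul _),
    integral_const_mul, integral_const_mul, integral_const_mul, ← hj, ← charFun_apply,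
    ← charFun_apply]
  simp
  ring

/-- By the fourfold exchange $\mathcal V^2$ is the mean of $\mathrm{Re}(z^2)$, where $z$ is the
inner product of two centered characters and $\mathrm{Re}\,z=-d$; and
$\mathrm{Re}(z^2)\le(\mathrm{Re}\,z)^2$. The inequality is all that is needed: it transfers
positivity, and it only decreases ratios normalized by $\mathcal V^2$. -/
lemma distVarSq_le {Ω : Type*} [MeasurableSpace Ω] {P : Measure Ω} [IsProbabilityMeasure P]
    {X : Ω → EuclideanSpace ℝ (Fin p)} (hX : AEMeasurable X P)
        (hμ : Integrable (fun x : EuclideanSpace ℝ (Fin p) => ‖x‖) (P.map X))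
    (hd : MemLp (fun w : EuclideanSpace ℝ (Fin p) × EuclideanSpace ℝ (Fin p) =>
        doubleCentered (P.map X) w.1 w.2) 2
      ((P.map X).prod (P.map X))) :
    distVarSq P X ≤ kernelSq (P.map X) (doubleCentered (P.map X)) := by
  have : IsProbabilityMeasure (P.map X) := Measure.isProbabilityMeasure_map hX
  rw [distVarSq, distCovSq, ← integral_prod_dcovMeasure]
  simp_rw [jointCharFun_self_sub hX]
  set μ := P.map X
  obtain ⟨hi, h⟩ := integral_sq_norm_integral_mul (measurable_centeredChar μ)
    (integrable_sq_norm_centeredChar hμ)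
  have hre := congrArg Complex.re h
  rw [Complex.ofReal_re, ← RCLike.re_eq_complex_re, ← integral_re hi] at hre
  rw [hre, kernelSq]
  refine integral_mono hi.re hd.integrable_sq fun w => ?_
  have hint : Integrable (fun t => centeredChar μ t w.1 * (starRingEnd ℂ) (centeredChar μ t w.2))
      (dcovMeasure p) := by
    have a : ∀ x : EuclideanSpace ℝ (Fin p),
        Integrable (fun t => ‖centeredChar μ t x‖ ^ 2) (dcovMeasure p) := by
      intro x
      refine (integral_re_centeredChar hμ x x).1.congr (ae_of_all _ fun t => ?_)
      simp only []
      rw [Complex.mul_conj, Complex.ofReal_re, Complex.normSq_eq_norm_sq]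
    have hm : ∀ x : EuclideanSpace ℝ (Fin p), Measurable fun t => centeredChar μ t x := fun x =>
      (measurable_centeredChar μ).comp (f := fun t : EuclideanSpace ℝ (Fin p) => (t, x))
          (by fun_prop)
    refine ((a w.1).add (a w.2)).mono' ?_ (ae_of_all _ fun t => ?_)
    · exact ((hm _).mul (Complex.continuous_conj.measurable.comp (hm _))).aestronglyMeasurable
    · simp only [norm_mul, RCLike.norm_conj, Pi.add_apply]
      nlinarith [sq_nonneg (‖centeredChar μ t w.1‖ - ‖centeredChar μ t w.2‖),
        sq_nonneg (‖centeredChar μ t w.1‖ + ‖centeredChar μ t w.2‖)]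
  have hD := (integral_re_centeredChar hμ w.1 w.2).2
  have hD' : (∫ t, centeredChar μ t w.1 * (starRingEnd ℂ) (centeredChar μ t w.2)
      ∂(dcovMeasure p)).re = -doubleCentered μ w.1 w.2 := by
    rw [← hD]; exact (integral_re hint).symm
  simp only [RCLike.re_eq_complex_re]
  rw [sq, Complex.mul_re, hD']
  nlinarith [mul_self_nonneg (∫ t, centeredChar μ t w.1 * (starRingEnd ℂ) (centeredChar μ t w.2)
      ∂(dcovMeasure p)).im]

end DistanceVarianceBound

/-! ### Tails, moments and normalization of kernels -/

section Moments

variable {Z : Type*} [MeasurableSpace Z] {ρ : Measure Z} [IsProbabilityMeasure ρ] {h : Z → Z → ℝ}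
  {τ : ℝ}

/-- The absolute moment of order `r` of a kernel. -/
noncomputable def kernelMoment (ρ : Measure Z) (h : Z → Z → ℝ) (r : ℝ) : ℝ :=
  ∫ p, |h p.1 p.2| ^ r ∂(ρ.prod ρ)

/-- Markov: where $h^2>c$, $h^2\le|h|^{2+2\tau}/c^\tau$. -/
lemma tailSq_le (hh : MemLp (fun p : Z × Z => h p.1 p.2) 2 (ρ.prod ρ))
    (hm : Measurable (fun p : Z × Z => h p.1 p.2)) (hτ : 0 < τ)
    (hi : Integrable (fun p : Z × Z => |h p.1 p.2| ^ (2 + 2 * τ)) (ρ.prod ρ)) {c : ℝ} (hc : 0 < c) :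
    tailSq ρ h c ≤ kernelMoment ρ h (2 + 2 * τ) / c ^ τ := by
  rw [tailSq, kernelMoment, ← integral_div]
  have hct : 0 < c ^ τ := by positivity
  refine integral_mono ?_ (hi.div_const _) fun p => ?_
  · refine hh.integrable_sq.mono' ?_ (ae_of_all _ fun p => ?_)
    · exact (Measurable.ite (measurableSet_lt measurable_const (hm.pow_const 2)) (hm.pow_const 2)
        measurable_const).aestronglyMeasurable
    · split_ifs
      · rw [Real.norm_of_nonneg (sq_nonneg _)]
      · simpa using sq_nonneg _
  · simp only []
    split_ifs with hlt
    · rw [le_div_iff₀ hct, Real.rpow_add (by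
        rw [abs_pos]; rintro h0; rw [h0] at hlt; norm_num at hlt; linarith),
        Real.rpow_mul (abs_nonneg _), Real.rpow_two, sq_abs]
      exact mul_le_mul_of_nonneg_left (Real.rpow_le_rpow hc.le hlt.le hτ.le) (sq_nonneg _)
    · positivity

/-- Bernoulli's inequality $s^{1+\tau}\ge1+(1+\tau)(s-1)$ at $s=h^2$, integrated. It allows either
marginal moment to be bounded by the product of both. -/
lemma one_le_kernelMoment (hh : MemLp (fun p : Z × Z => h p.1 p.2) 2 (ρ.prod ρ))
    (h1 : kernelSq ρ h = 1) (hτ : 0 < τ)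
    (hi : Integrable (fun p : Z × Z => |h p.1 p.2| ^ (2 + 2 * τ)) (ρ.prod ρ)) :
    1 ≤ kernelMoment ρ h (2 + 2 * τ) := by
  have hpt : ∀ p : Z × Z, 1 + (1 + τ) * (h p.1 p.2 ^ 2 - 1) ≤ |h p.1 p.2| ^ (2 + 2 * τ) := by
    intro p
    have := one_add_mul_self_le_rpow_one_add (s := h p.1 p.2 ^ 2 - 1) (p := 1 + τ)
      (by nlinarith [sq_nonneg (h p.1 p.2)]) (by linarith)
    rw [show 2 + 2 * τ = 2 * (1 + τ) by ring, Real.rpow_mul (abs_nonneg _), Real.rpow_two, sq_abs]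
    calc _ ≤ _ := this
      _ = _ := by ring_nf
  have hs := hh.integrable_sq
  have i1 : Integrable (fun p : Z × Z => (1 + τ) * (h p.1 p.2 ^ 2 - 1)) (ρ.prod ρ) :=
    (hs.sub (integrable_const _)).const_mul _
  have := integral_mono ((integrable_const (1 : ℝ)).add i1) hi hpt
  refine le_trans (le_of_eq ?_) this
  simp only [Pi.add_apply]
  rw [integral_add (integrable_const _) i1, integral_const_mul,
      integral_sub hs (integrable_const _)]
  rw [kernelSq] at h1
  rw [h1]; simp

lemma kernelMoment_prodKernel {A B : Type*} [MeasurableSpace A] [MeasurableSpace B] {μ : Measure A}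
    {ν : Measure B} [IsProbabilityMeasure μ] [IsProbabilityMeasure ν] (f : A → A → ℝ)
    (g : B → B → ℝ) (r : ℝ) :
    kernelMoment (μ.prod ν) (prodKernel f g) r = kernelMoment μ f r * kernelMoment ν g r := by
  simp only [kernelMoment, prodKernel, abs_mul, Real.mul_rpow (abs_nonneg _) (abs_nonneg _)]
  exact integral_prod_four (fun p => |f p.1 p.2| ^ r) (fun p => |g p.1 p.2| ^ r)

lemma integrable_rpow_prodKernel {A B : Type*} [MeasurableSpace A] [MeasurableSpace B]
    {μ : Measure A} {ν : Measure B} [IsProbabilityMeasure μ] [IsProbabilityMeasure ν]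
    {f : A → A → ℝ} {g : B → B → ℝ} {r : ℝ}
    (hf : Integrable (fun p : A × A => |f p.1 p.2| ^ r) (μ.prod μ))
    (hg : Integrable (fun p : B × B => |g p.1 p.2| ^ r) (ν.prod ν)) :
    Integrable (fun p : (A × B) × (A × B) => |prodKernel f g p.1 p.2| ^ r)
      ((μ.prod ν).prod (μ.prod ν)) := by
  simp only [prodKernel, abs_mul, Real.mul_rpow (abs_nonneg _) (abs_nonneg _)]
  exact integrable_prod_four hf hg

/-- The rescaling of a kernel to unit second moment. -/
noncomputable def normalizedKernel (ρ : Measure Z) (h : Z → Z → ℝ) (x y : Z) : ℝ :=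
  h x y / √(kernelSq ρ h)

lemma kernelSq_nonneg : 0 ≤ kernelSq ρ h := integral_nonneg fun _ => sq_nonneg _

lemma IsDegenerateKernel.normalizedKernel (hh : IsDegenerateKernel ρ h) :
    IsDegenerateKernel ρ (normalizedKernel ρ h) := by
  unfold _root_.normalizedKernel
  refine ⟨hh.meas.div_const _, fun x y => by rw [hh.symm x y], ?_, ?_⟩
  · filter_upwards [hh.centered] with x hx
    rw [integral_div, hx, zero_div]
  · simp only [div_eq_mul_inv]
    exact hh.memLp.mul_const _

lemma kernelSq_normalizedKernel (hV : 0 < kernelSq ρ h) :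
    kernelSq ρ (normalizedKernel ρ h) = 1 := by
  rw [kernelSq]
  simp only [normalizedKernel, div_pow, Real.sq_sqrt hV.le]
  rw [integral_div, ← kernelSq, div_self hV.ne']

lemma abs_normalizedKernel_rpow (r : ℝ) (x y : Z) :
    |normalizedKernel ρ h x y| ^ (2 + 2 * r) =
      |h x y| ^ (2 + 2 * r) / kernelSq ρ h ^ (1 + r) := by
  rw [normalizedKernel, abs_div, abs_of_nonneg (Real.sqrt_nonneg _),
    Real.div_rpow (abs_nonneg _) (Real.sqrt_nonneg _), Real.sqrt_eq_rpow,
    ← Real.rpow_mul kernelSq_nonneg]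
  congr 2; ring

lemma kernelMoment_normalizedKernel (r : ℝ) :
    kernelMoment ρ (normalizedKernel ρ h) (2 + 2 * r) =
      kernelMoment ρ h (2 + 2 * r) / kernelSq ρ h ^ (1 + r) := by
  rw [kernelMoment, kernelMoment, ← integral_div]
  simp only [abs_normalizedKernel_rpow]

lemma kernelSq_composeKernel_normalizedKernel :
    kernelSq ρ (composeKernel ρ (normalizedKernel ρ h)) =
      kernelSq ρ (composeKernel ρ h) / kernelSq ρ h ^ 2 := by
  have e : ∀ x y, composeKernel ρ (normalizedKernel ρ h) x y =
      composeKernel ρ h x y / kernelSq ρ h := by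
    intro x y
    rw [composeKernel, composeKernel, ← integral_div]
    congr 1; ext w
    rw [normalizedKernel, normalizedKernel, div_mul_div_comm, Real.mul_self_sqrt kernelSq_nonneg]
  rw [kernelSq]
  simp only [e, div_pow]
  rw [integral_div]; rfl

end Moments

/-! ### The double-centered distance as a degenerate kernel -/

section DoubleCentered

variable {p : ℕ} {μ : Measure (EuclideanSpace ℝ (Fin p))} [IsProbabilityMeasure μ]

lemma measurable_integral_norm_sub :
    Measurable (fun x : EuclideanSpace ℝ (Fin p) => ∫ z, ‖x - z‖ ∂μ) :=
  (StronglyMeasurable.integral_prod_right (f := fun x z : EuclideanSpace ℝ (Fin p) => ‖x - z‖)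
    (by fun_prop)).measurable

lemma measurable_doubleCentered : Measurable
    (fun w : EuclideanSpace ℝ (Fin p) × EuclideanSpace ℝ (Fin p) => doubleCentered μ w.1 w.2) := by
  have h := measurable_integral_norm_sub (μ := μ)
  have e : ∀ y : EuclideanSpace ℝ (Fin p), ∫ z, ‖z - y‖ ∂μ = ∫ z, ‖y - z‖ ∂μ := fun y => by
    simp only [norm_sub_rev]
  simp only [doubleCentered, e]
  have h1 : Measurable fun w : EuclideanSpace ℝ (Fin p) × EuclideanSpace ℝ (Fin p) =>
      ∫ z, ‖w.1 - z‖ ∂μ := h.comp measurable_fst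
  have h2 : Measurable fun w : EuclideanSpace ℝ (Fin p) × EuclideanSpace ℝ (Fin p) =>
      ∫ z, ‖w.2 - z‖ ∂μ := h.comp measurable_snd
  exact (((by fun_prop : Measurable fun w : EuclideanSpace ℝ (Fin p) × EuclideanSpace ℝ (Fin p) =>
    ‖w.1 - w.2‖).sub h1).sub h2).add_const _

lemma integrable_norm_of_rpow {τ : ℝ} (hτ : 0 < τ)
    (hμ : Integrable (fun x : EuclideanSpace ℝ (Fin p) => ‖x‖ ^ (2 + 2 * τ)) μ) :
    Integrable (fun x : EuclideanSpace ℝ (Fin p) => ‖x‖) μ := by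
  refine ((integrable_const (1 : ℝ)).add hμ).mono' (by fun_prop) (ae_of_all _ fun x => ?_)
  simp only [Pi.add_apply, norm_norm]
  rcases le_total ‖x‖ 1 with h | h
  · have := Real.rpow_nonneg (norm_nonneg x) (2 + 2 * τ); linarith
  · have := Real.rpow_le_rpow_of_exponent_le h (show (1 : ℝ) ≤ 2 + 2 * τ by linarith)
    rw [Real.rpow_one] at this; linarith

lemma abs_doubleCentered_le (hμ : Integrable (fun x : EuclideanSpace ℝ (Fin p) => ‖x‖) μ)
    (x y : EuclideanSpace ℝ (Fin p)) :
    |doubleCentered μ x y| ≤ 2 * ‖x‖ + 2 * ‖y‖ +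
      (2 * ∫ z, ‖z‖ ∂μ + ∫ z, ‖z.1 - z.2‖ ∂(μ.prod μ)) := by
  have hu : ∀ a : EuclideanSpace ℝ (Fin p), ∫ z, ‖a - z‖ ∂μ ≤ ‖a‖ + ∫ z, ‖z‖ ∂μ := by
    intro a
    refine (integral_mono (integrable_norm_sub hμ a) ((integrable_const ‖a‖).add hμ)
      fun z => norm_sub_le a z).trans_eq ?_
    simp only [Pi.add_apply]
    rw [integral_add (integrable_const _) hμ]; simp
  have hu0 : ∀ a : EuclideanSpace ℝ (Fin p), 0 ≤ ∫ z, ‖a - z‖ ∂μ :=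
    fun a => integral_nonneg fun _ => norm_nonneg _
  have hM : 0 ≤ ∫ z : EuclideanSpace ℝ (Fin p) × EuclideanSpace ℝ (Fin p),
      ‖z.1 - z.2‖ ∂(μ.prod μ) :=
    integral_nonneg fun _ => norm_nonneg _
  have e : ∫ z, ‖z - y‖ ∂μ = ∫ z, ‖y - z‖ ∂μ := by simp only [norm_sub_rev]
  rw [doubleCentered, e, abs_le]
  constructor <;> nlinarith [hu x, hu y, hu0 x, hu0 y, norm_sub_le x y, norm_nonneg (x - y),
    norm_nonneg x, norm_nonneg y]

lemma integrable_doubleCentered_rpow {τ : ℝ} (hτ : 0 < τ)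
    (hμ : Integrable (fun x : EuclideanSpace ℝ (Fin p) => ‖x‖ ^ (2 + 2 * τ)) μ) :
    Integrable (fun w : EuclideanSpace ℝ (Fin p) × EuclideanSpace ℝ (Fin p) =>
      |doubleCentered μ w.1 w.2| ^ (2 + 2 * τ)) (μ.prod μ) := by
  have h1 := integrable_norm_of_rpow hτ hμ
  have hr : (ENNReal.ofReal (2 + 2 * τ)).toReal = 2 + 2 * τ := ENNReal.toReal_ofReal (by linarith)
  have hr0 : ENNReal.ofReal (2 + 2 * τ) ≠ 0 := by
    rw [ne_eq, ENNReal.ofReal_eq_zero]; linarith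
  have hL : MemLp (fun x : EuclideanSpace ℝ (Fin p) => ‖x‖) (ENNReal.ofReal (2 + 2 * τ)) μ := by
    rw [memLp_norm_iff (by fun_prop), ← integrable_norm_rpow_iff (by fun_prop) hr0
      ENNReal.ofReal_ne_top, hr]
    exact hμ
  have ha : MemLp (fun w : EuclideanSpace ℝ (Fin p) × EuclideanSpace ℝ (Fin p) => ‖w.1‖)
      (ENNReal.ofReal (2 + 2 * τ)) (μ.prod μ) :=
    hL.comp_measurePreserving (measurePreserving_fst (μ := μ) (ν := μ))
  have hb : MemLp (fun w : EuclideanSpace ℝ (Fin p) × EuclideanSpace ℝ (Fin p) => ‖w.2‖)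
      (ENNReal.ofReal (2 + 2 * τ)) (μ.prod μ) :=
    hL.comp_measurePreserving (measurePreserving_snd (μ := μ) (ν := μ))
  have hd : MemLp (fun w : EuclideanSpace ℝ (Fin p) × EuclideanSpace ℝ (Fin p) =>
      doubleCentered μ w.1 w.2) (ENNReal.ofReal (2 + 2 * τ)) (μ.prod μ) := by
    refine MemLp.mono' (((ha.const_mul 2).add (hb.const_mul 2)).add (memLp_const
      (2 * ∫ z, ‖z‖ ∂μ + ∫ z, ‖z.1 - z.2‖ ∂(μ.prod μ))))
      measurable_doubleCentered.aestronglyMeasurable (ae_of_all _ fun w => ?_)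
    exact abs_doubleCentered_le h1 w.1 w.2
  have := hd.integrable_norm_rpow hr0 ENNReal.ofReal_ne_top
  rw [hr] at this
  exact this

lemma isDegenerateKernel_doubleCentered {τ : ℝ} (hτ : 0 < τ)
    (hμ : Integrable (fun x : EuclideanSpace ℝ (Fin p) => ‖x‖ ^ (2 + 2 * τ)) μ) :
    IsDegenerateKernel μ (doubleCentered μ) := by
  have h1 := integrable_norm_of_rpow hτ hμ
  refine ⟨measurable_doubleCentered, fun x y => ?_, ae_of_all _ fun x => ?_, ?_⟩
  · simp only [doubleCentered, norm_sub_rev]; ring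
  · have hp := integrable_norm_sub_prod h1
    have i1 : Integrable (fun y => ∫ z, ‖z - y‖ ∂μ) μ := hp.integral_prod_right
    have i0 := integrable_norm_sub h1 x
    have e : ∀ y, doubleCentered μ x y = ‖x - y‖ + (∫ z, ‖z.1 - z.2‖ ∂(μ.prod μ)) -
        (∫ z, ‖x - z‖ ∂μ) - ∫ z, ‖z - y‖ ∂μ := fun y => by simp only [doubleCentered]; ring
    simp only [e]
    rw [integral_add_sub_sub i0 (integrable_const _) (integrable_const _) i1,
      integral_prod_symm _ hp]
    simp
  · rw [memLp_two_iff_integrable_sq measurable_doubleCentered.aestronglyMeasurable]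
    refine ((integrable_const (1 : ℝ)).add (integrable_doubleCentered_rpow hτ hμ)).mono'
      (measurable_doubleCentered.pow_const 2).aestronglyMeasurable (ae_of_all _ fun w => ?_)
    simp only [Pi.add_apply, norm_pow, Real.norm_eq_abs]
    rcases le_total |doubleCentered μ w.1 w.2| 1 with h | h
    · have := Real.rpow_nonneg (abs_nonneg (doubleCentered μ w.1 w.2)) (2 + 2 * τ)
      nlinarith [abs_nonneg (doubleCentered μ w.1 w.2)]
    · have := Real.rpow_le_rpow_of_exponent_le h (show (2 : ℝ) ≤ 2 + 2 * τ by linarith)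
      rw [Real.rpow_two] at this; linarith

lemma doubleCenteredMoment_eq (r : ℝ) :
    doubleCenteredMoment μ r = kernelMoment μ (doubleCentered μ) r := rfl

/-- The factors of the four-point product form the cycle 0–1–3–2; the grouping puts opposite
vertices together. -/
lemma measurePreserving_four {Z : Type*} [MeasurableSpace Z] (ρ : Measure Z)
    [IsProbabilityMeasure ρ] :
    MeasurePreserving (fun x : Fin 4 → Z => ((x 0, x 3), (x 1, x 2))) (Measure.pi fun _ => ρ)
      ((ρ.prod ρ).prod (ρ.prod ρ)) := by
  let e : Fin 4 → Fin 4 := ![0, 3, 1, 2]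
  have hind : iIndepFun (fun (i : Fin 4) (x : Fin 4 → Z) => x i) (Measure.pi fun _ => ρ) :=
    iIndepFun_pi (X := fun _ => id) fun _ => aemeasurable_id
  have hev := fun i : Fin 4 => measurePreserving_eval (fun _ : Fin 4 => ρ) i
  have h2 := hind.indepFun_prodMk_prodMk (fun i => measurable_pi_apply i) 0 3 1 2
    (by decide) (by decide) (by decide) (by decide)
  have h03 := hind.indepFun (show (0 : Fin 4) ≠ 3 by decide)
  have h12 := hind.indepFun (show (1 : Fin 4) ≠ 2 by decide)
  have hev' := fun i : Fin 4 => (hev i).measurable.aemeasurable (μ := Measure.pi fun _ => ρ)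
  rw [indepFun_iff_map_prod_eq_prod_map_map (hev' 0) (hev' 3)] at h03
  rw [indepFun_iff_map_prod_eq_prod_map_map (hev' 1) (hev' 2)] at h12
  rw [indepFun_iff_map_prod_eq_prod_map_map ((hev' 0).prodMk (hev' 3))
    ((hev' 1).prodMk (hev' 2))] at h2
  rw [h03, h12, (hev 0).map_eq, (hev 1).map_eq, (hev 2).map_eq, (hev 3).map_eq] at h2
  exact ⟨by fun_prop, h2⟩

/-- With $X_0,X_3$ fixed, the paths through $X_1$ and through $X_2$ are independent and each
averages to $(h\circ h)(X_0,X_3)$. -/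
lemma IsDegenerateKernel.integral_four {Z : Type*} [MeasurableSpace Z] {ρ : Measure Z}
    [IsProbabilityMeasure ρ] {h : Z → Z → ℝ} (hh : IsDegenerateKernel ρ h) :
    ∫ x : Fin 4 → Z, h (x 0) (x 1) * h (x 0) (x 2) * h (x 1) (x 3) * h (x 2) (x 3)
      ∂(Measure.pi fun _ => ρ) = kernelSq ρ (_root_.composeKernel ρ h) := by
  have e : ∀ f g : (Z × Z) × (Z × Z) → Z,
      Measurable f → Measurable g → Measurable fun r => h (f r) (g r) :=
    fun f g hf hg => hh.meas.comp (hf.prodMk hg)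
  have hm : Measurable (fun r : (Z × Z) × (Z × Z) =>
      (h r.1.1 r.2.1 * h r.1.2 r.2.1) * (h r.1.1 r.2.2 * h r.1.2 r.2.2)) := by
    refine ((e _ _ ?_ ?_).mul (e _ _ ?_ ?_)).mul ((e _ _ ?_ ?_).mul (e _ _ ?_ ?_)) <;> fun_prop
  have hmp := measurePreserving_four ρ
  have := integral_map (μ := Measure.pi fun _ : Fin 4 => ρ) hmp.measurable.aemeasurable
    hm.aestronglyMeasurable
  rw [hmp.map_eq] at this
  rw [kernelSq_composeKernel hh.meas hh.memLp, this]
  refine integral_congr_ae (ae_of_all _ fun x => ?_)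
  simp only []
  rw [hh.symm (x 3) (x 1), hh.symm (x 3) (x 2)]
  ring

lemma gMoment_eq (hh : IsDegenerateKernel μ (doubleCentered μ)) :
    gMoment μ = kernelSq μ (composeKernel μ (doubleCentered μ)) :=
  hh.integral_four

end DoubleCentered

/-! ### Studentization -/

/-- The studentized `𝒰`-inner product of two matrices. -/
noncomputable def uCorr {n : ℕ} (D E : Fin n → Fin n → ℝ) : ℝ :=
  if 0 < uInner D D * uInner E E then uInner D E / √(uInner D D * uInner E E) else 0

section Studentization

lemma norm_exp_mul_I_sub_exp_mul_I_le (a b : ℝ) :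
    ‖Complex.exp ((a : ℂ) * Complex.I) - Complex.exp ((b : ℂ) * Complex.I)‖ ≤ |a - b| := by
  have e : Complex.exp ((a : ℂ) * Complex.I) - Complex.exp ((b : ℂ) * Complex.I) =
      Complex.exp ((b : ℂ) * Complex.I) * (Complex.exp (Complex.I * ((a - b : ℝ) : ℂ)) - 1) := by
    rw [mul_sub, ← Complex.exp_add, mul_one]
    congr 2; push_cast; ring
  rw [e, norm_mul, Complex.norm_exp_ofReal_mul_I, one_mul]
  exact Real.norm_exp_I_mul_ofReal_sub_one_le

/-- The effect of studentization on `exp (i t S)`. -/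
lemma norm_exp_studentized_sub_le {Q S a b t η : ℝ} (hη0 : 0 < η) (hη : η ≤ 1 / 2) :
    ‖Complex.exp (((t * (if 0 < a * b then Q / √(a * b) else 0) : ℝ) : ℂ) * Complex.I) -
      Complex.exp (((t * S : ℝ) : ℂ) * Complex.I)‖ ≤
      4 * |t| * √η + 2 * ((|Q - S| + |a - 1| + |b - 1|) / η + η * S ^ 2) := by
  have h2 : ‖Complex.exp (((t * (if 0 < a * b then Q / √(a * b) else 0) : ℝ) : ℂ) * Complex.I) -
      Complex.exp (((t * S : ℝ) : ℂ) * Complex.I)‖ ≤ 2 := by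
    refine (norm_sub_le _ _).trans ?_
    rw [Complex.norm_exp_ofReal_mul_I, Complex.norm_exp_ofReal_mul_I]; norm_num
  have h0 : 0 ≤ 4 * |t| * √η := by positivity
  -- Two exceptional events, a large total error and $\eta S^2>1$. On each the trivial bound 2 is
  -- absorbed by the last term, a Markov bound in pointwise form.
  by_cases hbad : η < |Q - S| + |a - 1| + |b - 1|
  · have : 1 ≤ (|Q - S| + |a - 1| + |b - 1|) / η := by rw [one_le_div hη0]; exact hbad.le
    nlinarith [mul_nonneg hη0.le (sq_nonneg S)]
  have hd : 0 ≤ (|Q - S| + |a - 1| + |b - 1|) / η := by positivity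
  by_cases hS : 1 < η * S ^ 2
  · linarith
  have hS0 : 0 ≤ η * S ^ 2 := by positivity
  push Not at hbad hS
  have hQ : |Q - S| ≤ η := by linarith [abs_nonneg (a - 1), abs_nonneg (b - 1)]
  have ha := abs_le.1 (show |a - 1| ≤ η by linarith [abs_nonneg (Q - S), abs_nonneg (b - 1)])
  have hb := abs_le.1 (show |b - 1| ≤ η by linarith [abs_nonneg (Q - S), abs_nonneg (a - 1)])
  have hab : 0 < a * b := mul_pos (by linarith) (by linarith)
  have hr1 : 1 - η ≤ √(a * b) := Real.le_sqrt_of_sq_le (by nlinarith)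
  have hr2 : √(a * b) ≤ 1 + η := Real.sqrt_le_iff.2 ⟨by linarith, by nlinarith⟩
  rw [if_pos hab]
  set r := √(a * b)
  have hr0 : 0 < r := by linarith
  have hSη : |S| * η ≤ √η := by
    refine Real.le_sqrt_of_sq_le ?_
    rw [mul_pow, sq_abs]; nlinarith
  have hηs : η ≤ √η := Real.le_sqrt_of_sq_le (by nlinarith)
  -- The numerator of the difference is at most $\eta+|S|\eta\le2\sqrt\eta$, and $r\ge1/2$.
  have hdiff : |Q / r - S| ≤ 4 * √η := by
    have e : Q / r - S = ((Q - S) + S * (1 - r)) / r := by field_simp; ring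
    rw [e, abs_div, abs_of_pos hr0, div_le_iff₀ hr0]
    have h1r : |1 - r| ≤ η := abs_le.2 ⟨by linarith, by linarith⟩
    have := abs_add_le (Q - S) (S * (1 - r))
    rw [abs_mul] at this
    have h3 := mul_le_mul_of_nonneg_left h1r (abs_nonneg S)
    have h4 : (1 : ℝ) / 2 ≤ r := by linarith
    nlinarith [Real.sqrt_nonneg η]
  refine (norm_exp_mul_I_sub_exp_mul_I_le _ _).trans ?_
  rw [← mul_sub, abs_mul]
  have := mul_le_mul_of_nonneg_left hdiff (abs_nonneg t)
  linarith

end Studentization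

section Integrability

variable {n : ℕ} {Z : Type*} [MeasurableSpace Z] {π : Measure Z} {D E : Z → Fin n → Fin n → ℝ}

lemma measurable_uInner (hD : ∀ k l, Measurable fun z => D z k l)
    (hE : ∀ k l, Measurable fun z => E z k l) : Measurable fun z => uInner (D z) (E z) := by
  unfold uInner
  have h1 := fun k => Finset.measurable_sum Finset.univ fun l _ => hD k l
  have h2 := fun k => Finset.measurable_sum Finset.univ fun l _ => hE k l
  exact (((Finset.measurable_sum _ fun k _ => Finset.measurable_sum _ fun l _ =>
    (hD k l).mul (hE k l)).sub ((Finset.measurable_sum _ fun k _ => (h1 k).mul (h2 k)).const_mul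
      _)).add (((Finset.measurable_sum _ fun k _ => h1 k).mul
        (Finset.measurable_sum _ fun k _ => h2 k)).const_mul _)).const_mul _

lemma measurable_uCorr (hD : ∀ k l, Measurable fun z => D z k l)
    (hE : ∀ k l, Measurable fun z => E z k l) : Measurable fun z => uCorr (D z) (E z) := by
  unfold uCorr
  have h := (measurable_uInner hD hD).mul (measurable_uInner hE hE)
  exact Measurable.ite (measurableSet_lt measurable_const h)
    ((measurable_uInner hD hE).div h.sqrt) measurable_const

lemma integrable_uInner (hD : ∀ k l, MemLp (fun z => D z k l) 2 π)
    (hE : ∀ k l, MemLp (fun z => E z k l) 2 π) : Integrable (fun z => uInner (D z) (E z)) π := by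
  unfold uInner
  have h1 := fun k => memLp_finsetSum Finset.univ fun l _ => hD k l
  have h2 := fun k => memLp_finsetSum Finset.univ fun l _ => hE k l
  exact (((integrable_finsetSum _ fun k _ => integrable_finsetSum _ fun l _ =>
    (hD k l).integrable_mul (hE k l)).sub ((integrable_finsetSum _ fun k _ =>
      (h1 k).integrable_mul (h2 k)).const_mul _)).add
        (((memLp_finsetSum _ fun k _ => h1 k).integrable_mul
          (memLp_finsetSum _ fun k _ => h2 k)).const_mul _)).const_mul _

end Integrability

/-! ### Quantitative limit theorem for the studentized statistic -/

section StudentizedLimit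

variable {A B : Type*} [MeasurableSpace A] [MeasurableSpace B] {μ : Measure A} {ν : Measure B}
  [IsProbabilityMeasure μ] [IsProbabilityMeasure ν] {f : A → A → ℝ} {g : B → B → ℝ} {n : ℕ}

lemma IsDegenerateKernel.measurable_offDiag {Z ι : Type*} [MeasurableSpace Z] [DecidableEq ι]
    {ρ : Measure Z} {h : Z → Z → ℝ} (hh : IsDegenerateKernel ρ h) (k l : ι) :
    Measurable fun z : ι → Z => offDiag h z k l := by
  unfold offDiag
  split_ifs
  · exact measurable_const
  · exact hh.meas.comp (f := fun z : ι → Z => (z k, z l))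
      ((measurable_pi_apply k).prodMk (measurable_pi_apply l))

lemma IsDegenerateKernel.memLp_partialPairSum {Z : Type*} [MeasurableSpace Z] {ρ : Measure Z}
    [IsProbabilityMeasure ρ] {h : Z → Z → ℝ} (hh : IsDegenerateKernel ρ h) :
    MemLp (fun z : Fin n → Z => partialPairSum h n z) 2 (Measure.pi fun _ : Fin n => ρ) := by
  have := (hh.memLp_total (n := n)).const_mul (1 / 2)
  refine this.ae_eq (ae_of_all _ fun z => ?_)
  simp only [hh.sum_offDiag_eq]; ring

lemma IsDegenerateKernel.integral_partialPairSum_sq {Z : Type*} [MeasurableSpace Z] {ρ : Measure Z}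
    [IsProbabilityMeasure ρ] {h : Z → Z → ℝ} (hh : IsDegenerateKernel ρ h)
    (h1 : kernelSq ρ h = 1) :
    ∫ z, (partialPairSum h n z) ^ 2 ∂(Measure.pi fun _ : Fin n => ρ) = (n : ℝ) * (n - 1) / 2 := by
  have := hh.integral_total_sq (n := n) h1
  simp only [hh.sum_offDiag_eq, mul_pow] at this
  rw [integral_const_mul] at this
  linarith

/-- Triangle inequality through the normalized $U$-statistic `S` with $E S^2=1$. The truncation
parameter is $\varepsilon=\eta^2$, so that dividing by $\eta$ in the studentization bound still
leaves $O(\eta)$. -/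
lemma norm_integral_exp_uCorr_sub_le (hf : IsDegenerateKernel μ f) (hg : IsDegenerateKernel ν g)
    (hf1 : kernelSq μ f = 1) (hg1 : kernelSq ν g = 1) (hn : 6 ≤ n) (t : ℝ) {η : ℝ} (hη0 : 0 < η)
    (hη : η ≤ 1 / 2) :
    ‖∫ z, Complex.exp (((t * (√((n : ℝ) * (n - 1) / 2) *
        uCorr (offDiag f fun i => (z i).1) (offDiag g fun i => (z i).2)) : ℝ) : ℂ) * Complex.I)
        ∂(Measure.pi fun _ : Fin n => μ.prod ν) - (Real.exp (-(t ^ 2 / 2)) : ℂ)‖ ≤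
      (4 * |t| * √η + 2 * ((16 / √n + (4 * η ^ 2 + 4 * tailSq μ f ((η ^ 2) ^ 2 * n) + 10 / n) +
        (4 * η ^ 2 + 4 * tailSq ν g ((η ^ 2) ^ 2 * n) + 10 / n)) / η + η)) +
      (68 * t ^ 2 + 3072 * t ^ 4) * (η ^ 2 + tailSq (μ.prod ν) (prodKernel f g) ((η ^ 2) ^ 2 * n) +
        √(kernelSq (μ.prod ν) (composeKernel (μ.prod ν) (prodKernel f g))) + 1 / n) := by
  have hn' : (6 : ℝ) ≤ n := by exact_mod_cast hn
  have hk := hf.prodKernel hg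
  have hk1 : kernelSq (μ.prod ν) (prodKernel f g) = 1 := by
    rw [kernelSq_prodKernel, hf1, hg1, one_mul]
  have hV0 : 0 < (n : ℝ) * (n - 1) / 2 := by nlinarith
  have hs0 : 0 < √((n : ℝ) * (n - 1) / 2) := Real.sqrt_pos.2 hV0
  have hs2 : √((n : ℝ) * (n - 1) / 2) ^ 2 = (n : ℝ) * (n - 1) / 2 := Real.sq_sqrt hV0.le
  have hB1 := integral_abs_uInner_sub_le hf hg hf1 hg1 hn
  have hB2 := hf.integral_abs_uInner_sub_one_le hf1 hn (ε := η ^ 2) (by positivity)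
  have hB3 := hg.integral_abs_uInner_sub_one_le hg1 hn (ε := η ^ 2) (by positivity)
  have hclt := hk.norm_integral_exp_sub_le (n := n) hk1 (t / √((n : ℝ) * (n - 1) / 2))
    (ε := η ^ 2) (by positivity)
  have hSq := hk.integral_partialPairSum_sq (n := n) hk1
  have mS := hk.memLp_partialPairSum (n := n)
  have hfst := measurePreserving_pi_fst (ι := Fin n) (μ := μ) (ν := ν)
  have hsnd := measurePreserving_pi_snd (ι := Fin n) (μ := μ) (ν := ν)
  set s := √((n : ℝ) * (n - 1) / 2) with hs
  set π := Measure.pi fun _ : Fin n => μ.prod ν with hπ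
  have mD : ∀ k l, Measurable fun z : Fin n → A × B => offDiag f (fun i => (z i).1) k l :=
    fun k l => (hf.measurable_offDiag k l).comp hfst.measurable
  have mE : ∀ k l, Measurable fun z : Fin n → A × B => offDiag g (fun i => (z i).2) k l :=
    fun k l => (hg.measurable_offDiag k l).comp hsnd.measurable
  have LD : ∀ k l, MemLp (fun z : Fin n → A × B => offDiag f (fun i => (z i).1) k l) 2 π :=
    fun k l => (hf.memLp_offDiag k l).comp_measurePreserving hfst
  have LE : ∀ k l, MemLp (fun z : Fin n → A × B => offDiag g (fun i => (z i).2) k l) 2 π :=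
    fun k l => (hg.memLp_offDiag k l).comp_measurePreserving hsnd
  have mDD := measurable_uInner (fun k l => hf.measurable_offDiag (ι := Fin n) k l)
    (fun k l => hf.measurable_offDiag k l)
  have mEE := measurable_uInner (fun k l => hg.measurable_offDiag (ι := Fin n) k l)
    (fun k l => hg.measurable_offDiag k l)
  rw [← hfst.map_eq, integral_map hfst.measurable.aemeasurable
    (mDD.sub_const 1).abs.aestronglyMeasurable] at hB2
  rw [← hsnd.map_eq, integral_map hsnd.measurable.aemeasurable
    (mEE.sub_const 1).abs.aestronglyMeasurable] at hB3
  set D : (Fin n → A × B) → Fin n → Fin n → ℝ := fun z => offDiag f (fun i => (z i).1) with hD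
  set E : (Fin n → A × B) → Fin n → Fin n → ℝ := fun z => offDiag g (fun i => (z i).2) with hE
  set S : (Fin n → A × B) → ℝ := fun z => 1 / s * partialPairSum (prodKernel f g) n z with hS
  have iQ : Integrable (fun z => |s * uInner (D z) (E z) - S z|) π :=
    (((integrable_uInner LD LE).const_mul _).sub
      ((mS.const_mul (1 / s)).integrable one_le_two)).abs
  have iD : Integrable (fun z => |uInner (D z) (D z) - 1|) π :=
    ((integrable_uInner LD LD).sub (integrable_const _)).abs
  have iE : Integrable (fun z => |uInner (E z) (E z) - 1|) π :=
    ((integrable_uInner LE LE).sub (integrable_const _)).abs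
  have iS : Integrable (fun z => S z ^ 2) π := (mS.const_mul (1 / s)).integrable_sq
  have vS : ∫ z, S z ^ 2 ∂π = 1 := by
    simp only [hS, mul_pow]
    rw [integral_const_mul, hSq, ← hs2]
    field_simp
  have mT : Measurable fun z => s * uCorr (D z) (E z) := (measurable_uCorr mD mE).const_mul _
  have mSm : Measurable S := (measurable_partialPairSum hk.meas n).const_mul _
  have iexp : ∀ F : (Fin n → A × B) → ℝ, Measurable F →
      Integrable (fun z => Complex.exp (((t * F z : ℝ) : ℂ) * Complex.I)) π := fun F hF =>
    Integrable.of_bound (by fun_prop) 1 (ae_of_all _ fun z => by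
      rw [Complex.norm_exp_ofReal_mul_I])
  have hstep : ‖∫ z, Complex.exp (((t * (s * uCorr (D z) (E z)) : ℝ) : ℂ) * Complex.I) ∂π -
      ∫ z, Complex.exp (((t * S z : ℝ) : ℂ) * Complex.I) ∂π‖ ≤
      4 * |t| * √η + 2 * ((16 / √n + (4 * η ^ 2 + 4 * tailSq μ f ((η ^ 2) ^ 2 * n) + 10 / n) +
        (4 * η ^ 2 + 4 * tailSq ν g ((η ^ 2) ^ 2 * n) + 10 / n)) / η + η) := by
    rw [← integral_sub (iexp _ mT) (iexp _ mSm)]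
    have iQDE : Integrable (fun z => |s * uInner (D z) (E z) - S z| + |uInner (D z) (D z) - 1| +
        |uInner (E z) (E z) - 1|) π := (iQ.add iD).add iE
    have iR : Integrable (fun z => (|s * uInner (D z) (E z) - S z| + |uInner (D z) (D z) - 1| +
        |uInner (E z) (E z) - 1|) / η + η * S z ^ 2) π := (iQDE.div_const _).add (iS.const_mul _)
    have iB : Integrable (fun z => 4 * |t| * √η + 2 * ((|s * uInner (D z) (E z) - S z| +
        |uInner (D z) (D z) - 1| + |uInner (E z) (E z) - 1|) / η + η * S z ^ 2)) π :=
      (integrable_const _).add (iR.const_mul 2)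
    refine (norm_integral_le_of_norm_le iB (ae_of_all _ fun z => ?_)).trans ?_
    · have := norm_exp_studentized_sub_le (Q := s * uInner (D z) (E z)) (S := S z)
        (a := uInner (D z) (D z)) (b := uInner (E z) (E z)) (t := t) hη0 hη
      refine le_trans (le_of_eq ?_) this
      congr 5
      rw [uCorr]
      split_ifs
      · rw [mul_div_assoc]
      · rw [mul_zero]
    · rw [integral_add (integrable_const _) (iR.const_mul 2), integral_const, integral_const_mul,
        integral_add (iQDE.div_const _) (iS.const_mul _), integral_div, integral_const_mul, vS,
        integral_add (by exact iQ.add iD) iE, integral_add iQ iD]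
      simp only [probReal_univ, one_smul, mul_one]
      gcongr
  have hmain : ‖∫ z, Complex.exp (((t * S z : ℝ) : ℂ) * Complex.I) ∂π -
      (Real.exp (-(t ^ 2 / 2)) : ℂ)‖ ≤ (68 * t ^ 2 + 3072 * t ^ 4) *
      (η ^ 2 + tailSq (μ.prod ν) (prodKernel f g) ((η ^ 2) ^ 2 * n) +
        √(kernelSq (μ.prod ν) (composeKernel (μ.prod ν) (prodKernel f g))) + 1 / n) := by
    have e1 : ∀ z, t * S z = t / s * partialPairSum (prodKernel f g) n z := fun z => by
      simp only [hS]; ring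
    have e2 : (t / s) ^ 2 * ((n : ℝ) * (n - 1) / 2) / 2 = t ^ 2 / 2 := by
      rw [← hs2]; field_simp
    rw [e2] at hclt
    simp only [e1]
    refine hclt.trans ?_
    -- Here $n^2/s^2=2n/(n-1)\le4$, whence $68=17\cdot4$ and $3072=192\cdot16$.
    have hu : (t / s) ^ 2 * (n : ℝ) ^ 2 ≤ 4 * t ^ 2 := by
      rw [div_pow, hs2, div_mul_eq_mul_div, div_le_iff₀ hV0]
      nlinarith [sq_nonneg t, mul_nonneg (sq_nonneg t) (show (0 : ℝ) ≤ n * (n - 2) by nlinarith)]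
    have hu0 : 0 ≤ (t / s) ^ 2 * (n : ℝ) ^ 2 := by positivity
    have ht0 : 0 ≤ tailSq (μ.prod ν) (prodKernel f g) ((η ^ 2) ^ 2 * n) :=
      integral_nonneg fun p => by simp only [Pi.zero_apply]; split_ifs <;> positivity
    refine mul_le_mul_of_nonneg_right ?_ (by positivity)
    nlinarith
  calc _ ≤ _ := norm_sub_le_norm_sub_add_norm_sub _
        (∫ z, Complex.exp (((t * S z : ℝ) : ℂ) * Complex.I) ∂π) _
    _ ≤ _ := add_le_add hstep hmain

end StudentizedLimit

/-! ### From distances to normalized double-centered kernels -/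

section SampleStatistics

variable {p q n : ℕ} {μ : Measure (EuclideanSpace ℝ (Fin p))}
    {ν : Measure (EuclideanSpace ℝ (Fin q))}

lemma doubleCentered_comm (x y : EuclideanSpace ℝ (Fin p)) :
    doubleCentered μ x y = doubleCentered μ y x := by
  simp only [doubleCentered, norm_sub_rev]; ring

lemma offDiag_doubleCentered_comm (x : Fin n → EuclideanSpace ℝ (Fin p)) (k l : Fin n) :
    offDiag (doubleCentered μ) x k l = offDiag (doubleCentered μ) x l k := by
  simp only [offDiag, eq_comm (a := k), doubleCentered_comm (x k)]

lemma uCentered_eq (μ : Measure (EuclideanSpace ℝ (Fin p))) (hn : 4 ≤ n)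
    (x : Fin n → EuclideanSpace ℝ (Fin p)) {k l : Fin n} (hkl : k ≠ l) :
    uCentered x k l = uMatrix (offDiag (doubleCentered μ) x) k l := by
  -- Half of the grand mean goes to each index, so that off the diagonal distance minus $d$ has the
  -- form $u_k+u_l$; on the diagonal both matrices are 0.
  refine (uMatrix_eq_of_additive hn (a := fun k l => ‖x k - x l‖) (u := fun k =>
    ∫ z, ‖x k - z‖ ∂μ - (∫ z, ‖z.1 - z.2‖ ∂(μ.prod μ)) / 2) (fun k l => ?_) hkl)
  by_cases h : k = l
  · simp [h, offDiag]
  · have e : ∫ z, ‖z - x l‖ ∂μ = ∫ z, ‖x l - z‖ ∂μ := by simp only [norm_sub_rev]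
    simp only [offDiag, if_neg h, doubleCentered, e]
    ring

lemma sampleDistCov_eq (μ : Measure (EuclideanSpace ℝ (Fin p)))
    (ν : Measure (EuclideanSpace ℝ (Fin q))) (hn : 4 ≤ n)
    (x : Fin n → EuclideanSpace ℝ (Fin p)) (y : Fin n → EuclideanSpace ℝ (Fin q)) :
    sampleDistCov x y =
      uInner (offDiag (doubleCentered μ) x) (offDiag (doubleCentered ν) y) := by
  rw [← sum_uMatrix_mul hn (fun k l => offDiag_doubleCentered_comm x k l)
    (fun k l => offDiag_doubleCentered_comm y k l) (fun k => by simp [offDiag])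
    (fun k => by simp [offDiag]), sampleDistCov]
  congr 1
  refine Finset.sum_congr rfl fun k _ => Finset.sum_congr rfl fun l _ => ?_
  split_ifs with hkl
  · rw [uCentered_eq μ hn x hkl, uCentered_eq ν hn y hkl]
  · rfl

lemma uInner_div {D E D' E' : Fin n → Fin n → ℝ} {a b : ℝ} (hD : ∀ k l, D' k l = D k l / a)
    (hE : ∀ k l, E' k l = E k l / b) : uInner D' E' = uInner D E / (a * b) := by
  unfold uInner
  generalize 1 / ((n : ℝ) * ((n : ℝ) - 3)) = r₁
  generalize 2 / ((n : ℝ) - 2) = r₂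
  generalize 1 / (((n : ℝ) - 1) * ((n : ℝ) - 2)) = r₃
  simp only [hD, hE, ← Finset.sum_div, div_mul_div_comm]
  ring

lemma uCorr_div {D E D' E' : Fin n → Fin n → ℝ} {a b : ℝ} (ha : 0 < a) (hb : 0 < b)
    (hD : ∀ k l, D' k l = D k l / a) (hE : ∀ k l, E' k l = E k l / b) :
    uCorr D' E' = uCorr D E := by
  have e : uInner D D / (a * a) * (uInner E E / (b * b)) =
      uInner D D * uInner E E / (a * b) ^ 2 := by
    field_simp
  have h2 : 0 < (a * b) ^ 2 := by positivity
  rw [uCorr, uCorr, uInner_div hD hE, uInner_div hD hD, uInner_div hE hE, e]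
  by_cases h : 0 < uInner D D * uInner E E
  · rw [if_pos h, if_pos (by positivity), Real.sqrt_div' _ h2.le, Real.sqrt_sq (by positivity)]
    field_simp
  · rw [if_neg h, if_neg]
    rw [div_pos_iff_of_pos_right h2]; exact h

lemma offDiag_normalizedKernel {Z : Type*} [MeasurableSpace Z] {ρ : Measure Z} {h : Z → Z → ℝ}
    (z : Fin n → Z) (k l : Fin n) :
    offDiag (normalizedKernel ρ h) z k l = offDiag h z k l / √(kernelSq ρ h) := by
  simp only [offDiag, normalizedKernel]
  split_ifs <;> simp

lemma sampleDistCorr_eq (hn : 4 ≤ n) (hV : 0 < kernelSq μ (doubleCentered μ))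
    (hW : 0 < kernelSq ν (doubleCentered ν))
    (x : Fin n → EuclideanSpace ℝ (Fin p)) (y : Fin n → EuclideanSpace ℝ (Fin q)) :
    sampleDistCorr x y = uCorr (offDiag (normalizedKernel μ (doubleCentered μ)) x)
      (offDiag (normalizedKernel ν (doubleCentered ν)) y) := by
  rw [uCorr_div (Real.sqrt_pos.2 hV) (Real.sqrt_pos.2 hW) (offDiag_normalizedKernel x)
    (offDiag_normalizedKernel y), sampleDistCorr, uCorr, sampleDistCov_eq μ ν hn,
    sampleDistCov_eq μ μ hn, sampleDistCov_eq ν ν hn]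

lemma measurable_uCentered (k l : Fin n) :
    Measurable fun x : Fin n → EuclideanSpace ℝ (Fin p) => uCentered x k l := by
  unfold uCentered; fun_prop

lemma measurable_sampleDistCov {S : Type*} [MeasurableSpace S]
    {x : S → Fin n → EuclideanSpace ℝ (Fin p)} {y : S → Fin n → EuclideanSpace ℝ (Fin q)}
    (hx : Measurable x) (hy : Measurable y) : Measurable fun s => sampleDistCov (x s) (y s) := by
  unfold sampleDistCov
  refine (Finset.measurable_sum _ fun k _ => Finset.measurable_sum _ fun l _ => ?_).const_mul _
  split_ifs
  · exact ((measurable_uCentered k l).comp hx).mul ((measurable_uCentered k l).comp hy)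
  · exact measurable_const

lemma measurable_rescaledDistCorr : Measurable fun z : Fin n →
    EuclideanSpace ℝ (Fin p) × EuclideanSpace ℝ (Fin q) =>
      rescaledDistCorr (fun k => (z k).1) (fun k => (z k).2) := by
  have h1 : Measurable fun (z : Fin n → EuclideanSpace ℝ (Fin p) × EuclideanSpace ℝ (Fin q)) k =>
    (z k).1 := by fun_prop
  have h2 : Measurable fun (z : Fin n → EuclideanSpace ℝ (Fin p) × EuclideanSpace ℝ (Fin q)) k =>
    (z k).2 := by fun_prop
  unfold rescaledDistCorr sampleDistCorr
  have h := (measurable_sampleDistCov h1 h1).mul (measurable_sampleDistCov h2 h2)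
  exact (Measurable.ite (measurableSet_lt measurable_const h)
    ((measurable_sampleDistCov h1 h2).div h.sqrt) measurable_const).const_mul _

end SampleStatistics

/-! ### Characteristic function of $T_n$ and passage to the limit -/

section CharacteristicFunctionBound

/-- The error bound in the central limit theorem for the distance correlation, in terms of the
sample size `n`, the moment ratio `R` and the `g`-moment ratio `K`. -/
noncomputable def distCorrBound (τ t η : ℝ) (n : ℕ) (R K : ℝ) : ℝ :=
  4 * |t| * √η + 2 * ((16 / √n + 8 * η ^ 2 + 8 * (R / ((η ^ 2) ^ 2) ^ τ) + 20 / n) / η + η) +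
    (68 * t ^ 2 + 3072 * t ^ 4) * (η ^ 2 + R / ((η ^ 2) ^ 2) ^ τ + √K + 1 / n)

/-- Two successive limits. For fixed $\eta$ the bound tends to $4|t|\sqrt\eta+18\eta+C_t\eta^2$,
where $18\eta=2(8\eta^2/\eta+\eta)$; $\eta$ is chosen beforehand to make this small. -/
lemma tendsto_of_distCorrBound {ι : Type*} {l : Filter ι} {τ t : ℝ} {n : ι → ℕ}
    {R K : ι → ℝ} {φ : ι → ℂ} {c : ℂ} (hn : Tendsto n l atTop) (hR : Tendsto R l (𝓝 0))
    (hK : Tendsto K l (𝓝 0))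
    (h : ∀ i, 6 ≤ n i → ∀ η, 0 < η → η ≤ 1 / 2 →
      ‖φ i - c‖ ≤ distCorrBound τ t η (n i) (R i) (K i)) : Tendsto φ l (𝓝 c) := by
  rw [Metric.tendsto_nhds]
  intro e he
  have hL : Tendsto (fun η : ℝ => 4 * |t| * √η + 18 * η + (68 * t ^ 2 + 3072 * t ^ 4) * η ^ 2)
      (𝓝[>] 0) (𝓝 0) := by
    refine tendsto_nhdsWithin_of_tendsto_nhds (Continuous.tendsto' (by fun_prop) 0 0 (by simp))
  obtain ⟨η, hηe, hη0, hη⟩ := ((hL.eventually_lt_const he).and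
    (Ioc_mem_nhdsGT (show (0 : ℝ) < 1 / 2 by norm_num))).exists
  have hnR : Tendsto (fun i => (n i : ℝ)) l atTop := tendsto_natCast_atTop_atTop.comp hn
  have hs : Tendsto (fun i => 16 / √(n i : ℝ)) l (𝓝 0) :=
    (Real.tendsto_sqrt_atTop.comp hnR).const_div_atTop 16
  have h20 : Tendsto (fun i => 20 / (n i : ℝ)) l (𝓝 0) := hnR.const_div_atTop 20
  have h1n : Tendsto (fun i => 1 / (n i : ℝ)) l (𝓝 0) := hnR.const_div_atTop 1
  have hR' := hR.div_const (((η ^ 2) ^ 2) ^ τ)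
  have hK' := hK.sqrt
  have hB : Tendsto (fun i => distCorrBound τ t η (n i) (R i) (K i)) l
      (𝓝 (4 * |t| * √η + 2 * ((0 + 8 * η ^ 2 + 8 * (0 / ((η ^ 2) ^ 2) ^ τ) + 0) / η + η) +
        (68 * t ^ 2 + 3072 * t ^ 4) * (η ^ 2 + 0 / ((η ^ 2) ^ 2) ^ τ + √0 + 0))) := by
    unfold distCorrBound
    exact (((((((hs.add_const _).add (hR'.const_mul 8)).add h20).div_const η).add_const η).const_mul
      2).const_add _).add ((((hR'.const_add _).add hK').add h1n).const_mul _)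
  have hlim : 4 * |t| * √η + 2 * ((0 + 8 * η ^ 2 + 8 * (0 / ((η ^ 2) ^ 2) ^ τ) + 0) / η + η) +
        (68 * t ^ 2 + 3072 * t ^ 4) * (η ^ 2 + 0 / ((η ^ 2) ^ 2) ^ τ + √0 + 0) < e := by
    refine lt_of_eq_of_lt ?_ hηe
    rw [Real.sqrt_zero]
    field_simp
    ring
  filter_upwards [hB.eventually_lt_const hlim, hn.eventually_ge_atTop 6] with i hi hni
  rw [dist_eq_norm]
  exact (h i hni η hη0 hη).trans_lt hi

variable {p q n : ℕ} {Ω : Type*} [MeasurableSpace Ω] {P : Measure Ω} [IsProbabilityMeasure P]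
  {X : Ω → EuclideanSpace ℝ (Fin p)} {Y : Ω → EuclideanSpace ℝ (Fin q)}
  {XS : Fin n → Ω → EuclideanSpace ℝ (Fin p)} {YS : Fin n → Ω → EuclideanSpace ℝ (Fin q)} {τ : ℝ}

lemma aemeasurable_sample
    (hid : ∀ k, IdentDistrib (fun ω => (XS k ω, YS k ω)) (fun ω => (X ω, Y ω)) P P) :
    AEMeasurable (fun ω k => (XS k ω, YS k ω)) P :=
  aemeasurable_pi_lambda _ fun k => (hid k).aemeasurable_fst

lemma aemeasurable_rescaledDistCorr
    (hid : ∀ k, IdentDistrib (fun ω => (XS k ω, YS k ω)) (fun ω => (X ω, Y ω)) P P) :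
    AEMeasurable (fun ω => rescaledDistCorr (fun k => XS k ω) (fun k => YS k ω)) P :=
  Measurable.comp_aemeasurable (f := fun ω k => (XS k ω, YS k ω))
    (g := fun z : Fin n → EuclideanSpace ℝ (Fin p) × EuclideanSpace ℝ (Fin q) =>
      rescaledDistCorr (fun k => (z k).1) (fun k => (z k).2))
    measurable_rescaledDistCorr (aemeasurable_sample hid)

lemma map_sample_eq (hX : AEMeasurable X P) (hY : AEMeasurable Y P)
    (hind : iIndepFun (fun k ω => (XS k ω, YS k ω)) P)
    (hid : ∀ k, IdentDistrib (fun ω => (XS k ω, YS k ω)) (fun ω => (X ω, Y ω)) P P)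
    (hXY : IndepFun X Y P) :
    P.map (fun ω k => (XS k ω, YS k ω)) = Measure.pi fun _ => (P.map X).prod (P.map Y) := by
  rw [(iIndepFun_iff_map_fun_eq_pi_map fun k => (hid k).aemeasurable_fst).1 hind]
  congr 1; ext1 k
  rw [(hid k).map_eq, (indepFun_iff_map_prod_eq_prod_map_map hX hY).1 hXY]

lemma charFun_map_rescaledDistCorr (hX : AEMeasurable X P) (hY : AEMeasurable Y P)
    (hind : iIndepFun (fun k ω => (XS k ω, YS k ω)) P)
    (hid : ∀ k, IdentDistrib (fun ω => (XS k ω, YS k ω)) (fun ω => (X ω, Y ω)) P P)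
    (hXY : IndepFun X Y P) (t : ℝ) :
    charFun (P.map fun ω => rescaledDistCorr (fun k => XS k ω) (fun k => YS k ω)) t =
      ∫ z : Fin n → EuclideanSpace ℝ (Fin p) × EuclideanSpace ℝ (Fin q),
        Complex.exp (((t * rescaledDistCorr (fun k => (z k).1) (fun k => (z k).2) : ℝ) : ℂ) *
          Complex.I) ∂(Measure.pi fun _ => (P.map X).prod (P.map Y)) := by
  have hm := measurable_rescaledDistCorr (n := n) (p := p) (q := q)
  have hme : Measurable fun z : Fin n → EuclideanSpace ℝ (Fin p) × EuclideanSpace ℝ (Fin q) =>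
      Complex.exp (((t * rescaledDistCorr (fun k => (z k).1) (fun k => (z k).2) : ℝ) : ℂ) *
        Complex.I) :=
    Complex.measurable_exp.comp ((Complex.measurable_ofReal.comp (hm.const_mul t)).mul_const _)
  rw [← map_sample_eq hX hY hind hid hXY,
    integral_map (aemeasurable_sample hid) hme.aestronglyMeasurable,
    charFun_apply_real, integral_map (aemeasurable_rescaledDistCorr hid) (by fun_prop)]
  simp only [Complex.ofReal_mul]

/-- Normalized by $E\,d^2$, the moment and four-point ratios are at most the hypothesis ratios `R`
and `K`, as $\mathcal V^2\le E\,d^2$. Thus $K$ bounds the composed product kernel and $R$ all three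
tails. -/
lemma norm_charFun_rescaledDistCorr_sub_le (hX : AEMeasurable X P) (hY : AEMeasurable Y P)
    (hind : iIndepFun (fun k ω => (XS k ω, YS k ω)) P)
    (hid : ∀ k, IdentDistrib (fun ω => (XS k ω, YS k ω)) (fun ω => (X ω, Y ω)) P P)
    (hXY : IndepFun X Y P) (hτ : 0 < τ)
    (hXmom : Integrable (fun ω => ‖X ω‖ ^ (2 + 2 * τ)) P)
    (hYmom : Integrable (fun ω => ‖Y ω‖ ^ (2 + 2 * τ)) P)
    (hXpos : 0 < distVarSq P X) (hYpos : 0 < distVarSq P Y) (hn : 6 ≤ n) (t : ℝ) {η : ℝ}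
    (hη0 : 0 < η) (hη : η ≤ 1 / 2) :
    ‖charFun (P.map fun ω => rescaledDistCorr (fun k => XS k ω) (fun k => YS k ω)) t -
      (Real.exp (-(t ^ 2 / 2)) : ℂ)‖ ≤ distCorrBound τ t η n
        (doubleCenteredMoment (P.map X) (2 + 2 * τ) * doubleCenteredMoment (P.map Y) (2 + 2 * τ) /
          ((n : ℝ) ^ τ * (distVarSq P X * distVarSq P Y) ^ (1 + τ)))
        (gMoment (P.map X) * gMoment (P.map Y) / (distVarSq P X * distVarSq P Y) ^ 2) := by
  rw [charFun_map_rescaledDistCorr hX hY hind hid hXY]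
  have : IsProbabilityMeasure (P.map X) := Measure.isProbabilityMeasure_map hX
  have : IsProbabilityMeasure (P.map Y) := Measure.isProbabilityMeasure_map hY
  have mX : Integrable (fun x : EuclideanSpace ℝ (Fin p) => ‖x‖ ^ (2 + 2 * τ)) (P.map X) :=
    (integrable_map_measure (Measurable.aestronglyMeasurable (by fun_prop)) hX).2 hXmom
  have mY : Integrable (fun x : EuclideanSpace ℝ (Fin q) => ‖x‖ ^ (2 + 2 * τ)) (P.map Y) :=
    (integrable_map_measure (Measurable.aestronglyMeasurable (by fun_prop)) hY).2 hYmom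
  have dX := isDegenerateKernel_doubleCentered hτ mX
  have dY := isDegenerateKernel_doubleCentered hτ mY
  have iX := integrable_doubleCentered_rpow hτ mX
  have iY := integrable_doubleCentered_rpow hτ mY
  have vX := distVarSq_le hX (integrable_norm_of_rpow hτ mX) dX.memLp
  have vY := distVarSq_le hY (integrable_norm_of_rpow hτ mY) dY.memLp
  set μ := P.map X
  set ν := P.map Y
  have hV := hXpos.trans_le vX
  have hW := hYpos.trans_le vY
  have hVW : distVarSq P X * distVarSq P Y ≤
      kernelSq μ (doubleCentered μ) * kernelSq ν (doubleCentered ν) :=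
    mul_le_mul vX vY hYpos.le hV.le
  have hpos := mul_pos hXpos hYpos
  have hn' : (6 : ℝ) ≤ n := by exact_mod_cast hn
  have hn0 : (0 : ℝ) < n := by linarith
  have hnτ : 0 < (n : ℝ) ^ τ := by positivity
  set f := normalizedKernel μ (doubleCentered μ) with hfdef
  set g := normalizedKernel ν (doubleCentered ν) with hgdef
  have hf : IsDegenerateKernel μ f := dX.normalizedKernel
  have hg : IsDegenerateKernel ν g := dY.normalizedKernel
  have hf1 : kernelSq μ f = 1 := kernelSq_normalizedKernel hV
  have hg1 : kernelSq ν g = 1 := kernelSq_normalizedKernel hW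
  have jf : Integrable (fun p => |f p.1 p.2| ^ (2 + 2 * τ)) (μ.prod μ) := by
    simp only [hfdef, abs_normalizedKernel_rpow]; exact iX.div_const _
  have jg : Integrable (fun p => |g p.1 p.2| ^ (2 + 2 * τ)) (ν.prod ν) := by
    simp only [hgdef, abs_normalizedKernel_rpow]; exact iY.div_const _
  have of := one_le_kernelMoment hf.memLp hf1 hτ jf
  have og := one_le_kernelMoment hg.memLp hg1 hτ jg
  set R := doubleCenteredMoment μ (2 + 2 * τ) * doubleCenteredMoment ν (2 + 2 * τ) /
          ((n : ℝ) ^ τ * (distVarSq P X * distVarSq P Y) ^ (1 + τ)) with hR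
  set K := gMoment μ * gMoment ν / (distVarSq P X * distVarSq P Y) ^ 2 with hK
  have hmR : kernelMoment μ f (2 + 2 * τ) * kernelMoment ν g (2 + 2 * τ) / (n : ℝ) ^ τ ≤ R := by
    rw [hR, hfdef, hgdef, kernelMoment_normalizedKernel, kernelMoment_normalizedKernel,
      div_mul_div_comm, div_div, ← Real.mul_rpow hV.le hW.le, mul_comm ((n : ℝ) ^ τ),
      doubleCenteredMoment_eq, doubleCenteredMoment_eq]
    have a1 : 0 ≤ kernelMoment μ (doubleCentered μ) (2 + 2 * τ) :=
      integral_nonneg fun _ => by positivity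
    have a2 : 0 ≤ kernelMoment ν (doubleCentered ν) (2 + 2 * τ) :=
      integral_nonneg fun _ => by positivity
    gcongr
  have hKK : kernelSq (μ.prod ν) (composeKernel (μ.prod ν) (prodKernel f g)) ≤ K := by
    rw [composeKernel_prodKernel, kernelSq_prodKernel, hfdef, hgdef,
      kernelSq_composeKernel_normalizedKernel, kernelSq_composeKernel_normalizedKernel, hK,
      gMoment_eq dX, gMoment_eq dY, div_mul_div_comm, ← mul_pow]
    have a1 := kernelSq_nonneg (ρ := μ) (h := composeKernel μ (doubleCentered μ))
    have a2 := kernelSq_nonneg (ρ := ν) (h := composeKernel ν (doubleCentered ν))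
    gcongr
  have hη4 : 0 < (η ^ 2) ^ 2 := by positivity
  have hητ : 0 < ((η ^ 2) ^ 2) ^ τ := by positivity
  have hmul : ((η ^ 2) ^ 2 * (n : ℝ)) ^ τ = (n : ℝ) ^ τ * ((η ^ 2) ^ 2) ^ τ := by
    rw [Real.mul_rpow hη4.le hn0.le, mul_comm]
  have hgen : ∀ m : ℝ, m ≤ kernelMoment μ f (2 + 2 * τ) * kernelMoment ν g (2 + 2 * τ) →
      m / ((η ^ 2) ^ 2 * (n : ℝ)) ^ τ ≤ R / ((η ^ 2) ^ 2) ^ τ := by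
    intro m hm
    rw [hmul, ← div_div]
    exact div_le_div_of_nonneg_right ((div_le_div_of_nonneg_right hm hnτ.le).trans hmR) hητ.le
  -- The other marginal moment is at least 1, so multiplying by it only weakens the bound.
  have tf : tailSq μ f ((η ^ 2) ^ 2 * n) ≤ R / ((η ^ 2) ^ 2) ^ τ :=
    (tailSq_le hf.memLp hf.meas hτ jf (by positivity)).trans
      (hgen _ (le_mul_of_one_le_right (by linarith) og))
  have tg : tailSq ν g ((η ^ 2) ^ 2 * n) ≤ R / ((η ^ 2) ^ 2) ^ τ :=
    (tailSq_le hg.memLp hg.meas hτ jg (by positivity)).trans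
      (hgen _ (le_mul_of_one_le_left (by linarith) of))
  have hfg := hf.prodKernel hg
  have tfg : tailSq (μ.prod ν) (prodKernel f g) ((η ^ 2) ^ 2 * n) ≤ R / ((η ^ 2) ^ 2) ^ τ :=
    (tailSq_le hfg.memLp hfg.meas hτ (integrable_rpow_prodKernel jf jg) (by positivity)).trans
      (hgen _ (kernelMoment_prodKernel f g _).le)
  have key := norm_integral_exp_uCorr_sub_le hf hg hf1 hg1 hn t hη0 hη
  have e : ∀ z : Fin n → EuclideanSpace ℝ (Fin p) × EuclideanSpace ℝ (Fin q),
      rescaledDistCorr (fun k => (z k).1) (fun k => (z k).2) = √((n : ℝ) * (n - 1) / 2) *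
        uCorr (offDiag f fun i => (z i).1) (offDiag g fun i => (z i).2) := fun z => by
    rw [rescaledDistCorr, sampleDistCorr_eq (by omega) hV hW]
  simp only [e]
  refine key.trans ?_
  have hsK := Real.sqrt_le_sqrt hKK
  rw [distCorrBound]
  have h3 : 16 / √(n : ℝ) + (4 * η ^ 2 + 4 * tailSq μ f ((η ^ 2) ^ 2 * n) + 10 / n) +
      (4 * η ^ 2 + 4 * tailSq ν g ((η ^ 2) ^ 2 * n) + 10 / n) ≤
      16 / √n + 8 * η ^ 2 + 8 * (R / ((η ^ 2) ^ 2) ^ τ) + 20 / n := by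
    have : (10 : ℝ) / n + 10 / n = 20 / n := by ring
    linarith
  gcongr

end CharacteristicFunctionBound

theorem theorem1 {ι : Type*} (l : Filter ι) (n p q : ι → ℕ)
    (hn : Tendsto n l atTop) (hpq : Tendsto (fun i => p i + q i) l atTop)
    {Ω : ι → Type*} [∀ i, MeasurableSpace (Ω i)]
    (P : (i : ι) → Measure (Ω i)) [∀ i, IsProbabilityMeasure (P i)]
    (X : (i : ι) → Ω i → EuclideanSpace ℝ (Fin (p i)))
    (Y : (i : ι) → Ω i → EuclideanSpace ℝ (Fin (q i)))
    (hX : ∀ i, AEMeasurable (X i) (P i)) (hY : ∀ i, AEMeasurable (Y i) (P i))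
    (XS : (i : ι) → Fin (n i) → Ω i → EuclideanSpace ℝ (Fin (p i)))
    (YS : (i : ι) → Fin (n i) → Ω i → EuclideanSpace ℝ (Fin (q i)))
    (hiid_indep : ∀ i, iIndepFun (fun k ω => (XS i k ω, YS i k ω)) (P i))
    (hiid_ident : ∀ i k, IdentDistrib (fun ω => (XS i k ω, YS i k ω))
      (fun ω => (X i ω, Y i ω)) (P i) (P i))
    (hXY : ∀ i, IndepFun (X i) (Y i) (P i))
    (τ : ℝ) (hτ0 : 0 < τ) (hτ1 : τ ≤ 1)
    (hXmom : ∀ i, Integrable (fun ω => ‖X i ω‖ ^ (2 + 2 * τ)) (P i))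
    (hYmom : ∀ i, Integrable (fun ω => ‖Y i ω‖ ^ (2 + 2 * τ)) (P i))
    (hXpos : ∀ i, 0 < distVarSq (P i) (X i)) (hYpos : ∀ i, 0 < distVarSq (P i) (Y i))
    (hcond1 : Tendsto (fun i =>
      doubleCenteredMoment ((P i).map (X i)) (2 + 2 * τ) *
          doubleCenteredMoment ((P i).map (Y i)) (2 + 2 * τ) /
        ((n i : ℝ) ^ τ * (distVarSq (P i) (X i) * distVarSq (P i) (Y i)) ^ (1 + τ))) l (𝓝 0))
    (hcond2 : Tendsto (fun i =>
      gMoment ((P i).map (X i)) * gMoment ((P i).map (Y i)) /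
        (distVarSq (P i) (X i) * distVarSq (P i) (Y i)) ^ 2) l (𝓝 0)) :
    TendstoInDistribution
      (fun i ω => rescaledDistCorr (fun k => XS i k ω) (fun k => YS i k ω)) l
      (id : ℝ → ℝ) P (gaussianReal 0 1) := by
  refine ⟨fun i => aemeasurable_rescaledDistCorr (hiid_ident i), aemeasurable_id, ?_⟩
  -- `l` is an arbitrary filter, whereas the argument runs along sequences. Besides constants, only
  -- `n` and the two ratios enter the error bound, so `l` may be replaced by the coarser pullback of
  -- the product of `atTop` and two neighbourhood filters of 0. That filter is countably generated,
  -- hence sequences suffice and Lévy's continuity theorem applies to each.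
  have hl := hn.prodMk (hcond1.prodMk hcond2)
  rw [tendsto_iff_comap] at hl
  refine Tendsto.mono_left ?_ hl
  refine tendsto_of_seq_tendsto fun u hu => ?_
  have hu' := tendsto_comap.comp hu
  have hn' := tendsto_fst.comp hu'
  have h1' := (tendsto_fst.comp tendsto_snd).comp hu'
  have h2' := (tendsto_snd.comp tendsto_snd).comp hu'
  refine ProbabilityMeasure.tendsto_of_tendsto_charFun fun t => ?_
  have hc : charFun ((gaussianReal 0 1).map id) t = (Real.exp (-(t ^ 2 / 2)) : ℂ) := by
    rw [Measure.map_id, charFun_gaussianReal]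
    push_cast
    congr 1
    simp
  simp only [ProbabilityMeasure.coe_mk, hc]
  exact tendsto_of_distCorrBound (τ := τ) (t := t) hn' h1' h2' fun j hj η hη0 hη =>
    norm_charFun_rescaledDistCorr_sub_le (hX _) (hY _) (hiid_indep _) (hiid_ident _) (hXY _) hτ0
      (hXmom _) (hYmom _) (hXpos _) (hYpos _) hj t hη0 hη
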